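/- Let $[a,b]\subset[0,\infty)$ with $a<b$, and let $\varphi_1,\varphi_2:[a,b]\to\mathbb R$ be increasing (not necessarily strictly), continuously differentiable functions (one-sided derivatives at the end points; in particular they are Lipschitz) such that $\varphi_1+\varphi_2$ is strictly increasing and $\varphi_1'(x)+\varphi_2'(x)>0$ for all $x\in[a,b]\setminus\{0\}$. For a complex $3\times 3$ matrix $X$ put $|X|=(X^*X)^{1/2}$, let $\mathbb M_3[a,b]$ be the set of complex $3\times3$ matrices $X$ such that the spectrum of $|X|$ is contained in $[a,b]$, and for $X\in\mathbb M_3[a,b]$ set $\varphi(X)=\varphi_1(|X|)-\varphi_2(|X^*|)$ (functional calculus). Let $T\in\mathbb M_3[a,b]$, and assume that one of the following holds: 1. $a=0$ and $\ker T\neq\{0\}$; 2. $a>0$ and $\varphi_1,\varphi_2\in C^2[a,b]$. Then the initial value problem $$\frac{dX(t)}{dt}=[\varphi(X(t)),X(t)],\qquad X(0)=T,$$ has a unique global solution $X:[0,\infty)\to\mathbb M_3[a,b]$ (the flow $F^\varphi_t(T)=X(t)$), and $F^\varphi_t(T)$ converges to a normal matrix as $t\to\infty$. -/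

import Mathlib

namespace MatrixFlow

open Set Filter Topology
open scoped NNReal Matrix MatrixOrder

/-- The condition (C0): `φ₁`, `φ₂` are continuous and increasing on `[a, b]`, and `φ₁ + φ₂` is
strictly increasing there. -/
structure CondC0 (a b : ℝ) (φ₁ φ₂ : ℝ → ℝ) : Prop where
  continuousOn₁ : ContinuousOn φ₁ (Icc a b)
  continuousOn₂ : ContinuousOn φ₂ (Icc a b)
  monotoneOn₁ : MonotoneOn φ₁ (Icc a b)
  monotoneOn₂ : MonotoneOn φ₂ (Icc a b)
  strictMonoOn_add : StrictMonoOn (fun x => φ₁ x + φ₂ x) (Icc a b)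

/-- The condition (CL): (C0), and `φ₁`, `φ₂` are Lipschitz on `[a, b]`. -/
structure CondCL (a b : ℝ) (φ₁ φ₂ : ℝ → ℝ) : Prop extends CondC0 a b φ₁ φ₂ where
  lipschitzOn₁ : ∃ K : ℝ≥0, LipschitzOnWith K φ₁ (Icc a b)
  lipschitzOn₂ : ∃ K : ℝ≥0, LipschitzOnWith K φ₂ (Icc a b)

/-- The condition (C1): (CL), `φ₁, φ₂ ∈ C¹[a, b]`, and `φ₁' + φ₂' > 0` on `[a, b] \ {0}`
(with one-sided derivatives at the end points). -/
structure CondC1 (a b : ℝ) (φ₁ φ₂ : ℝ → ℝ) : Prop extends CondCL a b φ₁ φ₂ where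
  contDiffOn₁ : ContDiffOn ℝ 1 φ₁ (Icc a b)
  contDiffOn₂ : ContDiffOn ℝ 1 φ₂ (Icc a b)
  deriv_pos : ∀ x ∈ Icc a b \ {0},
    0 < derivWithin φ₁ (Icc a b) x + derivWithin φ₂ (Icc a b) x

/-- The set of complex `n × n` matrices `X` such that the spectrum of `|X| = (X^* X)^{1/2}` is
contained in `[a, b]`. -/
def matricesIn (n : ℕ) (a b : ℝ) : Set (Matrix (Fin n) (Fin n) ℂ) :=
  {X | spectrum ℝ (CFC.abs X) ⊆ Icc a b}

/-- `φ(X) = φ₁(|X|) - φ₂(|X^*|)`, by functional calculus. -/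
noncomputable def phi {n : ℕ} (φ₁ φ₂ : ℝ → ℝ) (X : Matrix (Fin n) (Fin n) ℂ) :
    Matrix (Fin n) (Fin n) ℂ :=
  cfc φ₁ (CFC.abs X) - cfc φ₂ (CFC.abs Xᴴ)

/-- `X : [0, ∞) → M_n[a, b]` is a global solution of the initial value problem
`X'(t) = [φ(X(t)), X(t)]`, `X(0) = T`. (Only the values of `X` on `[0, ∞)` matter.) -/
structure IsGlobalSolution {n : ℕ} (a b : ℝ) (φ₁ φ₂ : ℝ → ℝ) (T : Matrix (Fin n) (Fin n) ℂ)
    (X : ℝ → Matrix (Fin n) (Fin n) ℂ) : Prop where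
  init : X 0 = T
  mem : ∀ t ∈ Ici (0 : ℝ), X t ∈ matricesIn n a b
  hasDeriv : ∀ t ∈ Ici (0 : ℝ), HasDerivWithinAt X ⁅phi φ₁ φ₂ (X t), X t⁆ (Ici 0) t

/-- `X` is the flow `t ↦ F_t^φ(T)`, that is, the unique global solution on `[0, ∞)` of
`X'(t) = [φ(X(t)), X(t)]`, `X(0) = T`. -/
structure IsFlow {n : ℕ} (a b : ℝ) (φ₁ φ₂ : ℝ → ℝ) (T : Matrix (Fin n) (Fin n) ℂ)
    (X : ℝ → Matrix (Fin n) (Fin n) ℂ) : Prop where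
  isGlobalSolution : IsGlobalSolution a b φ₁ φ₂ T X
  unique : ∀ Z : ℝ → Matrix (Fin n) (Fin n) ℂ,
    IsGlobalSolution a b φ₁ φ₂ T Z → EqOn Z X (Ici 0)

/-- The flow `t ↦ F_t^φ(T)` exists and converges to a normal matrix as `t → ∞`. -/
def FlowConvergesToNormal {n : ℕ} (a b : ℝ) (φ₁ φ₂ : ℝ → ℝ)
    (T : Matrix (Fin n) (Fin n) ℂ) : Prop :=
  ∃ X : ℝ → Matrix (Fin n) (Fin n) ℂ, IsFlow a b φ₁ φ₂ T X ∧
    ∃ N : Matrix (Fin n) (Fin n) ℂ, IsStarNormal N ∧ Tendsto X atTop (𝓝 N)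

end MatrixFlow

/-! The equation is a Lax equation whose generator H = φ(X) is Hermitian. Since [H, ·] is a
derivation, every polynomial in X obeys the same linear commutator equation, so polynomial
identities satisfied by T persist along the flow. The quantitative side is read off a singular value
decomposition X = U S V*, where |X| = V S V* and |X*| = U S U*: traces pairing functions of these
two matrices become double sums with the doubly stochastic weights |(V*U) i j|².

Well-posedness. With φ₁, φ₂ extended to the line, X ↦ φ(X) is Lipschitz in the Frobenius norm
(`lipschitzWith_phi`), so a cut-off equation has global solutions. By the rearrangement inequality
the traces of (X*X)^p, and of the same powers for X⁻¹ when it exists, do not increase; as p → ∞ this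
keeps the singular values in [a, b] (`matricesIn_invariant`), and the cut-off is never felt.

Asymptotic normality. ‖X‖² decreases at rate 2D with D = Re tr φ(X)(X*X − XX*) ≥ 0. Barbalat's lemma
gives D → 0, and small D forces |X| and |X*| together (`norm_abs_sub_le_of_dissipation`), so every
cluster point is normal.

Convergence. Let P be an idempotent polynomial in X. Using PX = XP, the derivative of ‖P‖² is minus
a weighted square norm of [X, P − P*], up to an error which is small once |X| and |X*| are close
(`IsSVD.re_trace_phi_commutator`, `exists_schur_multiplier_bound`). For an idempotent, [X, P − P*]
controls P − P*, and ‖P − P*‖² is 2‖P‖² minus a constant of motion; hence ‖P − P*‖ decays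
exponentially (`exists_decay_rate`). The velocity [φ(X), P] is bounded by ‖P − P*‖, so P converges.
This applies to the spectral idempotents of X. At a cluster point the nilpotent part is normal and
nilpotent, hence zero, so the cluster point is the sum of the eigenvalues times the limits of the
idempotents. It is therefore unique, and the bounded orbit converges to it. -/

namespace MatrixFlow

open Set Filter Topology Polynomial
open scoped NNReal Matrix MatrixOrder ComplexOrder Matrix.Norms.Frobenius

variable {n : ℕ}

/-! ### Singular value decompositions and the functional calculus. -/

section

/-- The complex diagonal matrix with the given real diagonal. -/
def dg (f : Fin n → ℝ) : Matrix (Fin n) (Fin n) ℂ := Matrix.diagonal fun i => (f i : ℂ)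

lemma dg_mul_dg (f g : Fin n → ℝ) : dg f * dg g = dg (fun i => f i * g i) := by
  simp [dg, Matrix.diagonal_mul_diagonal]

lemma dg_add (f g : Fin n → ℝ) : dg f + dg g = dg (fun i => f i + g i) := by
  simp [dg, Matrix.diagonal_add]

@[simp] lemma conjTranspose_dg (f : Fin n → ℝ) : (dg f)ᴴ = dg f := by
  simp [dg, Matrix.diagonal_conjTranspose, Pi.star_def]

lemma posSemidef_dg {f : Fin n → ℝ} (hf : ∀ i, 0 ≤ f i) : (dg f).PosSemidef := by
  rw [dg, Matrix.posSemidef_diagonal_iff]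
  intro i
  exact_mod_cast hf i

/-- `X = U S V*` is a singular value decomposition of the square matrix `X`. -/
structure IsSVD (U V : Matrix (Fin n) (Fin n) ℂ) (s : Fin n → ℝ)
    (X : Matrix (Fin n) (Fin n) ℂ) : Prop where
  left : U ∈ Matrix.unitaryGroup (Fin n) ℂ
  right : V ∈ Matrix.unitaryGroup (Fin n) ℂ
  nonneg : ∀ i, 0 ≤ s i
  eq : X = U * dg s * Vᴴ

lemma unitary_conj_mul {U : Matrix (Fin n) (Fin n) ℂ} (hU : U ∈ Matrix.unitaryGroup (Fin n) ℂ) :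
    Uᴴ * U = 1 := Matrix.mem_unitaryGroup_iff'.1 hU

lemma unitary_mul_conj {U : Matrix (Fin n) (Fin n) ℂ} (hU : U ∈ Matrix.unitaryGroup (Fin n) ℂ) :
    U * Uᴴ = 1 := Matrix.mem_unitaryGroup_iff.1 hU

lemma unitary_cancel {U : Matrix (Fin n) (Fin n) ℂ} (hU : U ∈ Matrix.unitaryGroup (Fin n) ℂ)
    (Y : Matrix (Fin n) (Fin n) ℂ) : Uᴴ * (U * Y) = Y := by
  rw [← mul_assoc, unitary_conj_mul hU, one_mul]

lemma unitary_cancel' {U : Matrix (Fin n) (Fin n) ℂ} (hU : U ∈ Matrix.unitaryGroup (Fin n) ℂ)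
    (Y : Matrix (Fin n) (Fin n) ℂ) : U * (Uᴴ * Y) = Y := by
  rw [← mul_assoc, unitary_mul_conj hU, one_mul]

/-- If V diagonalises X*X, the columns of XV are pairwise orthogonal, with the singular values as
norms; normalising them yields U. -/
lemma exists_isSVD (X : Matrix (Fin n) (Fin n) ℂ) : ∃ U V s, IsSVD U V s X := by
  classical
  have hM : (Xᴴ * X).IsHermitian := Matrix.isHermitian_conjTranspose_mul_self X
  have hpos : (Xᴴ * X).PosSemidef := Matrix.posSemidef_conjTranspose_mul_self X
  set V : Matrix (Fin n) (Fin n) ℂ := hM.eigenvectorUnitary.1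
  have hV : V ∈ Matrix.unitaryGroup (Fin n) ℂ := hM.eigenvectorUnitary.2
  set m := hM.eigenvalues
  have hm : ∀ i, 0 ≤ m i := hpos.eigenvalues_nonneg
  have hspec : Xᴴ * X = V * dg m * Vᴴ := by
    have := hM.spectral_theorem
    rw [Unitary.conjStarAlgAut_apply] at this
    exact this
  have hG : (X * V)ᴴ * (X * V) = dg m := by
    rw [Matrix.conjTranspose_mul, mul_assoc, ← mul_assoc Xᴴ, hspec]
    simp only [mul_assoc, unitary_conj_mul hV, unitary_cancel hV, mul_one]
  let f : Fin n → EuclideanSpace ℂ (Fin n) := fun i => WithLp.toLp 2 ((X * V).col i)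
  have hin : ∀ i j, inner ℂ (f i) (f j) = dg m i j := by
    intro i j
    rw [← hG, Matrix.mul_apply, PiLp.inner_apply]
    exact Finset.sum_congr rfl fun k _ => by
      simp [f, Matrix.conjTranspose_apply, mul_comm]
  have horth : Pairwise fun i j => inner ℂ (f i) (f j) = 0 := by
    intro i j hij
    simp only [hin, dg]
    exact Matrix.diagonal_apply_ne _ hij
  have hcard : Module.finrank ℂ (EuclideanSpace ℂ (Fin n)) = Fintype.card (Fin n) := by simp
  -- On an orthogonal family Gram–Schmidt only normalises the nonzero vectors. The slots of the zero
  -- columns are filled arbitrarily, which is harmless because their singular values vanish.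
  let b := InnerProductSpace.gramSchmidtOrthonormalBasis hcard f
  have hnorm : ∀ i, ‖f i‖ = √(m i) := by
    intro i
    have h1 : ((‖f i‖ ^ 2 : ℝ) : ℂ) = (m i : ℂ) := by
      have := hin i i
      rw [inner_self_eq_norm_sq_to_K] at this
      simpa [dg] using this
    have h2 : ‖f i‖ ^ 2 = m i := by exact_mod_cast h1
    rw [← h2, Real.sqrt_sq (norm_nonneg _)]
  let U : Matrix (Fin n) (Fin n) ℂ := Matrix.of fun k i => b i k
  have hU : U ∈ Matrix.unitaryGroup (Fin n) ℂ := by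
    rw [Matrix.mem_unitaryGroup_iff']
    ext i j
    have := orthonormal_iff_ite.1 b.orthonormal i j
    rw [PiLp.inner_apply] at this
    rw [Matrix.mul_apply, Matrix.one_apply, ← this]
    exact Finset.sum_congr rfl fun k _ => by
      simp [U, mul_comm]
  refine ⟨U, V, fun i => √(m i), hU, hV, fun i => Real.sqrt_nonneg _, ?_⟩
  have hXV : X * V = U * dg fun i => √(m i) := by
    ext k i
    rw [dg, Matrix.mul_diagonal]
    by_cases hf : f i = 0
    · have h1 : (X * V) k i = f i k := rfl
      rw [h1, ← hnorm, hf]; simp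
    · have hb : b i = ((‖f i‖ : ℂ))⁻¹ • f i :=
        InnerProductSpace.gramSchmidtOrthonormalBasis_apply_of_orthogonal hcard horth hf
      have h1 : (X * V) k i = f i k := rfl
      have h2 : U k i = b i k := rfl
      have h3 : (‖f i‖ : ℂ) ≠ 0 := by exact_mod_cast (norm_ne_zero_iff.2 hf)
      rw [h1, h2, hb, ← hnorm]
      simp only [PiLp.smul_apply, smul_eq_mul]
      field_simp
  rw [← hXV, mul_assoc, unitary_mul_conj hV, mul_one]

lemma IsSVD.conjTranspose {U V : Matrix (Fin n) (Fin n) ℂ} {s : Fin n → ℝ}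
    {X : Matrix (Fin n) (Fin n) ℂ} (h : IsSVD U V s X) : IsSVD V U s Xᴴ := by
  refine ⟨h.right, h.left, h.nonneg, ?_⟩
  rw [h.eq]
  simp [Matrix.conjTranspose_mul, mul_assoc]

lemma IsSVD.conj_mul_self {U V : Matrix (Fin n) (Fin n) ℂ} {s : Fin n → ℝ}
    {X : Matrix (Fin n) (Fin n) ℂ} (h : IsSVD U V s X) :
    Xᴴ * X = V * dg (fun i => s i ^ 2) * Vᴴ := by
  rw [h.eq]
  simp only [Matrix.conjTranspose_mul, Matrix.conjTranspose_conjTranspose, conjTranspose_dg,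
    mul_assoc, unitary_cancel h.left]
  rw [← mul_assoc (dg s) (dg s), dg_mul_dg]
  simp only [pow_two]

lemma IsSVD.abs_eq {U V : Matrix (Fin n) (Fin n) ℂ} {s : Fin n → ℝ}
    {X : Matrix (Fin n) (Fin n) ℂ} (h : IsSVD U V s X) : CFC.abs X = V * dg s * Vᴴ := by
  rw [CFC.abs]
  refine CFC.sqrt_unique ?_ ?_
  · rw [Matrix.star_eq_conjTranspose, h.conj_mul_self]
    simp only [mul_assoc, unitary_cancel h.right]
    rw [← mul_assoc (dg s) (dg s), dg_mul_dg]
    simp only [pow_two]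
  · exact ((posSemidef_dg h.nonneg).mul_mul_conjTranspose_same V).nonneg

lemma spectrum_unitary_dg {V : Matrix (Fin n) (Fin n) ℂ}
    (hV : V ∈ Matrix.unitaryGroup (Fin n) ℂ) (s : Fin n → ℝ) :
    spectrum ℝ (V * dg s * Vᴴ) = Set.range s := by
  have h1 : spectrum ℝ (V * dg s * Vᴴ) = spectrum ℝ (dg s) :=
    Unitary.spectrum_star_right_conjugate (R := ℝ) (a := dg s) (U := ⟨V, hV⟩)
  rw [h1]
  have h2 : spectrum ℝ (dg s) = (fun x : ℝ => (x : ℂ)) ⁻¹' spectrum ℂ (dg s) :=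
    (spectrum.preimage_algebraMap (S := ℂ) (R := ℝ) (a := dg s)).symm
  rw [h2, dg, spectrum_diagonal]
  ext x
  simp

lemma aeval_dg (p : ℝ[X]) (s : Fin n → ℝ) : aeval (dg s) p = dg (fun i => p.eval (s i)) := by
  induction p using Polynomial.induction_on' with
  | add p q hp hq => simp [hp, hq, dg_add]
  | monomial k c =>
    rw [aeval_monomial]
    have : dg s ^ k = dg (fun i => s i ^ k) := by simp [dg, Matrix.diagonal_pow, Pi.pow_def]
    rw [this, Algebra.algebraMap_eq_smul_one, smul_mul_assoc, one_mul]
    ext i j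
    by_cases hij : i = j
    · subst hij; simp [dg]
    · simp [dg, hij]

/-- The spectrum is finite, so φ may be replaced by its Lagrange interpolant there, and polynomials
commute with unitary conjugation. -/
lemma cfc_unitary_dg {V : Matrix (Fin n) (Fin n) ℂ} (hV : V ∈ Matrix.unitaryGroup (Fin n) ℂ)
    (s : Fin n → ℝ) (φ : ℝ → ℝ) :
    cfc φ (V * dg s * Vᴴ) = V * dg (fun i => φ (s i)) * Vᴴ := by
  classical
  have hsa : IsSelfAdjoint (V * dg s * Vᴴ) := by
    rw [IsSelfAdjoint, Matrix.star_eq_conjTranspose]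
    simp [Matrix.conjTranspose_mul, mul_assoc]
  let p : ℝ[X] := Lagrange.interpolate (Finset.univ.image s) id φ
  have hp : ∀ i, p.eval (s i) = φ (s i) := fun i =>
    Lagrange.eval_interpolate_at_node φ (v := id) (Function.injective_id.injOn)
      (Finset.mem_image_of_mem s (Finset.mem_univ i))
  have h1 : cfc φ (V * dg s * Vᴴ) = cfc (fun x => p.eval x) (V * dg s * Vᴴ) := by
    refine cfc_congr fun x hx => ?_
    rw [spectrum_unitary_dg hV] at hx
    obtain ⟨i, rfl⟩ := hx
    exact (hp i).symm
  rw [h1, cfc_polynomial p _ hsa]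
  have h2 : aeval (V * dg s * Vᴴ) p = V * aeval (dg s) p * Vᴴ := by
    have h3 := Polynomial.aeval_algHom_apply
      (Unitary.conjStarAlgAut ℝ (Matrix (Fin n) (Fin n) ℂ) ⟨V, hV⟩).toAlgEquiv.toAlgHom (dg s) p
    exact h3
  rw [h2, aeval_dg]
  simp only [hp]

lemma IsSVD.phi_eq {U V : Matrix (Fin n) (Fin n) ℂ} {s : Fin n → ℝ}
    {X : Matrix (Fin n) (Fin n) ℂ} (h : IsSVD U V s X) (φ₁ φ₂ : ℝ → ℝ) :
    phi φ₁ φ₂ X = V * dg (fun i => φ₁ (s i)) * Vᴴ - U * dg (fun i => φ₂ (s i)) * Uᴴ := by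
  rw [phi, h.abs_eq, h.conjTranspose.abs_eq, cfc_unitary_dg h.right, cfc_unitary_dg h.left]

lemma IsSVD.mem_matricesIn {U V : Matrix (Fin n) (Fin n) ℂ} {s : Fin n → ℝ}
    {X : Matrix (Fin n) (Fin n) ℂ} (h : IsSVD U V s X) {a b : ℝ} :
    X ∈ matricesIn n a b ↔ ∀ i, s i ∈ Icc a b := by
  rw [matricesIn, mem_ofPred_eq, h.abs_eq, spectrum_unitary_dg h.right, range_subset_iff]

lemma phi_congr {a b : ℝ} {φ₁ φ₂ ψ₁ ψ₂ : ℝ → ℝ} (h₁ : EqOn φ₁ ψ₁ (Icc a b))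
    (h₂ : EqOn φ₂ ψ₂ (Icc a b)) {X : Matrix (Fin n) (Fin n) ℂ} (hX : X ∈ matricesIn n a b) :
    phi φ₁ φ₂ X = phi ψ₁ ψ₂ X := by
  obtain ⟨U, V, s, h⟩ := exists_isSVD X
  have hs := h.mem_matricesIn.1 hX
  rw [h.phi_eq, h.phi_eq]
  simp only [h₁ (hs _), h₂ (hs _)]

lemma conjTranspose_phi (φ₁ φ₂ : ℝ → ℝ) (X : Matrix (Fin n) (Fin n) ℂ) :
    (phi φ₁ φ₂ X)ᴴ = phi φ₁ φ₂ X := by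
  obtain ⟨U, V, s, h⟩ := exists_isSVD X
  rw [h.phi_eq]
  simp [Matrix.conjTranspose_mul, mul_assoc]

end

/-! ### Frobenius norm, rearrangement, and Lipschitz bounds for φ(X). -/

section

lemma frob_sq_eq_sum (X : Matrix (Fin n) (Fin n) ℂ) : ‖X‖ ^ 2 = ∑ i, ∑ j, ‖X i j‖ ^ 2 := by
  rw [Matrix.frobenius_norm_def, ← Real.sqrt_eq_rpow, Real.sq_sqrt]
  · simp
  · positivity

lemma frob_sq_eq_trace (X : Matrix (Fin n) (Fin n) ℂ) : ‖X‖ ^ 2 = (Xᴴ * X).trace.re := by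
  rw [frob_sq_eq_sum, Matrix.trace, Complex.re_sum, Finset.sum_comm]
  refine Finset.sum_congr rfl fun i _ => ?_
  rw [Matrix.diag_apply, Matrix.mul_apply, Complex.re_sum]
  refine Finset.sum_congr rfl fun j _ => ?_
  rw [Matrix.conjTranspose_apply, Complex.star_def, Complex.conj_mul', ← Complex.ofReal_pow,
    Complex.ofReal_re]

lemma norm_entry_le (X : Matrix (Fin n) (Fin n) ℂ) (i j : Fin n) : ‖X i j‖ ≤ ‖X‖ := by
  refine le_of_sq_le_sq ?_ (norm_nonneg _)
  rw [frob_sq_eq_sum]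
  exact (Finset.single_le_sum (f := fun j => ‖X i j‖ ^ 2) (fun j _ => sq_nonneg _)
    (Finset.mem_univ j)).trans (Finset.single_le_sum (f := fun i => ∑ j, ‖X i j‖ ^ 2)
      (fun i _ => Finset.sum_nonneg fun j _ => sq_nonneg _) (Finset.mem_univ i))

lemma norm_unitary_mul {U : Matrix (Fin n) (Fin n) ℂ} (hU : U ∈ Matrix.unitaryGroup (Fin n) ℂ)
    (X : Matrix (Fin n) (Fin n) ℂ) : ‖U * X‖ = ‖X‖ := by
  refine (pow_left_inj₀ (norm_nonneg _) (norm_nonneg _) two_ne_zero).1 ?_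
  rw [frob_sq_eq_trace, frob_sq_eq_trace, Matrix.conjTranspose_mul, mul_assoc, unitary_cancel hU]

lemma norm_mul_unitary {U : Matrix (Fin n) (Fin n) ℂ} (hU : U ∈ Matrix.unitaryGroup (Fin n) ℂ)
    (X : Matrix (Fin n) (Fin n) ℂ) : ‖X * U‖ = ‖X‖ := by
  refine (pow_left_inj₀ (norm_nonneg _) (norm_nonneg _) two_ne_zero).1 ?_
  rw [frob_sq_eq_trace, frob_sq_eq_trace, Matrix.conjTranspose_mul, Matrix.trace_mul_comm,
    mul_assoc, unitary_cancel' hU, Matrix.trace_mul_comm]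

lemma conjTranspose_mem_unitary {U : Matrix (Fin n) (Fin n) ℂ}
    (hU : U ∈ Matrix.unitaryGroup (Fin n) ℂ) : Uᴴ ∈ Matrix.unitaryGroup (Fin n) ℂ :=
  Unitary.star_mem hU

lemma norm_conj_unitary {U V : Matrix (Fin n) (Fin n) ℂ} (hU : U ∈ Matrix.unitaryGroup (Fin n) ℂ)
    (hV : V ∈ Matrix.unitaryGroup (Fin n) ℂ)
    (X : Matrix (Fin n) (Fin n) ℂ) : ‖Uᴴ * X * V‖ = ‖X‖ := by
  rw [norm_mul_unitary hV, norm_unitary_mul (conjTranspose_mem_unitary hU)]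

lemma abs_re_trace_mul_le (X Y : Matrix (Fin n) (Fin n) ℂ) :
    |(X * Y).trace.re| ≤ ‖X‖ * ‖Y‖ := by
  have h1 : |(X * Y).trace.re| ≤ ∑ i, ∑ j, ‖X i j‖ * ‖Y j i‖ := by
    refine (Complex.abs_re_le_norm _).trans ?_
    rw [Matrix.trace]
    refine (norm_sum_le _ _).trans (Finset.sum_le_sum fun i _ => ?_)
    rw [Matrix.diag_apply, Matrix.mul_apply]
    refine (norm_sum_le _ _).trans (Finset.sum_le_sum fun j _ => (norm_mul _ _).le)
  refine h1.trans (le_of_sq_le_sq ?_ (by positivity))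
  rw [mul_pow, frob_sq_eq_sum, frob_sq_eq_sum Y, Finset.sum_comm (f := fun i j => ‖Y i j‖ ^ 2)]
  simp only [← Finset.sum_product']
  exact Finset.sum_mul_sq_le_sq_mul_sq _ _ _

lemma sum_row_unitary {W : Matrix (Fin n) (Fin n) ℂ} (hW : W ∈ Matrix.unitaryGroup (Fin n) ℂ)
    (i : Fin n) : ∑ j, ‖W i j‖ ^ 2 = 1 := by
  have h : (W * Wᴴ) i i = 1 := by rw [unitary_mul_conj hW, Matrix.one_apply_eq]
  rw [Matrix.mul_apply] at h
  have h2 := congrArg Complex.re h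
  rw [Complex.re_sum, Complex.one_re] at h2
  rw [← h2]
  refine Finset.sum_congr rfl fun j _ => ?_
  rw [Matrix.conjTranspose_apply, Complex.star_def, Complex.mul_conj', ← Complex.ofReal_pow,
    Complex.ofReal_re]

lemma sum_col_unitary {W : Matrix (Fin n) (Fin n) ℂ} (hW : W ∈ Matrix.unitaryGroup (Fin n) ℂ)
    (j : Fin n) : ∑ i, ‖W i j‖ ^ 2 = 1 := by
  have := sum_row_unitary (conjTranspose_mem_unitary hW) j
  simpa [Matrix.conjTranspose_apply] using this

lemma re_trace_dg_mul (k l : Fin n → ℝ) (W : Matrix (Fin n) (Fin n) ℂ) :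
    (dg k * W * dg l * Wᴴ).trace.re = ∑ i, ∑ j, ‖W i j‖ ^ 2 * (k i * l j) := by
  rw [Matrix.trace, Complex.re_sum]
  refine Finset.sum_congr rfl fun i _ => ?_
  rw [Matrix.diag_apply, Matrix.mul_apply, Complex.re_sum]
  refine Finset.sum_congr rfl fun j _ => ?_
  rw [dg, dg, Matrix.mul_diagonal, Matrix.diagonal_mul, Matrix.conjTranspose_apply,
    Complex.star_def]
  have : (k i : ℂ) * W i j * l j * (starRingEnd ℂ) (W i j) =
      ((‖W i j‖ ^ 2 * (k i * l j) : ℝ) : ℂ) := by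
    push_cast
    rw [← Complex.mul_conj']; ring
  rw [this, Complex.ofReal_re]

/-- The trace pairing of functions of two positive matrices. -/
lemma re_trace_conj_dg_mul {U V : Matrix (Fin n) (Fin n) ℂ} (k l : Fin n → ℝ) :
    (V * dg k * Vᴴ * (U * dg l * Uᴴ)).trace.re =
      ∑ i, ∑ j, ‖(Vᴴ * U) i j‖ ^ 2 * (k i * l j) := by
  rw [← re_trace_dg_mul, mul_assoc V, mul_assoc V, Matrix.trace_mul_comm]
  simp only [Matrix.conjTranspose_mul, Matrix.conjTranspose_conjTranspose, mul_assoc]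

lemma norm_sq_dg_mul_sub (k l : Fin n → ℝ) (Y Z : Matrix (Fin n) (Fin n) ℂ) :
    ‖dg k * Y - Z * dg l‖ ^ 2 = ∑ i, ∑ j, ‖(k i : ℂ) * Y i j - l j * Z i j‖ ^ 2 := by
  rw [frob_sq_eq_sum]
  simp only [dg, Matrix.sub_apply, Matrix.mul_diagonal, Matrix.diagonal_mul, mul_comm (Z _ _)]

/-- In the bases V and U the difference has entries (k i − l j) W i j with W = V*U, so estimates on
such differences reduce to scalar estimates at pairs of singular values. -/
lemma norm_sq_conj_dg_sub {U V : Matrix (Fin n) (Fin n) ℂ}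
    (hU : U ∈ Matrix.unitaryGroup (Fin n) ℂ) (hV : V ∈ Matrix.unitaryGroup (Fin n) ℂ)
    (k l : Fin n → ℝ) :
    ‖V * dg k * Vᴴ - U * dg l * Uᴴ‖ ^ 2 =
      ∑ i, ∑ j, ‖(Vᴴ * U) i j‖ ^ 2 * (k i - l j) ^ 2 := by
  have h : Vᴴ * (V * dg k * Vᴴ - U * dg l * Uᴴ) * U = dg k * (Vᴴ * U) - (Vᴴ * U) * dg l := by
    simp only [mul_sub, sub_mul, mul_assoc, unitary_cancel hV, unitary_conj_mul hU, mul_one]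
  rw [← norm_conj_unitary hV hU, h, norm_sq_dg_mul_sub]
  refine Finset.sum_congr rfl fun i _ => Finset.sum_congr rfl fun j _ => ?_
  rw [← sub_mul, norm_mul, mul_pow, ← Complex.ofReal_sub, Complex.norm_real, Real.norm_eq_abs,
    sq_abs, mul_comm]

lemma mul_mem_unitary {U V : Matrix (Fin n) (Fin n) ℂ}
    (hU : U ∈ Matrix.unitaryGroup (Fin n) ℂ) (hV : V ∈ Matrix.unitaryGroup (Fin n) ℂ) :
    Vᴴ * U ∈ Matrix.unitaryGroup (Fin n) ℂ :=
  mul_mem (conjTranspose_mem_unitary hV) hU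

/-- The rearrangement inequality for doubly stochastic weights. -/
lemma sum_unitary_mul_le {W : Matrix (Fin n) (Fin n) ℂ} (hW : W ∈ Matrix.unitaryGroup (Fin n) ℂ)
    {k l : Fin n → ℝ} (hkl : Monovary k l) :
    ∑ i, ∑ j, ‖W i j‖ ^ 2 * (k i * l j) ≤ ∑ i, k i * l i := by
  let p : Matrix (Fin n) (Fin n) ℝ := Matrix.of fun i j => ‖W i j‖ ^ 2
  have hp : p ∈ doublyStochastic ℝ (Fin n) :=
    mem_doublyStochastic_iff_sum.2 ⟨fun i j => by simp only [p, Matrix.of_apply]; positivity,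
      sum_row_unitary hW, sum_col_unitary hW⟩
  -- Birkhoff's theorem reduces the claim to permutation matrices, where it is the classical
  -- rearrangement inequality.
  obtain ⟨w, hw0, hw1, hw⟩ := exists_eq_sum_perm_of_mem_doublyStochastic hp
  have h1 : ∀ i j, ‖W i j‖ ^ 2 = ∑ σ : Equiv.Perm (Fin n), w σ * σ.permMatrix ℝ i j := by
    intro i j
    have : p i j = (∑ σ : Equiv.Perm (Fin n), w σ • σ.permMatrix ℝ) i j := by rw [hw]
    rw [Matrix.sum_apply] at this
    exact this
  have h2 : ∑ i, ∑ j, ‖W i j‖ ^ 2 * (k i * l j) =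
      ∑ σ : Equiv.Perm (Fin n), w σ * ∑ i, k i * l (σ i) := by
    simp only [h1, Finset.sum_mul, Finset.mul_sum]
    rw [Finset.sum_congr rfl fun i _ => Finset.sum_comm, Finset.sum_comm]
    refine Finset.sum_congr rfl fun σ _ => Finset.sum_congr rfl fun i _ => ?_
    simp [Equiv.Perm.permMatrix, PEquiv.toMatrix_apply]
  rw [h2]
  calc ∑ σ : Equiv.Perm (Fin n), w σ * ∑ i, k i * l (σ i)
      ≤ ∑ σ : Equiv.Perm (Fin n), w σ * ∑ i, k i * l i :=
        Finset.sum_le_sum fun σ _ =>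
          mul_le_mul_of_nonneg_left hkl.sum_mul_comp_perm_le_sum_mul (hw0 σ)
    _ = ∑ i, k i * l i := by rw [← Finset.sum_mul, hw1, one_mul]

lemma re_trace_conj_dg_mul_self {V : Matrix (Fin n) (Fin n) ℂ}
    (hV : V ∈ Matrix.unitaryGroup (Fin n) ℂ) (k l : Fin n → ℝ) :
    (V * dg k * Vᴴ * (V * dg l * Vᴴ)).trace.re = ∑ i, k i * l i := by
  rw [re_trace_conj_dg_mul, unitary_conj_mul hV]
  simp [Matrix.one_apply, apply_ite]

/-- Source of the signs in the Lyapunov arguments: a function of |X| pairs with a comonotone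
function of |X| at least as strongly as with that function of |X*|. -/
lemma re_trace_rearrangement {U V : Matrix (Fin n) (Fin n) ℂ}
    (hU : U ∈ Matrix.unitaryGroup (Fin n) ℂ) (hV : V ∈ Matrix.unitaryGroup (Fin n) ℂ)
    {k l : Fin n → ℝ} (hkl : Monovary k l) :
    0 ≤ (V * dg k * Vᴴ * (V * dg l * Vᴴ - U * dg l * Uᴴ)).trace.re := by
  rw [mul_sub, Matrix.trace_sub, Complex.sub_re, re_trace_conj_dg_mul_self hV,
    re_trace_conj_dg_mul, sub_nonneg]
  exact sum_unitary_mul_le (mul_mem_unitary hU hV) hkl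

/-- Conjugating X − X' and its adjoint into the singular bases gives entries s y − s' z and s z − s'
y, with y, z entries of V*V' and U*U'. The sum of their squares exceeds (s − s')²(|y|² + |z|²) by 2
s s' |y − z|² ≥ 0. This makes the absolute value Lipschitz in the Frobenius norm. -/
lemma norm_sq_abs_sub_le {U V U' V' : Matrix (Fin n) (Fin n) ℂ} {s s' : Fin n → ℝ}
    {X X' : Matrix (Fin n) (Fin n) ℂ} (h : IsSVD U V s X) (h' : IsSVD U' V' s' X') :
    ‖V * dg s * Vᴴ - V' * dg s' * V'ᴴ‖ ^ 2 + ‖U * dg s * Uᴴ - U' * dg s' * U'ᴴ‖ ^ 2 ≤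
      2 * ‖X - X'‖ ^ 2 := by
  have e1 : Uᴴ * (X - X') * V' = dg s * (Vᴴ * V') - (Uᴴ * U') * dg s' := by
    rw [h.eq, h'.eq]
    simp only [mul_sub, sub_mul, mul_assoc, unitary_cancel h.left, unitary_conj_mul h'.right,
      mul_one]
  have e2 : Vᴴ * (X - X')ᴴ * U' = dg s * (Uᴴ * U') - (Vᴴ * V') * dg s' := by
    rw [h.eq, h'.eq]
    simp only [Matrix.conjTranspose_sub, Matrix.conjTranspose_mul, conjTranspose_dg,
      Matrix.conjTranspose_conjTranspose, mul_sub, sub_mul, mul_assoc, unitary_cancel h.right,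
      unitary_conj_mul h'.left, mul_one]
  have n1 : ‖X - X'‖ ^ 2 = ‖dg s * (Vᴴ * V') - (Uᴴ * U') * dg s'‖ ^ 2 := by
    rw [← e1, norm_conj_unitary h.left h'.right]
  have n2 : ‖X - X'‖ ^ 2 = ‖dg s * (Uᴴ * U') - (Vᴴ * V') * dg s'‖ ^ 2 := by
    rw [← e2, norm_conj_unitary h.right h'.left, Matrix.frobenius_norm_conjTranspose]
  have n3 : 2 * ‖X - X'‖ ^ 2 = ‖dg s * (Vᴴ * V') - (Uᴴ * U') * dg s'‖ ^ 2 +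
      ‖dg s * (Uᴴ * U') - (Vᴴ * V') * dg s'‖ ^ 2 := by rw [← n1, ← n2]; ring
  rw [n3, norm_sq_conj_dg_sub h'.right h.right, norm_sq_conj_dg_sub h'.left h.left,
    norm_sq_dg_mul_sub, norm_sq_dg_mul_sub, ← Finset.sum_add_distrib, ← Finset.sum_add_distrib]
  refine Finset.sum_le_sum fun i _ => ?_
  rw [← Finset.sum_add_distrib, ← Finset.sum_add_distrib]
  refine Finset.sum_le_sum fun j _ => ?_
  generalize (Vᴴ * V') i j = y
  generalize (Uᴴ * U') i j = z
  have hs := mul_nonneg (h.nonneg i) (h'.nonneg j)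
  simp only [← Complex.normSq_eq_norm_sq, Complex.normSq_apply, Complex.sub_re, Complex.sub_im,
    Complex.re_ofReal_mul, Complex.im_ofReal_mul]
  nlinarith [mul_nonneg hs (add_nonneg (sq_nonneg (y.re - z.re)) (sq_nonneg (y.im - z.im)))]

lemma norm_conj_dg_comp_sub_le {U V : Matrix (Fin n) (Fin n) ℂ}
    (hU : U ∈ Matrix.unitaryGroup (Fin n) ℂ) (hV : V ∈ Matrix.unitaryGroup (Fin n) ℂ)
    {φ : ℝ → ℝ} {K : ℝ≥0} (hφ : LipschitzWith K φ) (s s' : Fin n → ℝ) :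
    ‖V * dg (fun i => φ (s i)) * Vᴴ - U * dg (fun i => φ (s' i)) * Uᴴ‖ ≤
      K * ‖V * dg s * Vᴴ - U * dg s' * Uᴴ‖ := by
  refine le_of_sq_le_sq ?_ (by positivity)
  rw [mul_pow, norm_sq_conj_dg_sub hU hV, norm_sq_conj_dg_sub hU hV, Finset.mul_sum]
  refine Finset.sum_le_sum fun i _ => ?_
  rw [Finset.mul_sum]
  refine Finset.sum_le_sum fun j _ => ?_
  have h1 := hφ.dist_le_mul (s i) (s' j)
  rw [Real.dist_eq, Real.dist_eq] at h1
  have h2 : (φ (s i) - φ (s' j)) ^ 2 ≤ (K : ℝ) ^ 2 * (s i - s' j) ^ 2 := by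
    rw [← mul_pow, sq_le_sq, abs_mul, abs_of_nonneg K.coe_nonneg]
    exact h1
  calc _ ≤ ‖(Vᴴ * U) i j‖ ^ 2 * ((K : ℝ) ^ 2 * (s i - s' j) ^ 2) := by gcongr
    _ = _ := by ring

lemma norm_cfc_abs_sub_le {φ : ℝ → ℝ} {K : ℝ≥0} (hφ : LipschitzWith K φ)
    (X Y : Matrix (Fin n) (Fin n) ℂ) :
    ‖cfc φ (CFC.abs X) - cfc φ (CFC.abs Y)‖ ≤ 2 * K * ‖X - Y‖ := by
  obtain ⟨U, V, s, h⟩ := exists_isSVD X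
  obtain ⟨U', V', s', h'⟩ := exists_isSVD Y
  rw [h.abs_eq, h'.abs_eq, cfc_unitary_dg h.right, cfc_unitary_dg h'.right]
  refine (norm_conj_dg_comp_sub_le h'.right h.right hφ s s').trans ?_
  have h1 : ‖V * dg s * Vᴴ - V' * dg s' * V'ᴴ‖ ≤ 2 * ‖X - Y‖ := by
    refine le_of_sq_le_sq ?_ (by positivity)
    nlinarith [norm_sq_abs_sub_le h h', sq_nonneg ‖U * dg s * Uᴴ - U' * dg s' * U'ᴴ‖,
      sq_nonneg ‖X - Y‖]
  calc _ ≤ (K : ℝ) * (2 * ‖X - Y‖) := by gcongr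
    _ = _ := by ring

lemma lipschitzWith_phi {φ₁ φ₂ : ℝ → ℝ} {K : ℝ≥0} (h₁ : LipschitzWith K φ₁)
    (h₂ : LipschitzWith K φ₂) :
    LipschitzWith (4 * K) (phi φ₁ φ₂ : Matrix (Fin n) (Fin n) ℂ → _) := by
  refine LipschitzWith.of_dist_le_mul fun X Y => ?_
  rw [dist_eq_norm, dist_eq_norm]
  have e : phi φ₁ φ₂ X - phi φ₁ φ₂ Y = (cfc φ₁ (CFC.abs X) - cfc φ₁ (CFC.abs Y)) -
      (cfc φ₂ (CFC.abs Xᴴ) - cfc φ₂ (CFC.abs Yᴴ)) := by rw [phi, phi]; abel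
  have h3 := norm_cfc_abs_sub_le h₂ Xᴴ Yᴴ
  rw [← Matrix.conjTranspose_sub, Matrix.frobenius_norm_conjTranspose] at h3
  rw [e]
  refine (norm_sub_le _ _).trans ((add_le_add (norm_cfc_abs_sub_le h₁ X Y) h3).trans ?_)
  push_cast
  linarith

end

section

/-! ### Global solutions of cut-off equations. -/

section ODE

variable {E : Type*} [NormedAddCommGroup E]

/-- A bounded Lipschitz vector field has global forward solutions. -/
lemma exists_global_solution [NormedSpace ℝ E] [CompleteSpace E] {f : E → E} {C M : ℝ≥0} (hf : LipschitzWith C f)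
    (hM : ∀ x, ‖f x‖ ≤ M) (x₀ : E) :
    ∃ X : ℝ → E, X 0 = x₀ ∧ ∀ t ∈ Ici (0 : ℝ), HasDerivWithinAt X (f (X t)) (Ici 0) t := by
  have hex : ∀ N : ℕ, ∃ α : ℝ → E, α 0 = x₀ ∧
      ∀ t ∈ Icc (0 : ℝ) N, HasDerivWithinAt α (f (α t)) (Icc 0 N) t := by
    intro N
    have hN : (0 : ℝ) ≤ N := Nat.cast_nonneg N
    have hpl : IsPicardLindelof (fun _ => f) (⟨0, left_mem_Icc.2 hN⟩ : Icc (0 : ℝ) N) x₀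
        (M * N) 0 M C := by
      refine ⟨fun t _ => hf.lipschitzOnWith, fun x _ => continuousOn_const, fun t _ x _ => hM x, ?_⟩
      simp
    exact hpl.exists_eq_forall_mem_Icc_hasDerivWithinAt₀
  choose α hα0 hα using hex
  have huniq : ∀ m N : ℕ, m ≤ N → EqOn (α m) (α N) (Icc 0 m) := by
    intro m N hmN
    have hmN' : (m : ℝ) ≤ N := by exact_mod_cast hmN
    have key : ∀ k : ℕ, (m : ℝ) ≤ k → ContinuousOn (α k) (Icc 0 m) ∧
        ∀ t ∈ Ico (0 : ℝ) m, HasDerivWithinAt (α k) (f (α k t)) (Ici t) t := by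
      intro k hk
      refine ⟨fun t ht => ((hα k t ⟨ht.1, ht.2.trans hk⟩).continuousWithinAt).mono
        (Icc_subset_Icc_right hk), fun t ht => ?_⟩
      refine (hα k t ⟨ht.1, ht.2.le.trans hk⟩).mono_of_mem_nhdsWithin ?_
      exact mem_of_superset (Icc_mem_nhdsGE (ht.2.trans_le hk)) (Icc_subset_Icc_left ht.1)
    obtain ⟨c1, d1⟩ := key m le_rfl
    obtain ⟨c2, d2⟩ := key N hmN'
    exact ODE_solution_unique_of_mem_Icc_right (v := fun _ => f) (s := fun _ => univ) (K := C)
      (fun t _ => hf.lipschitzOnWith) c1 d1 (fun _ _ => mem_univ _) c2 d2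
      (fun _ _ => mem_univ _) ((hα0 m).trans (hα0 N).symm)
  -- Solutions on [0, N] agree where they overlap; at time t the one on [0, ⌈t⌉] is used, which near
  -- t equals the solution on any longer interval.
  refine ⟨fun t => α (⌈t⌉₊) t, by simp [hα0], fun t ht => ?_⟩
  have ht0 : (0 : ℝ) ≤ t := ht
  obtain ⟨N, hN⟩ := exists_nat_gt t
  have heq : ∀ u ∈ Icc (0 : ℝ) N, α (⌈u⌉₊) u = α N u := fun u hu =>
    huniq _ _ (Nat.ceil_le.2 hu.2) ⟨hu.1, Nat.le_ceil u⟩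
  have hnhds : Icc (0 : ℝ) N ∈ 𝓝[Ici 0] t :=
    mem_nhdsWithin.2 ⟨Iio (N : ℝ), isOpen_Iio, hN, fun u hu => ⟨hu.2, le_of_lt hu.1⟩⟩
  have h1 := (hα N t ⟨ht0, hN.le⟩).mono_of_mem_nhdsWithin hnhds
  rw [← heq t ⟨ht0, hN.le⟩] at h1
  exact h1.congr_of_eventuallyEq (eventually_of_mem hnhds heq) (heq t ⟨ht0, hN.le⟩)

/-- The scalar cut-off which is `1` on the ball of radius `R - 1` and `0` off that of radius `R`. -/
noncomputable def cutoff (R : ℝ) (x : E) : ℝ := max 0 (min 1 (R - ‖x‖))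

lemma cutoff_nonneg (R : ℝ) (x : E) : 0 ≤ cutoff R x := le_max_left _ _

lemma cutoff_le_one (R : ℝ) (x : E) : cutoff R x ≤ 1 := max_le zero_le_one (min_le_left _ _)

lemma cutoff_eq_one {R : ℝ} {x : E} (h : ‖x‖ ≤ R - 1) : cutoff R x = 1 := by
  rw [cutoff, min_eq_left (by linarith), max_eq_right zero_le_one]

lemma cutoff_eq_zero {R : ℝ} {x : E} (h : R ≤ ‖x‖) : cutoff R x = 0 :=
  max_eq_left ((min_le_right _ _).trans (by linarith))

lemma abs_cutoff_sub_le (R : ℝ) (x y : E) : |cutoff R x - cutoff R y| ≤ ‖x - y‖ := by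
  have h1 := abs_max_sub_max_le_max 0 (min 1 (R - ‖x‖)) 0 (min 1 (R - ‖y‖))
  have h2 := abs_min_sub_min_le_max 1 (R - ‖x‖) 1 (R - ‖y‖)
  have h3 : |R - ‖x‖ - (R - ‖y‖)| ≤ ‖x - y‖ := by
    rw [sub_sub_sub_cancel_left, abs_sub_comm]
    exact abs_norm_sub_norm_le x y
  rw [sub_self, abs_zero] at h1 h2
  exact h1.trans (max_le (norm_nonneg _) (h2.trans (max_le (norm_nonneg _) h3)))

lemma cutoff_smul_norm_le [NormedSpace ℝ E] {R M : ℝ} (hM0 : 0 ≤ M) {W : E → E} (hM : ∀ x, ‖x‖ ≤ R → ‖W x‖ ≤ M)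
    (x : E) : ‖cutoff R x • W x‖ ≤ M := by
  rcases le_total R ‖x‖ with h | h
  · rw [cutoff_eq_zero h]; simpa using hM0
  · rw [norm_smul, Real.norm_of_nonneg (cutoff_nonneg R x)]
    calc _ ≤ 1 * M := mul_le_mul (cutoff_le_one R x) (hM x h) (norm_nonneg _) zero_le_one
      _ = M := one_mul M

/-- Inside the ball the product rule gives M + C. If y lies outside, the cut-off at x is at most ‖x
− y‖, so no control of W outside the ball is needed. -/
lemma cutoff_smul_lipschitz [NormedSpace ℝ E] {R : ℝ} {M C : ℝ≥0} {W : E → E} (hM : ∀ x, ‖x‖ ≤ R → ‖W x‖ ≤ M)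
    (hC : ∀ x y, ‖x‖ ≤ R → ‖y‖ ≤ R → ‖W x - W y‖ ≤ C * ‖x - y‖) :
    LipschitzWith (M + C) fun x => cutoff R x • W x := by
  have one_side : ∀ x y : E, ‖x‖ ≤ R → R ≤ ‖y‖ →
      ‖cutoff R x • W x - cutoff R y • W y‖ ≤ (M + C) * ‖x - y‖ := by
    intro x y hx hy
    have h1 := abs_cutoff_sub_le R x y
    rw [cutoff_eq_zero hy, sub_zero] at h1
    rw [cutoff_eq_zero hy, zero_smul, sub_zero, norm_smul, Real.norm_eq_abs]
    calc _ ≤ ‖x - y‖ * M := mul_le_mul h1 (hM x hx) (norm_nonneg _) (norm_nonneg _)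
      _ ≤ _ := by nlinarith [mul_nonneg C.coe_nonneg (norm_nonneg (x - y))]
  refine LipschitzWith.of_dist_le_mul fun x y => ?_
  rw [dist_eq_norm, dist_eq_norm, NNReal.coe_add]
  rcases le_total R ‖x‖ with hx | hx <;> rcases le_total R ‖y‖ with hy | hy
  · rw [cutoff_eq_zero hx, cutoff_eq_zero hy]
    simp only [zero_smul, sub_zero, norm_zero]
    positivity
  · rw [← norm_neg, neg_sub, ← norm_neg (x - y), neg_sub]
    exact one_side y x hy hx
  · exact one_side x y hx hy
  · have e : cutoff R x • W x - cutoff R y • W y =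
        (cutoff R x - cutoff R y) • W x + cutoff R y • (W x - W y) := by
      rw [sub_smul, smul_sub]; abel
    rw [e]
    refine (norm_add_le _ _).trans ?_
    rw [norm_smul, norm_smul, Real.norm_eq_abs, Real.norm_of_nonneg (cutoff_nonneg R y), add_mul]
    refine add_le_add ?_ ?_
    · rw [mul_comm]
      exact mul_le_mul (hM x hx) (abs_cutoff_sub_le R x y) (abs_nonneg _) M.coe_nonneg
    · calc _ ≤ 1 * (C * ‖x - y‖) :=
            mul_le_mul (cutoff_le_one R y) (hC x y hx hy) (norm_nonneg _) zero_le_one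
        _ = _ := one_mul _

end ODE

/-! ### Commutator equations: invariant polynomial identities and derivatives of traces. -/

section Lax

lemma norm_lie_le (H X : Matrix (Fin n) (Fin n) ℂ) : ‖⁅H, X⁆‖ ≤ 2 * ‖H‖ * ‖X‖ := by
  rw [Ring.lie_def]
  refine (norm_sub_le _ _).trans ?_
  have h1 := norm_mul_le H X
  have h2 := norm_mul_le X H
  nlinarith

/-- [H, ·] obeys the Leibniz rule and kills scalars, so the equation passes from X to each
polynomial in X. -/
lemma HasDerivWithinAt.lie_aeval {X : ℝ → Matrix (Fin n) (Fin n) ℂ}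
    {H : Matrix (Fin n) (Fin n) ℂ} {S : Set ℝ} {t : ℝ} (h : HasDerivWithinAt X ⁅H, X t⁆ S t)
    (p : ℂ[X]) :
    HasDerivWithinAt (fun u => aeval (X u) p) ⁅H, aeval (X t) p⁆ S t := by
  induction p using Polynomial.induction_on with
  | C c =>
    simp only [aeval_C]
    have : ⁅H, algebraMap ℂ (Matrix (Fin n) (Fin n) ℂ) c⁆ = 0 := by
      rw [Ring.lie_def, sub_eq_zero]
      exact (Algebra.commutes c H).symm
    rw [this]
    exact hasDerivWithinAt_const _ _ _
  | add p q hp hq =>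
    have e : ⁅H, aeval (X t) (p + q)⁆ = ⁅H, aeval (X t) p⁆ + ⁅H, aeval (X t) q⁆ := by
      simp only [Ring.lie_def, map_add]
      noncomm_ring
    rw [e]
    simp only [map_add]
    exact hp.fun_add hq
  | monomial k c ih =>
    have e : ∀ Y : Matrix (Fin n) (Fin n) ℂ, aeval Y (C c * Polynomial.X ^ (k + 1)) =
        aeval Y (C c * Polynomial.X ^ k) * Y := by
      intro Y; simp [pow_succ, mul_assoc]
    simp only [e]
    have e' : ⁅H, aeval (X t) (C c * Polynomial.X ^ k) * X t⁆ =
        ⁅H, aeval (X t) (C c * Polynomial.X ^ k)⁆ * X t +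
          aeval (X t) (C c * Polynomial.X ^ k) * ⁅H, X t⁆ := by
      simp only [Ring.lie_def]
      noncomm_ring
    rw [e']
    exact ih.fun_mul h

/-- A solution of a bounded linear commutator equation which starts at zero vanishes. -/
lemma lie_solution_eq_zero {Y H : ℝ → Matrix (Fin n) (Fin n) ℂ} {C : ℝ}
    (h : ∀ t ∈ Ici (0 : ℝ), HasDerivWithinAt Y ⁅H t, Y t⁆ (Ici 0) t)
    (hC : ∀ t ∈ Ici (0 : ℝ), ‖H t‖ ≤ C) (h0 : Y 0 = 0) {t : ℝ} (ht : 0 ≤ t) : Y t = 0 := by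
  refine eq_zero_of_abs_deriv_le_mul_abs_self_of_eq_zero_right (K := 2 * C) (a := 0) (b := t)
    (f' := fun u => ⁅H u, Y u⁆) (fun u hu => ((h u hu.1).continuousWithinAt).mono Icc_subset_Ici_self)
    (fun u hu => (h u hu.1).mono (Ici_subset_Ici.2 hu.1)) h0 (fun u hu => ?_) t ⟨ht, le_rfl⟩
  refine (norm_lie_le _ _).trans ?_
  gcongr
  exact hC u hu.1

/-- Isospectrality in polynomial form. It transports invertibility, idempotency and nilpotency from
the initial value to all times. -/
lemma aeval_lie_solution_eq_zero {X H : ℝ → Matrix (Fin n) (Fin n) ℂ} {C : ℝ}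
    (h : ∀ t ∈ Ici (0 : ℝ), HasDerivWithinAt X ⁅H t, X t⁆ (Ici 0) t)
    (hC : ∀ t ∈ Ici (0 : ℝ), ‖H t‖ ≤ C) {p : ℂ[X]} (h0 : aeval (X 0) p = 0) {t : ℝ}
    (ht : 0 ≤ t) : aeval (X t) p = 0 :=
  lie_solution_eq_zero (fun u hu => HasDerivWithinAt.lie_aeval (h u hu) p) hC h0 ht

lemma hasDerivWithinAt_re_trace {Y : ℝ → Matrix (Fin n) (Fin n) ℂ}
    {D : Matrix (Fin n) (Fin n) ℂ} {S : Set ℝ} {t : ℝ} (h : HasDerivWithinAt Y D S t) :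
    HasDerivWithinAt (fun u => (Y u).trace.re) D.trace.re S t := by
  let L : Matrix (Fin n) (Fin n) ℂ →ₗ[ℝ] ℝ :=
    Complex.reLm ∘ₗ (Matrix.traceLinearMap (Fin n) ℝ ℂ)
  exact (LinearMap.toContinuousLinearMap L).hasFDerivAt.comp_hasDerivWithinAt t h

lemma hasDerivWithinAt_conjTranspose {Y : ℝ → Matrix (Fin n) (Fin n) ℂ}
    {D : Matrix (Fin n) (Fin n) ℂ} {S : Set ℝ} {t : ℝ} (h : HasDerivWithinAt Y D S t) :
    HasDerivWithinAt (fun u => (Y u)ᴴ) Dᴴ S t := by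
  exact h.star

lemma trace_pow_deriv {A : ℝ → Matrix (Fin n) (Fin n) ℂ}
    {D : Matrix (Fin n) (Fin n) ℂ} {S : Set ℝ} {t : ℝ} (h : HasDerivWithinAt A D S t) (p : ℕ) :
    HasDerivWithinAt (fun u => (A u ^ (p + 1)).trace.re) ((p + 1) * (A t ^ p * D).trace.re) S t := by
  -- A and D need not commute, so the derivative of a power has no short closed form. Tested under
  -- the trace against Z commuting with A, it behaves as in the commutative case; keeping Z general
  -- closes the induction.
  have key : ∀ q : ℕ, ∃ Q, HasDerivWithinAt (fun u => A u ^ q) Q S t ∧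
      ∀ Z, Commute (A t) Z → (Q * Z).trace = q * (A t ^ (q - 1) * D * Z).trace := by
    intro q
    induction q with
    | zero => exact ⟨0, by simp only [pow_zero]; exact hasDerivWithinAt_const _ _ _, by simp⟩
    | succ q ih =>
      obtain ⟨Q, hQ, hQ'⟩ := ih
      refine ⟨Q * A t + A t ^ q * D, by simp only [pow_succ]; exact hQ.fun_mul h, fun Z hZ => ?_⟩
      rw [add_mul, Matrix.trace_add, mul_assoc, hQ' _ ((Commute.refl _).mul_right hZ)]
      rcases q with _ | q
      · simp
      · have : (A t ^ q * D * (A t * Z)).trace = (A t ^ (q + 1) * D * Z).trace := by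
          rw [hZ.eq, ← mul_assoc, Matrix.trace_mul_comm, ← mul_assoc, ← mul_assoc, ← pow_succ']
        simp only [Nat.add_sub_cancel, this]
        push_cast; ring
  obtain ⟨Q, hQ, hQ'⟩ := key (p + 1)
  have h1 := hQ' 1 (Commute.one_right _)
  rw [mul_one, mul_one, Nat.add_sub_cancel] at h1
  have h2 := hasDerivWithinAt_re_trace hQ
  rw [h1] at h2
  convert h2 using 1
  rw [← Complex.ofReal_natCast, Complex.re_ofReal_mul]
  push_cast; ring

lemma mul_pow_mul_eq (X Z : Matrix (Fin n) (Fin n) ℂ) (p : ℕ) :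
    X * (Z * X) ^ p * Z = (X * Z) ^ (p + 1) := by
  induction p with
  | zero => simp
  | succ p ih => rw [pow_succ, pow_succ _ (p + 1), ← ih]; simp only [mul_assoc]

/-- Self-adjointness of H and cyclicity of the trace leave only the defect of normality of X.
Applied to X, to X⁻¹ and to idempotents, this produces the monotone quantities of the proof. -/
lemma lie_trace_pow_deriv {X : ℝ → Matrix (Fin n) (Fin n) ℂ}
    {H : Matrix (Fin n) (Fin n) ℂ} (hH : Hᴴ = H) {S : Set ℝ} {t : ℝ}
    (h : HasDerivWithinAt X ⁅H, X t⁆ S t) (p : ℕ) :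
    HasDerivWithinAt (fun u => (((X u)ᴴ * X u) ^ (p + 1)).trace.re)
      (2 * (p + 1) * (H * ((X t * (X t)ᴴ) ^ (p + 1) - ((X t)ᴴ * X t) ^ (p + 1))).trace.re) S t := by
  have h1 := trace_pow_deriv ((hasDerivWithinAt_conjTranspose h).fun_mul h) p
  convert h1 using 1
  generalize X t = Y
  rw [mul_comm (2 : ℝ), mul_assoc]
  congr 1
  have e : ⁅H, Y⁆ᴴ * Y + Yᴴ * ⁅H, Y⁆ =
      Yᴴ * H * Y + Yᴴ * H * Y - H * (Yᴴ * Y) - (Yᴴ * Y) * H := by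
    simp only [Ring.lie_def, Matrix.conjTranspose_sub, Matrix.conjTranspose_mul, hH]
    noncomm_ring
  rw [e]
  have e1 : ((Yᴴ * Y) ^ p * (Yᴴ * H * Y)).trace = (H * (Y * Yᴴ) ^ (p + 1)).trace := by
    rw [← mul_pow_mul_eq, Matrix.trace_mul_comm]
    have : Yᴴ * H * Y * (Yᴴ * Y) ^ p = Yᴴ * (H * (Y * (Yᴴ * Y) ^ p)) := by
      simp only [mul_assoc]
    rw [this, Matrix.trace_mul_comm]
    simp only [mul_assoc]
  have e2 : ((Yᴴ * Y) ^ p * (H * (Yᴴ * Y))).trace = (H * (Yᴴ * Y) ^ (p + 1)).trace := by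
    rw [Matrix.trace_mul_comm, mul_assoc, ← pow_succ']
  have e3 : ((Yᴴ * Y) ^ p * (Yᴴ * Y * H)).trace = (H * (Yᴴ * Y) ^ (p + 1)).trace := by
    rw [← mul_assoc, ← pow_succ, Matrix.trace_mul_comm]
  rw [mul_sub, mul_sub, mul_sub, mul_add, Matrix.trace_sub, Matrix.trace_sub, Matrix.trace_sub,
    Matrix.trace_add, e1, e2, e3]
  simp only [Complex.sub_re, Complex.add_re]
  ring

end Lax

end

/-! ### Invariance of the singular value interval; existence and uniqueness of the flow. -/

section

lemma conj_dg_pow {V : Matrix (Fin n) (Fin n) ℂ} (hV : V ∈ Matrix.unitaryGroup (Fin n) ℂ)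
    (m : Fin n → ℝ) (p : ℕ) : (V * dg m * Vᴴ) ^ p = V * dg (fun i => m i ^ p) * Vᴴ := by
  induction p with
  | zero =>
    have : dg (fun i => m i ^ 0) = 1 := by simp [dg]
    rw [this, mul_one, unitary_mul_conj hV, pow_zero]
  | succ p ih =>
    rw [pow_succ, ih]
    simp only [mul_assoc, unitary_cancel hV]
    rw [← mul_assoc (dg _) (dg _), dg_mul_dg]
    simp only [pow_succ]

lemma re_trace_conj_dg {V : Matrix (Fin n) (Fin n) ℂ} (hV : V ∈ Matrix.unitaryGroup (Fin n) ℂ)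
    (m : Fin n → ℝ) : (V * dg m * Vᴴ).trace.re = ∑ i, m i := by
  rw [Matrix.trace_mul_comm, unitary_cancel hV, dg, Matrix.trace_diagonal, Complex.re_sum]
  simp

variable {U V : Matrix (Fin n) (Fin n) ℂ} {s : Fin n → ℝ} {X : Matrix (Fin n) (Fin n) ℂ}

lemma IsSVD.norm_sq (h : IsSVD U V s X) : ‖X‖ ^ 2 = ∑ i, s i ^ 2 := by
  rw [frob_sq_eq_trace, h.conj_mul_self, re_trace_conj_dg h.right]

lemma norm_le_of_mem_matricesIn {a b : ℝ} (ha : 0 ≤ a) (hab : a < b) (hX : X ∈ matricesIn n a b) :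
    ‖X‖ ≤ n * b := by
  obtain ⟨U, V, s, h⟩ := exists_isSVD X
  have hs := h.mem_matricesIn.1 hX
  have hb : 0 ≤ b := ha.trans hab.le
  refine le_of_sq_le_sq ?_ (by positivity)
  rw [h.norm_sq]
  calc ∑ i, s i ^ 2 ≤ ∑ _i : Fin n, b ^ 2 :=
        Finset.sum_le_sum fun i _ => pow_le_pow_left₀ (h.nonneg i) (hs i).2 2
    _ = n * b ^ 2 := by simp
    _ ≤ (n * b) ^ 2 := by
      rw [mul_pow]
      gcongr
      exact_mod_cast Nat.le_self_pow two_ne_zero n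

/-- The minus sign in φ₁(|X|) − φ₂(|X*|) matches the exchange of U and V: each term is one instance
of the rearrangement inequality. -/
lemma IsSVD.re_trace_phi_mul_nonneg (h : IsSVD U V s X) {φ₁ φ₂ : ℝ → ℝ} {k : Fin n → ℝ}
    (h₁ : Monovary (fun i => φ₁ (s i)) k) (h₂ : Monovary (fun i => φ₂ (s i)) k) :
    0 ≤ (phi φ₁ φ₂ X * (V * dg k * Vᴴ - U * dg k * Uᴴ)).trace.re := by
  have e : phi φ₁ φ₂ X * (V * dg k * Vᴴ - U * dg k * Uᴴ) =
      V * dg (fun i => φ₁ (s i)) * Vᴴ * (V * dg k * Vᴴ - U * dg k * Uᴴ) +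
      U * dg (fun i => φ₂ (s i)) * Uᴴ * (U * dg k * Uᴴ - V * dg k * Vᴴ) := by
    rw [h.phi_eq]
    noncomm_ring
  rw [e, Matrix.trace_add, Complex.add_re]
  exact add_nonneg (re_trace_rearrangement h.left h.right h₁)
    (re_trace_rearrangement h.right h.left h₂)

/-- As p → ∞ the p-th root of c tends to 1, so trace bounds, with c the dimension, become bounds on
single singular values. -/
lemma le_of_pow_le_mul_pow {x b c : ℝ} (hb : 0 ≤ b) (hc : 0 ≤ c)
    (h : ∀ p : ℕ, (x ^ 2) ^ (p + 1) ≤ c * (b ^ 2) ^ (p + 1)) : x ≤ b := by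
  by_contra! hbx
  have hx : 0 < x := hb.trans_lt hbx
  have hy : b ^ 2 / x ^ 2 < 1 := by
    rw [div_lt_one (by positivity)]
    exact pow_lt_pow_left₀ hbx hb two_ne_zero
  have hy0 : 0 ≤ b ^ 2 / x ^ 2 := by positivity
  obtain ⟨N, hN⟩ := exists_pow_lt_of_lt_one (show (0 : ℝ) < 1 / (c + 1) by positivity) hy
  have h1 : (b ^ 2 / x ^ 2) ^ (N + 1) < 1 / (c + 1) :=
    (pow_le_pow_of_le_one hy0 hy.le (Nat.le_succ N)).trans_lt hN
  have h2 := h N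
  rw [div_pow, div_lt_div_iff₀ (by positivity) (by positivity), one_mul] at h1
  have h3 : 0 ≤ (b ^ 2) ^ (N + 1) := by positivity
  nlinarith

/-- Cayley–Hamilton: the constant coefficient of the characteristic polynomial is a nonzero multiple
of the determinant. Having the inverse as a polynomial makes it satisfy the same commutator
equation. -/
lemma exists_aeval_mul_eq_one {A : Matrix (Fin n) (Fin n) ℂ} (hA : A.det ≠ 0) :
    ∃ r : ℂ[X], aeval A (Polynomial.X * r - 1) = 0 := by
  set c := A.charpoly.coeff 0
  have hc : c ≠ 0 := by
    intro h0
    apply hA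
    rw [Matrix.det_eq_sign_charpoly_coeff]
    exact mul_eq_zero_of_right _ h0
  refine ⟨C (-c⁻¹) * A.charpoly.divX, ?_⟩
  have h1 : Polynomial.X * (C (-c⁻¹) * A.charpoly.divX) - 1 = C (-c⁻¹) * A.charpoly := by
    conv_rhs => rw [← Polynomial.divX_mul_X_add A.charpoly]
    rw [mul_add, ← C_mul]
    have : -c⁻¹ * A.charpoly.coeff 0 = -1 := by
      change -c⁻¹ * c = -1
      field_simp
    have hm1 : C (-1 : ℂ) = -1 := by simp
    rw [this, hm1]
    ring
  rw [h1, map_mul, Matrix.aeval_self_charpoly, mul_zero]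

lemma IsSVD.det_ne_zero (h : IsSVD U V s X) (hs : ∀ i, s i ≠ 0) : X.det ≠ 0 := by
  have hd : ∀ {W : Matrix (Fin n) (Fin n) ℂ}, W ∈ Matrix.unitaryGroup (Fin n) ℂ → W.det ≠ 0 := by
    intro W hW h0
    have := congrArg Matrix.det (unitary_mul_conj hW)
    rw [Matrix.det_mul, h0, zero_mul, Matrix.det_one] at this
    exact zero_ne_one this
  rw [h.eq, Matrix.det_mul, Matrix.det_mul, dg, Matrix.det_diagonal]
  refine mul_ne_zero (mul_ne_zero (hd h.left) ?_) (hd (conjTranspose_mem_unitary h.right))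
  exact Finset.prod_ne_zero_iff.2 fun i _ => by exact_mod_cast hs i

lemma IsSVD.ne_zero_of_mul_eq_one (h : IsSVD U V s X) {Y : Matrix (Fin n) (Fin n) ℂ}
    (hY : Y * X = 1) (i : Fin n) : s i ≠ 0 := by
  intro h0
  have e : V = Y * U * dg s := by
    calc V = Y * X * V := by rw [hY, one_mul]
      _ = _ := by rw [h.eq]; simp only [mul_assoc, unitary_conj_mul h.right, mul_one]
  have h1 := sum_col_unitary h.right i
  have h2 : ∀ k, V k i = 0 := by
    intro k
    rw [e, dg, Matrix.mul_diagonal, h0]; simp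
  simp [h2] at h1

lemma IsSVD.inv (h : IsSVD U V s X) {Y : Matrix (Fin n) (Fin n) ℂ} (hY : Y * X = 1) :
    IsSVD V U (fun i => (s i)⁻¹) Y := by
  refine ⟨h.right, h.left, fun i => inv_nonneg.2 (h.nonneg i), ?_⟩
  have hs := h.ne_zero_of_mul_eq_one hY
  have e : X * (V * dg (fun i => (s i)⁻¹) * Uᴴ) = 1 := by
    rw [h.eq]
    simp only [mul_assoc, unitary_cancel h.right]
    rw [← mul_assoc (dg s), dg_mul_dg]
    simp only [mul_inv_cancel₀ (hs _)]
    have : dg (fun _ : Fin n => (1 : ℝ)) = 1 := by simp [dg]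
    rw [this, one_mul, unitary_mul_conj h.left]
  calc Y = Y * (X * (V * dg (fun i => (s i)⁻¹) * Uᴴ)) := by rw [e, mul_one]
    _ = _ := by rw [← mul_assoc, hY, one_mul]

lemma antitoneOn_trace_pow {X H : ℝ → Matrix (Fin n) (Fin n) ℂ} (hH : ∀ t, (H t)ᴴ = H t)
    (hX : ∀ t ∈ Ici (0 : ℝ), HasDerivWithinAt X ⁅H t, X t⁆ (Ici 0) t) (p : ℕ)
    (hneg : ∀ t ∈ Ici (0 : ℝ),
      (H t * ((X t * (X t)ᴴ) ^ (p + 1) - ((X t)ᴴ * X t) ^ (p + 1))).trace.re ≤ 0) :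
    AntitoneOn (fun t => (((X t)ᴴ * X t) ^ (p + 1)).trace.re) (Ici 0) := by
  have hd := fun t ht => lie_trace_pow_deriv (hH t) (hX t ht) p
  refine antitoneOn_of_hasDerivWithinAt_nonpos (convex_Ici 0)
    (fun t ht => (hd t ht).continuousWithinAt)
    (fun t ht => (hd t (interior_subset ht)).mono interior_subset) fun t ht => ?_
  exact mul_nonpos_of_nonneg_of_nonpos (by positivity) (hneg t (interior_subset ht))

lemma trace_pow_le {b : ℝ} (hb : ∀ i, s i ≤ b) (h : IsSVD U V s X) (p : ℕ) :
    ((Xᴴ * X) ^ (p + 1)).trace.re ≤ n * (b ^ 2) ^ (p + 1) := by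
  rw [h.conj_mul_self, conj_dg_pow h.right, re_trace_conj_dg h.right]
  calc ∑ i, (s i ^ 2) ^ (p + 1) ≤ ∑ _i : Fin n, (b ^ 2) ^ (p + 1) :=
        Finset.sum_le_sum fun i _ => pow_le_pow_left₀ (sq_nonneg _)
          (pow_le_pow_left₀ (h.nonneg i) (hb i) 2) _
    _ = _ := by simp

lemma pow_le_trace_pow (h : IsSVD U V s X) (p : ℕ) (i : Fin n) :
    (s i ^ 2) ^ (p + 1) ≤ ((Xᴴ * X) ^ (p + 1)).trace.re := by
  rw [h.conj_mul_self, conj_dg_pow h.right, re_trace_conj_dg h.right]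
  exact Finset.single_le_sum (f := fun i => (s i ^ 2) ^ (p + 1)) (fun i _ => by positivity)
    (Finset.mem_univ i)

/-- The traces of (X*X)^(p+1) do not increase, which bounds the singular values above by b; for a >
0 the same argument for X⁻¹ bounds them below by a. The factor ρ admits the cut-off equation: only
its sign and a bound on the generator matter. -/
lemma matricesIn_invariant {a b : ℝ} (ha : 0 ≤ a) (hab : a < b) {φ₁ φ₂ : ℝ → ℝ}
    (h₁ : Monotone φ₁) (h₂ : Monotone φ₂) {X : ℝ → Matrix (Fin n) (Fin n) ℂ} {ρ : ℝ → ℝ}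
    (hρ : ∀ t, 0 ≤ ρ t) {C : ℝ} (hC : ∀ t ∈ Ici (0 : ℝ), ‖ρ t • phi φ₁ φ₂ (X t)‖ ≤ C)
    (hX : ∀ t ∈ Ici (0 : ℝ), HasDerivWithinAt X ⁅ρ t • phi φ₁ φ₂ (X t), X t⁆ (Ici 0) t)
    (h0 : X 0 ∈ matricesIn n a b) : ∀ t ∈ Ici (0 : ℝ), X t ∈ matricesIn n a b := by
  have hH : ∀ t, (ρ t • phi φ₁ φ₂ (X t))ᴴ = ρ t • phi φ₁ φ₂ (X t) := by
    intro t
    rw [Matrix.conjTranspose_smul, conjTranspose_phi, star_trivial]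
  obtain ⟨U₀, V₀, s₀, hs₀⟩ := exists_isSVD (X 0)
  have hm₀ := hs₀.mem_matricesIn.1 h0
  intro t ht
  obtain ⟨U, V, s, hs⟩ := exists_isSVD (X t)
  rw [hs.mem_matricesIn]
  have h0I : (0 : ℝ) ∈ Ici (0 : ℝ) := le_refl (0 : ℝ)
  intro i
  constructor
  · rcases ha.eq_or_lt with rfl | ha
    · exact hs.nonneg i
    have hd : (X 0).det ≠ 0 := hs₀.det_ne_zero fun i => (ha.trans_le (hm₀ i).1).ne'
    obtain ⟨r, hr⟩ := exists_aeval_mul_eq_one hd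
    let Y : ℝ → Matrix (Fin n) (Fin n) ℂ := fun u => aeval (X u) r
    have hYX : ∀ u ∈ Ici (0 : ℝ), Y u * X u = 1 := by
      intro u hu
      have := aeval_lie_solution_eq_zero hX hC hr hu
      rw [mul_comm, map_sub, map_mul, aeval_X, map_one, sub_eq_zero] at this
      exact this
    have hY : ∀ u ∈ Ici (0 : ℝ), HasDerivWithinAt Y ⁅ρ u • phi φ₁ φ₂ (X u), Y u⁆ (Ici 0) u :=
      fun u hu => HasDerivWithinAt.lie_aeval (hX u hu) r
    have hinv : (s i)⁻¹ ≤ a⁻¹ := by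
      refine le_of_pow_le_mul_pow (c := n) (by positivity) (by positivity) fun p => ?_
      have hanti := antitoneOn_trace_pow hH hY p fun u hu => by
        obtain ⟨U', V', s', hs'⟩ := exists_isSVD (X u)
        have hi := hs'.inv (hYX u hu)
        have e := hi.conjTranspose.conj_mul_self
        rw [Matrix.conjTranspose_conjTranspose] at e
        rw [e, hi.conj_mul_self, conj_dg_pow hs'.left, conj_dg_pow hs'.right]
        have hpos : ∀ j, 0 < s' j := fun j =>
          lt_of_le_of_ne (hs'.nonneg j) (hs'.ne_zero_of_mul_eq_one (hYX u hu) j).symm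
        -- Negative powers decrease in s, so the minus sign restores comonotonicity with φ. The
        -- exchange of U and V in the decomposition of the inverse compensates it.
        have hmono : ∀ φ : ℝ → ℝ, Monotone φ →
            Monovary (fun j => φ (s' j)) (fun j => -((s' j)⁻¹ ^ 2) ^ (p + 1)) := by
          intro φ hφ j k hjk
          refine hφ (le_of_not_gt fun hlt => ?_)
          have : ((s' j)⁻¹ ^ 2) ^ (p + 1) ≤ ((s' k)⁻¹ ^ 2) ^ (p + 1) := by
            have := (inv_lt_inv₀ (hpos j) (hpos k)).2 hlt
            have h3 := (inv_pos.2 (hpos j)).le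
            gcongr
          linarith
        have h4 := hs'.re_trace_phi_mul_nonneg (hmono φ₁ h₁) (hmono φ₂ h₂)
        have e5 : dg (fun j => -((s' j)⁻¹ ^ 2) ^ (p + 1)) =
            -dg (fun j => ((s' j)⁻¹ ^ 2) ^ (p + 1)) := by
          ext a b; by_cases hab : a = b <;> simp [dg, hab]
        rw [e5] at h4
        simp only [mul_neg, neg_mul, mul_add, mul_sub, Matrix.trace_sub, Matrix.trace_neg,
          Matrix.trace_add, Complex.add_re, Complex.sub_re,
          Complex.neg_re, sub_neg_eq_add, smul_mul_assoc, Matrix.trace_smul, Complex.smul_re,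
          smul_eq_mul] at h4 ⊢
        nlinarith [hρ u]
      have hi := hs.inv (hYX t ht)
      have hi₀ := hs₀.inv (hYX 0 h0I)
      exact (pow_le_trace_pow hi p i).trans ((hanti h0I ht ht).trans
        (trace_pow_le (fun j => inv_anti₀ ha (hm₀ j).1) hi₀ p))
    exact (inv_le_inv₀ (lt_of_le_of_ne (hs.nonneg i)
      (hs.ne_zero_of_mul_eq_one (hYX t ht) i).symm) ha).1 hinv
  · refine le_of_pow_le_mul_pow (c := n) (ha.trans hab.le) (by positivity) fun p => ?_
    have hanti := antitoneOn_trace_pow hH hX p fun u hu => by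
      obtain ⟨U', V', s', hs'⟩ := exists_isSVD (X u)
      have e := hs'.conjTranspose.conj_mul_self
      rw [Matrix.conjTranspose_conjTranspose] at e
      rw [e, hs'.conj_mul_self, conj_dg_pow hs'.left, conj_dg_pow hs'.right]
      have hmono : ∀ φ : ℝ → ℝ, Monotone φ →
          Monovary (fun j => φ (s' j)) (fun j => (s' j ^ 2) ^ (p + 1)) := by
        intro φ hφ j k hjk
        refine hφ (le_of_not_gt fun hlt => ?_)
        have : (s' k ^ 2) ^ (p + 1) ≤ (s' j ^ 2) ^ (p + 1) := by
          have h3 := hs'.nonneg k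
          gcongr
        linarith
      have h4 := hs'.re_trace_phi_mul_nonneg (hmono φ₁ h₁) (hmono φ₂ h₂)
      simp only [mul_sub, Matrix.trace_sub, Complex.sub_re, smul_mul_assoc, Matrix.trace_smul,
        Complex.smul_re, smul_eq_mul] at h4 ⊢
      nlinarith [hρ u]
    exact (pow_le_trace_pow hs p i).trans ((hanti h0I ht ht).trans
      (trace_pow_le (fun j => (hm₀ j).2) hs₀ p))

lemma norm_phi_le {φ₁ φ₂ : ℝ → ℝ} {K : ℝ≥0} (h₁ : LipschitzWith K φ₁) (h₂ : LipschitzWith K φ₂)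
    (X : Matrix (Fin n) (Fin n) ℂ) :
    ‖phi φ₁ φ₂ X‖ ≤ ‖phi φ₁ φ₂ (0 : Matrix (Fin n) (Fin n) ℂ)‖ + 4 * K * ‖X‖ := by
  have h := (lipschitzWith_phi (n := n) h₁ h₂).dist_le_mul X 0
  rw [dist_eq_norm, dist_eq_norm, sub_zero] at h
  push_cast at h
  have := norm_le_norm_add_norm_sub' (phi φ₁ φ₂ X) (phi φ₁ φ₂ 0)
  linarith

/-- The vector field `X ↦ [φ(X), X]` is Lipschitz on balls. -/
lemma norm_lie_phi_sub_le {φ₁ φ₂ : ℝ → ℝ} {K : ℝ≥0} (h₁ : LipschitzWith K φ₁)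
    (h₂ : LipschitzWith K φ₂) {R P : ℝ} {X Y : Matrix (Fin n) (Fin n) ℂ} (hX : ‖X‖ ≤ R)
    (hY : ‖phi φ₁ φ₂ Y‖ ≤ P) :
    ‖⁅phi φ₁ φ₂ X, X⁆ - ⁅phi φ₁ φ₂ Y, Y⁆‖ ≤ (8 * K * R + 2 * P) * ‖X - Y‖ := by
  have e : ⁅phi φ₁ φ₂ X, X⁆ - ⁅phi φ₁ φ₂ Y, Y⁆ =
      ⁅phi φ₁ φ₂ X - phi φ₁ φ₂ Y, X⁆ + ⁅phi φ₁ φ₂ Y, X - Y⁆ := by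
    simp only [Ring.lie_def]; noncomm_ring
  rw [e]
  have h3 := (lipschitzWith_phi (n := n) h₁ h₂).dist_le_mul X Y
  rw [dist_eq_norm, dist_eq_norm] at h3
  push_cast at h3
  have h4 := norm_lie_le (phi φ₁ φ₂ X - phi φ₁ φ₂ Y) X
  have h5 := norm_lie_le (phi φ₁ φ₂ Y) (X - Y)
  have h6 : 2 * ‖phi φ₁ φ₂ X - phi φ₁ φ₂ Y‖ * ‖X‖ ≤ 2 * (4 * K * ‖X - Y‖) * R := by gcongr
  have h7 : 2 * ‖phi φ₁ φ₂ Y‖ * ‖X - Y‖ ≤ 2 * P * ‖X - Y‖ := by gcongr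
  refine (norm_add_le _ _).trans ?_
  linarith

/-- The cut-off is scalar, so the cut-off equation is still a commutator equation with Hermitian
generator. Invariance then keeps its solution where the cut-off equals 1. -/
lemma exists_isGlobalSolution {a b : ℝ} (ha : 0 ≤ a) (hab : a < b) {φ₁ φ₂ : ℝ → ℝ}
    (m₁ : Monotone φ₁) (m₂ : Monotone φ₂) {K : ℝ≥0} (h₁ : LipschitzWith K φ₁)
    (h₂ : LipschitzWith K φ₂) {T : Matrix (Fin n) (Fin n) ℂ} (hT : T ∈ matricesIn n a b) :
    ∃ X, IsGlobalSolution a b φ₁ φ₂ T X := by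
  have hb : 0 ≤ b := ha.trans hab.le
  -- Matrices with singular values at most b have norm at most n b = R − 1, inside the region where
  -- the cut-off is 1.
  set R : ℝ≥0 := ⟨n * b + 1, by positivity⟩
  set P : ℝ≥0 := ‖phi φ₁ φ₂ (0 : Matrix (Fin n) (Fin n) ℂ)‖₊ + 4 * K * R
  have hP : ∀ X : Matrix (Fin n) (Fin n) ℂ, ‖X‖ ≤ R → ‖phi φ₁ φ₂ X‖ ≤ P := by
    intro X hX
    refine (norm_phi_le h₁ h₂ X).trans ?_
    simp only [P, NNReal.coe_add, NNReal.coe_mul, coe_nnnorm, NNReal.coe_ofNat]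
    gcongr
  have hM : ∀ X : Matrix (Fin n) (Fin n) ℂ, ‖X‖ ≤ R → ‖⁅phi φ₁ φ₂ X, X⁆‖ ≤ (2 * P * R : ℝ≥0) := by
    intro X hX
    refine (norm_lie_le _ _).trans ?_
    push_cast
    gcongr
    exact hP X hX
  have hL := cutoff_smul_lipschitz (R := R) (M := 2 * P * R) (C := 8 * K * R + 2 * P)
    (W := fun X : Matrix (Fin n) (Fin n) ℂ => ⁅phi φ₁ φ₂ X, X⁆) hM fun X Y hX hY => by
      push_cast
      exact norm_lie_phi_sub_le h₁ h₂ hX (hP Y hY)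
  obtain ⟨X, hX0, hX⟩ := exists_global_solution hL (cutoff_smul_norm_le (2 * P * R).2 hM) T
  have hX' : ∀ t ∈ Ici (0 : ℝ),
      HasDerivWithinAt X ⁅cutoff R (X t) • phi φ₁ φ₂ (X t), X t⁆ (Ici 0) t := by
    intro t ht
    have e : ⁅cutoff R (X t) • phi φ₁ φ₂ (X t), X t⁆ =
        cutoff R (X t) • ⁅phi φ₁ φ₂ (X t), X t⁆ := by
      simp only [Ring.lie_def, smul_sub, smul_mul_assoc, mul_smul_comm]
    rw [e]
    exact hX t ht
  have hmem := matricesIn_invariant ha hab m₁ m₂ (fun t => cutoff_nonneg R (X t))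
    (fun t _ => cutoff_smul_norm_le P.2 hP (X t)) hX' (hX0 ▸ hT)
  refine ⟨X, hX0, hmem, fun t ht => ?_⟩
  have h := hX' t ht
  rw [cutoff_eq_one, one_smul] at h
  · exact h
  · have := norm_le_of_mem_matricesIn ha hab (hmem t ht)
    change _ ≤ n * b + 1 - 1
    linarith

lemma isGlobalSolution_unique {a b : ℝ} (ha : 0 ≤ a) (hab : a < b) {φ₁ φ₂ : ℝ → ℝ}
    {K : ℝ≥0} (h₁ : LipschitzWith K φ₁) (h₂ : LipschitzWith K φ₂)
    {T : Matrix (Fin n) (Fin n) ℂ} {X Z : ℝ → Matrix (Fin n) (Fin n) ℂ}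
    (hX : IsGlobalSolution a b φ₁ φ₂ T X) (hZ : IsGlobalSolution a b φ₁ φ₂ T Z) :
    EqOn Z X (Ici 0) := by
  have hb : 0 ≤ b := ha.trans hab.le
  set R : ℝ≥0 := ⟨n * b, by positivity⟩
  set P : ℝ≥0 := ‖phi φ₁ φ₂ (0 : Matrix (Fin n) (Fin n) ℂ)‖₊ + 4 * K * R
  have hR : ∀ X ∈ matricesIn n a b, ‖X‖ ≤ R := fun X hX => norm_le_of_mem_matricesIn ha hab hX
  have hP : ∀ X ∈ matricesIn n a b, ‖phi φ₁ φ₂ X‖ ≤ P := by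
    intro X hX
    refine (norm_phi_le h₁ h₂ X).trans ?_
    simp only [P, NNReal.coe_add, NNReal.coe_mul, coe_nnnorm, NNReal.coe_ofNat]
    gcongr
    exact hR X hX
  have hL : LipschitzOnWith (8 * K * R + 2 * P)
      (fun X : Matrix (Fin n) (Fin n) ℂ => ⁅phi φ₁ φ₂ X, X⁆) (matricesIn n a b) :=
    LipschitzOnWith.of_dist_le_mul fun X hX Y hY => by
      rw [dist_eq_norm, dist_eq_norm]
      push_cast
      exact norm_lie_phi_sub_le h₁ h₂ (hR X hX) (hP Y hY)
  have aux : ∀ {Y : ℝ → Matrix (Fin n) (Fin n) ℂ}, IsGlobalSolution a b φ₁ φ₂ T Y → ∀ t : ℝ,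
      ContinuousOn Y (Icc 0 t) ∧ (∀ u ∈ Ico (0 : ℝ) t,
        HasDerivWithinAt Y ⁅phi φ₁ φ₂ (Y u), Y u⁆ (Ici u) u) := fun hY t =>
    ⟨fun u hu => ((hY.hasDeriv u hu.1).continuousWithinAt).mono Icc_subset_Ici_self,
      fun u hu => (hY.hasDeriv u hu.1).mono (Ici_subset_Ici.2 hu.1)⟩
  intro t ht
  exact ODE_solution_unique_of_mem_Icc_right (v := fun _ X => ⁅phi φ₁ φ₂ X, X⁆)
    (s := fun _ => matricesIn n a b) (fun _ _ => hL) (aux hZ t).1 (aux hZ t).2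
    (fun u hu => hZ.mem u hu.1) (aux hX t).1 (aux hX t).2 (fun u hu => hX.mem u hu.1)
    (hZ.init.trans hX.init.symm) ⟨ht, le_rfl⟩

end

/-! ### Dissipation of ‖X‖² and asymptotic normality. -/

section

/-- Barbalat's lemma for a dissipation identity: if `E ≥ 0` has derivative `-2 D` with `D ≥ 0`
Lipschitz, then `D` tends to zero. -/
lemma tendsto_zero_of_dissipation {E D : ℝ → ℝ} {L : ℝ}
    (hE : ∀ t ∈ Ici (0 : ℝ), HasDerivWithinAt E (-2 * D t) (Ici 0) t)
    (hE0 : ∀ t, 0 ≤ E t) (hD0 : ∀ t ∈ Ici (0 : ℝ), 0 ≤ D t)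
    (hD : ∀ t ∈ Ici (0 : ℝ), ∀ u ∈ Ici (0 : ℝ), |D t - D u| ≤ L * |t - u|) :
    Tendsto D atTop (𝓝 0) := by
  have hL : 0 ≤ L := by
    have := hD 1 (by simp) 0 (by simp)
    simp only [sub_zero, abs_one, mul_one] at this
    exact (abs_nonneg _).trans this
  have hanti : AntitoneOn E (Ici 0) :=
    antitoneOn_of_hasDerivWithinAt_nonpos (convex_Ici 0)
      (fun t ht => (hE t ht).continuousWithinAt)
      (fun t ht => (hE t (interior_subset ht)).mono interior_subset)
      fun t ht => by have := hD0 t (interior_subset ht); linarith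
  -- On [t, t + δ] the rate stays above D t − Lδ, so E loses at least 2δ times that amount; but E
  -- converges.
  have hstep : ∀ t ∈ Ici (0 : ℝ), ∀ δ > 0, 2 * δ * (D t - L * δ) ≤ E t - E (t + δ) := by
    intro t ht δ hδ
    have ht0 : (0 : ℝ) ≤ t := ht
    have hsub : Icc t (t + δ) ⊆ Ici (0 : ℝ) := fun u hu => ht0.trans hu.1
    have hd : ∀ u ∈ Icc t (t + δ), HasDerivWithinAt (fun u => E u + 2 * (D t - L * δ) * u)
        (-2 * D u + 2 * (D t - L * δ)) (Icc t (t + δ)) u := by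
      intro u hu
      have h1 := ((hE u (hsub hu)).mono hsub).fun_add
        (((hasDerivWithinAt_id u (Icc t (t + δ))).const_mul (2 * (D t - L * δ))))
      simpa using h1
    have h2 : AntitoneOn (fun u => E u + 2 * (D t - L * δ) * u) (Icc t (t + δ)) := by
      refine antitoneOn_of_hasDerivWithinAt_nonpos (convex_Icc _ _)
        (fun u hu => (hd u hu).continuousWithinAt)
        (fun u hu => (hd u (interior_subset hu)).mono interior_subset) fun u hu => ?_
      have hu' := interior_subset hu
      have h3 := (abs_le.1 (hD t ht u (hsub hu'))).2
      have h4 : |t - u| ≤ δ := by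
        rw [abs_sub_comm, abs_of_nonneg (by linarith [hu'.1])]
        linarith [hu'.2]
      nlinarith [mul_le_mul_of_nonneg_left h4 hL]
    have h5 := h2 (left_mem_Icc.2 (by linarith)) (right_mem_Icc.2 (by linarith))
      (by linarith : t ≤ t + δ)
    simp only at h5
    nlinarith
  have hconv : ∃ e, Tendsto E atTop (𝓝 e) := by
    have hA : Antitone fun t => E (max t 0) := fun t u htu =>
      hanti (mem_Ici.2 (le_max_right _ _)) (mem_Ici.2 (le_max_right _ _))
        (max_le_max_right 0 htu)
    refine ⟨_, (tendsto_atTop_ciInf hA ⟨0, ?_⟩).congr' ?_⟩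
    · rintro _ ⟨t, rfl⟩; exact hE0 _
    · filter_upwards [eventually_ge_atTop 0] with t ht
      rw [max_eq_left ht]
  obtain ⟨e, he⟩ := hconv
  rw [Metric.tendsto_atTop]
  intro ε hε
  -- With Lδ ≤ ε/2, a loss below εδ forces D t < ε/2 + Lδ ≤ ε.
  set δ := ε / (2 * (L + 1))
  have hδ : 0 < δ := by positivity
  have hLδ : L * δ ≤ ε / 2 := by
    simp only [δ]
    rw [mul_div_assoc', div_le_div_iff₀ (by positivity) (by positivity)]
    nlinarith
  have hdiff : Tendsto (fun t => E t - E (t + δ)) atTop (𝓝 0) := by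
    have := he.sub (he.comp (tendsto_atTop_add_const_right atTop δ tendsto_id))
    simpa using this
  obtain ⟨N, hN⟩ := (Metric.tendsto_atTop.1 hdiff) (ε * δ) (by positivity)
  refine ⟨max N 0, fun t ht => ?_⟩
  have ht0 : t ∈ Ici (0 : ℝ) := (le_max_right _ _).trans ht
  have h1 := hN t ((le_max_left _ _).trans ht)
  rw [Real.dist_eq, sub_zero] at h1 ⊢
  rw [abs_of_nonneg (hD0 t ht0)]
  have h2 := (le_abs_self _).trans_lt h1
  have h3 := (hstep t ht0 δ hδ).trans_lt h2
  have h4 : 2 * (D t - L * δ) < ε := by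
    by_contra! h
    nlinarith
  linarith

/-- Both matrices have the same Frobenius norm, so expanding the square gives 2‖A‖² − 2 Re tr AB. -/
lemma norm_sq_conj_dg_sub_eq_two_mul {U V : Matrix (Fin n) (Fin n) ℂ}
    (hU : U ∈ Matrix.unitaryGroup (Fin n) ℂ) (hV : V ∈ Matrix.unitaryGroup (Fin n) ℂ)
    (k : Fin n → ℝ) :
    ‖V * dg k * Vᴴ - U * dg k * Uᴴ‖ ^ 2 =
      2 * (V * dg k * Vᴴ * (V * dg k * Vᴴ - U * dg k * Uᴴ)).trace.re := by
  have hW := mul_mem_unitary hU hV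
  rw [norm_sq_conj_dg_sub hU hV, mul_sub, Matrix.trace_sub, Complex.sub_re,
    re_trace_conj_dg_mul_self hV, re_trace_conj_dg_mul]
  generalize Vᴴ * U = W at hW
  have h1 : ∑ i, ∑ j, ‖W i j‖ ^ 2 * k i ^ 2 = ∑ i, k i * k i := by
    refine Finset.sum_congr rfl fun i _ => ?_
    rw [← Finset.sum_mul, sum_row_unitary hW, one_mul, pow_two]
  have h2 : ∑ i, ∑ j, ‖W i j‖ ^ 2 * k j ^ 2 = ∑ i, k i * k i := by
    rw [Finset.sum_comm]
    refine Finset.sum_congr rfl fun i _ => ?_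
    rw [← Finset.sum_mul, sum_col_unitary hW, one_mul, pow_two]
  have h3 : ∑ i, ∑ j, ‖W i j‖ ^ 2 * (k i - k j) ^ 2 = ∑ i, ∑ j, ‖W i j‖ ^ 2 * k i ^ 2 +
      ∑ i, ∑ j, ‖W i j‖ ^ 2 * k j ^ 2 - 2 * ∑ i, ∑ j, ‖W i j‖ ^ 2 * (k i * k j) := by
    simp only [Finset.mul_sum, ← Finset.sum_add_distrib, ← Finset.sum_sub_distrib]
    exact Finset.sum_congr rfl fun i _ => Finset.sum_congr rfl fun j _ => by ring
  rw [h3, h1, h2]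
  ring

lemma re_trace_conj_dg_sub_smul {V Z : Matrix (Fin n) (Fin n) ℂ} (k l : Fin n → ℝ) (c : ℝ) :
    (V * dg (fun i => k i - c * l i) * Vᴴ * Z).trace.re =
      (V * dg k * Vᴴ * Z).trace.re - c * (V * dg l * Vᴴ * Z).trace.re := by
  have e : dg (fun i => k i - c * l i) = dg k - c • dg l := by
    ext i j; by_cases h : i = j <;> simp [dg, h]
  rw [e]
  simp only [mul_sub, sub_mul, mul_smul_comm, smul_mul_assoc, Matrix.trace_sub, Matrix.trace_smul,
    Complex.sub_re, Complex.smul_re, smul_eq_mul]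

lemma monovary_of_monotoneOn {S : Set ℝ} {f g : ℝ → ℝ} (hf : MonotoneOn f S)
    (hg : MonotoneOn g S) {s : Fin n → ℝ} (hs : ∀ i, s i ∈ S) :
    Monovary (fun i => f (s i)) (fun i => g (s i)) := by
  intro i j hij
  refine hf (hs i) (hs j) (le_of_not_gt fun h => ?_)
  exact absurd (hg (hs j) (hs i) h.le) (not_le.2 hij)

/-- A quantitative rearrangement inequality. -/
lemma exists_re_trace_ge {a b : ℝ} (ha : 0 ≤ a) (hab : a < b) {φ : ℝ → ℝ} (m : Monotone φ)
    {K : ℝ≥0} (hK : LipschitzWith K φ) :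
    ∃ c > 0, ∀ {U V : Matrix (Fin n) (Fin n) ℂ} {s : Fin n → ℝ},
      U ∈ Matrix.unitaryGroup (Fin n) ℂ → V ∈ Matrix.unitaryGroup (Fin n) ℂ →
      (∀ i, s i ∈ Icc a b) →
      c * ∑ i, ∑ j, ‖(Vᴴ * U) i j‖ ^ 2 *
        ((φ (s i) - φ a) ^ 2 - (φ (s j) - φ a) ^ 2) ^ 2 ≤
      (V * dg (fun i => φ (s i)) * Vᴴ *
        (V * dg (fun i => s i ^ 2) * Vᴴ - U * dg (fun i => s i ^ 2) * Uᴴ)).trace.re := by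
  -- Let r = (φ − φ a)². The constants make φ − c₁ r and x² − c₂ r increasing: increments of r are
  -- at most 2(φ b − φ a) times those of φ, and at most K² times those of x². Two rearrangements
  -- then replace φ by c₁ r and x² by c₂ r, and the pairing of r with itself is half a squared norm.
  set c₁ := 1 / (2 * (φ b - φ a) + 1)
  set c₂ := 1 / ((K : ℝ) ^ 2 + 1)
  have hφab : 0 ≤ φ b - φ a := sub_nonneg.2 (m hab.le)
  have hc₁ : 0 < c₁ := by positivity
  have hc₂ : 0 < c₂ := by positivity
  refine ⟨c₁ * c₂ / 2, by positivity, fun {U V s} hU hV hs => ?_⟩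
  let r : ℝ → ℝ := fun x => (φ x - φ a) ^ 2
  have hr : MonotoneOn r (Icc a b) := fun x hx y hy hxy =>
    pow_le_pow_left₀ (sub_nonneg.2 (m hx.1)) (sub_le_sub_right (m hxy) _) 2
  have hsq : MonotoneOn (fun x : ℝ => x ^ 2) (Icc a b) := fun x hx y hy hxy =>
    pow_le_pow_left₀ (ha.trans hx.1) hxy 2
  have h1 : MonotoneOn (fun x => φ x - c₁ * r x) (Icc a b) := by
    intro x hx y hy hxy
    have e1 : c₁ * (2 * (φ b - φ a) + 1) = 1 := by simp only [c₁]; field_simp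
    have e2 := m hxy
    have e3 := m hx.1
    have e4 := m hy.2
    have e5 : r y - r x = (φ y - φ x) * (φ y + φ x - 2 * φ a) := by simp only [r]; ring
    have e6 : r y - r x ≤ (φ y - φ x) * (2 * (φ b - φ a) + 1) := by
      rw [e5]; exact mul_le_mul_of_nonneg_left (by linarith) (by linarith)
    have e7 : c₁ * (r y - r x) ≤ φ y - φ x := by
      calc _ ≤ c₁ * ((φ y - φ x) * (2 * (φ b - φ a) + 1)) := by gcongr
        _ = (φ y - φ x) * (c₁ * (2 * (φ b - φ a) + 1)) := by ring
        _ = _ := by rw [e1, mul_one]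
    simp only
    linarith
  have h2 : MonotoneOn (fun x => x ^ 2 - c₂ * r x) (Icc a b) := by
    intro x hx y hy hxy
    have e1 : c₂ * ((K : ℝ) ^ 2 + 1) = 1 := by simp only [c₂]; field_simp
    have lip : ∀ {x y : ℝ}, x ≤ y → φ y - φ x ≤ K * (y - x) := by
      intro x y hxy
      have := hK.dist_le_mul y x
      rw [Real.dist_eq, Real.dist_eq, abs_of_nonneg (sub_nonneg.2 hxy)] at this
      exact (le_abs_self _).trans this
    have e2 := lip hxy
    have e3 := lip hx.1
    have e4 := lip hy.1
    have e5 : r y - r x = (φ y - φ x) * (φ y + φ x - 2 * φ a) := by simp only [r]; ring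
    have e6 : r y - r x ≤ (K * (y - x)) * (K * (y + x)) := by
      rw [e5]
      have := m hx.1; have := m hy.1
      have := K.coe_nonneg
      refine mul_le_mul e2 ?_ (by linarith) (by nlinarith)
      nlinarith
    have e7 : c₂ * (r y - r x) ≤ y ^ 2 - x ^ 2 := by
      have e8 : 0 ≤ y ^ 2 - x ^ 2 := sub_nonneg.2 (hsq hx hy hxy)
      calc _ ≤ c₂ * ((K * (y - x)) * (K * (y + x))) := by gcongr
        _ ≤ c₂ * ((K ^ 2 + 1) * (y ^ 2 - x ^ 2)) := by
          refine mul_le_mul_of_nonneg_left ?_ hc₂.le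
          nlinarith
        _ = (c₂ * ((K : ℝ) ^ 2 + 1)) * (y ^ 2 - x ^ 2) := by ring
        _ = _ := by rw [e1, one_mul]
    simp only
    linarith
  have t1 := re_trace_rearrangement hU hV (monovary_of_monotoneOn h1 hsq hs)
  rw [re_trace_conj_dg_sub_smul] at t1
  have t2 := re_trace_rearrangement hU hV (monovary_of_monotoneOn hr h2 hs)
  have e : ∀ {W : Matrix (Fin n) (Fin n) ℂ}, W * dg (fun i => s i ^ 2 - c₂ * r (s i)) * Wᴴ =
      W * dg (fun i => s i ^ 2) * Wᴴ - c₂ • (W * dg (fun i => r (s i)) * Wᴴ) := by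
    intro W
    have : dg (fun i => s i ^ 2 - c₂ * r (s i)) =
        dg (fun i => s i ^ 2) - c₂ • dg (fun i => r (s i)) := by
      ext i j; by_cases h : i = j <;> simp [dg, h]
    rw [this]
    simp only [mul_sub, sub_mul, mul_smul_comm, smul_mul_assoc]
  have e' : ∀ A B A' B' : Matrix (Fin n) (Fin n) ℂ,
      A - c₂ • A' - (B - c₂ • B') = (A - B) - c₂ • (A' - B') := by
    intro A B A' B'; rw [smul_sub]; abel
  rw [e, e, e', mul_sub _ _ (c₂ • _), mul_smul_comm, Matrix.trace_sub, Matrix.trace_smul,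
    Complex.sub_re, Complex.smul_re, smul_eq_mul] at t2
  have t3 := norm_sq_conj_dg_sub_eq_two_mul hU hV (fun i => r (s i))
  rw [norm_sq_conj_dg_sub hU hV] at t3
  change c₁ * c₂ / 2 * ∑ i, ∑ j, ‖(Vᴴ * U) i j‖ ^ 2 * (r (s i) - r (s j)) ^ 2 ≤ _
  rw [t3]
  nlinarith [mul_le_mul_of_nonneg_left (sub_nonneg.1 t2) hc₁.le]

/-- The dissipation rate of `‖X‖²` along the flow. -/
noncomputable def dissipation (φ₁ φ₂ : ℝ → ℝ) (X : Matrix (Fin n) (Fin n) ℂ) : ℝ :=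
  (phi φ₁ φ₂ X * (Xᴴ * X - X * Xᴴ)).trace.re

lemma IsSVD.dissipation_eq {U V X : Matrix (Fin n) (Fin n) ℂ} {s : Fin n → ℝ} (h : IsSVD U V s X)
    (φ₁ φ₂ : ℝ → ℝ) : dissipation φ₁ φ₂ X =
      (V * dg (fun i => φ₁ (s i)) * Vᴴ *
        (V * dg (fun i => s i ^ 2) * Vᴴ - U * dg (fun i => s i ^ 2) * Uᴴ)).trace.re +
      (U * dg (fun i => φ₂ (s i)) * Uᴴ *
        (U * dg (fun i => s i ^ 2) * Uᴴ - V * dg (fun i => s i ^ 2) * Vᴴ)).trace.re := by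
  have e := h.conjTranspose.conj_mul_self
  rw [Matrix.conjTranspose_conjTranspose] at e
  rw [dissipation, e, h.conj_mul_self, h.phi_eq, ← Complex.add_re, ← Matrix.trace_add]
  congr 2
  noncomm_ring

/-- Small dissipation forces `|X|` and `|X^*|` to be close. -/
lemma norm_abs_sub_le_of_dissipation {a b : ℝ} (ha : 0 ≤ a) (hab : a < b) {φ₁ φ₂ : ℝ → ℝ}
    (m₁ : Monotone φ₁) (m₂ : Monotone φ₂) {K : ℝ≥0} (h₁ : LipschitzWith K φ₁)
    (h₂ : LipschitzWith K φ₂) (hs : StrictMonoOn (fun x => φ₁ x + φ₂ x) (Icc a b)) {ε : ℝ}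
    (hε : 0 < ε) : ∃ C : ℝ, ∀ X ∈ matricesIn n a b,
      ‖CFC.abs X - CFC.abs Xᴴ‖ ^ 2 ≤ n * ε ^ 2 + C * dissipation φ₁ φ₂ X := by
  obtain ⟨c₁, hc₁, H₁⟩ := exists_re_trace_ge (n := n) ha hab m₁ h₁
  obtain ⟨c₂, hc₂, H₂⟩ := exists_re_trace_ge (n := n) ha hab m₂ h₂
  -- By strict monotonicity of φ₁ + φ₂, g vanishes only on the diagonal. Compactness bounds it below
  -- by δ where |x − y| ≥ ε; nearer pairs contribute at most n ε² in total.
  let g : ℝ × ℝ → ℝ := fun x => ((φ₁ x.1 - φ₁ a) ^ 2 - (φ₁ x.2 - φ₁ a) ^ 2) ^ 2 +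
    ((φ₂ x.1 - φ₂ a) ^ 2 - (φ₂ x.2 - φ₂ a) ^ 2) ^ 2
  have hg : Continuous g := by
    have := h₁.continuous
    have := h₂.continuous
    fun_prop
  have hcpt : IsCompact ((Icc a b ×ˢ Icc a b) ∩ {x : ℝ × ℝ | ε ≤ |x.1 - x.2|}) :=
    (isCompact_Icc.prod isCompact_Icc).inter_right
      (isClosed_le continuous_const (by fun_prop))
  have strict : ∀ x ∈ Icc a b, ∀ y ∈ Icc a b, x < y → 0 < g (y, x) := by
    intro x hx y hy hxy
    have hlt : φ₁ x + φ₂ x < φ₁ y + φ₂ y := hs hx hy hxy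
    have key : ∀ φ : ℝ → ℝ, Monotone φ → φ x < φ y →
        0 < ((φ y - φ a) ^ 2 - (φ x - φ a) ^ 2) ^ 2 := by
      intro φ hφ h
      have : (φ x - φ a) ^ 2 < (φ y - φ a) ^ 2 :=
        pow_lt_pow_left₀ (by linarith) (sub_nonneg.2 (hφ hx.1)) two_ne_zero
      exact pow_pos (sub_pos.2 this) 2
    rcases lt_or_ge (φ₁ x) (φ₁ y) with h | h
    · exact add_pos_of_pos_of_nonneg (key φ₁ m₁ h) (sq_nonneg _)
    · exact add_pos_of_nonneg_of_pos (sq_nonneg _) (key φ₂ m₂ (by linarith))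
  have hpos : ∀ x ∈ (Icc a b ×ˢ Icc a b) ∩ {x : ℝ × ℝ | ε ≤ |x.1 - x.2|}, 0 < g x := by
    rintro ⟨x, y⟩ ⟨⟨hx, hy⟩, hxy⟩
    rcases lt_trichotomy x y with h | h | h
    · have e : g (x, y) = g (y, x) := by simp only [g]; ring
      rw [e]; exact strict x hx y hy h
    · simp only [mem_ofPred_eq, h, sub_self, abs_zero] at hxy
      linarith
    · exact strict y hy x hx h
  obtain ⟨δ, hδ, hmin⟩ := hcpt.exists_forall_le' hg.continuousOn hpos
  refine ⟨(b - a) ^ 2 / δ * (1 / c₁ + 1 / c₂), fun X hX => ?_⟩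
  obtain ⟨U, V, s, h⟩ := exists_isSVD X
  have hsm := h.mem_matricesIn.1 hX
  have B₁ := H₁ h.left h.right hsm
  have B₂ := H₂ h.right h.left hsm
  rw [h.dissipation_eq]
  set D₁ := (V * dg (fun i => φ₁ (s i)) * Vᴴ *
        (V * dg (fun i => s i ^ 2) * Vᴴ - U * dg (fun i => s i ^ 2) * Uᴴ)).trace.re
  set D₂ := (U * dg (fun i => φ₂ (s i)) * Uᴴ *
        (U * dg (fun i => s i ^ 2) * Uᴴ - V * dg (fun i => s i ^ 2) * Vᴴ)).trace.re
  rw [h.abs_eq, h.conjTranspose.abs_eq, norm_sq_conj_dg_sub h.left h.right]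
  have hW := mul_mem_unitary h.left h.right
  have hWt : ∀ i j, ‖(Uᴴ * V) i j‖ = ‖(Vᴴ * U) j i‖ := by
    intro i j
    have : Uᴴ * V = (Vᴴ * U)ᴴ := by simp
    rw [this, Matrix.conjTranspose_apply, norm_star]
  simp only [hWt] at B₂
  rw [Finset.sum_comm] at B₂
  generalize Vᴴ * U = W at *
  have hterm : ∀ i j, ‖W i j‖ ^ 2 * (s i - s j) ^ 2 ≤ ‖W i j‖ ^ 2 * ε ^ 2 +
      (b - a) ^ 2 / δ * (‖W i j‖ ^ 2 * g (s i, s j)) := by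
    intro i j
    have hg0 : 0 ≤ g (s i, s j) := by simp only [g]; positivity
    have : (s i - s j) ^ 2 ≤ ε ^ 2 + (b - a) ^ 2 / δ * g (s i, s j) := by
      rcases le_total ε |s i - s j| with hle | hle
      · have h3 := hmin (s i, s j) ⟨⟨hsm i, hsm j⟩, hle⟩
        have h4 : (s i - s j) ^ 2 ≤ (b - a) ^ 2 := by
          rw [sq_le_sq, abs_of_nonneg (sub_nonneg.2 hab.le), abs_le]
          constructor <;> linarith [(hsm i).1, (hsm i).2, (hsm j).1, (hsm j).2]
        have h5 : (b - a) ^ 2 ≤ (b - a) ^ 2 / δ * g (s i, s j) := by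
          rw [div_mul_eq_mul_div, le_div_iff₀ hδ]
          gcongr
        nlinarith [sq_nonneg ε]
      · have h4 : (s i - s j) ^ 2 ≤ ε ^ 2 := by
          rw [sq_le_sq, abs_of_pos hε]; exact hle
        have : 0 ≤ (b - a) ^ 2 / δ * g (s i, s j) := by positivity
        linarith
    calc _ ≤ ‖W i j‖ ^ 2 * (ε ^ 2 + (b - a) ^ 2 / δ * g (s i, s j)) := by gcongr
      _ = _ := by ring
  have hsum : ∑ i, ∑ j, ‖W i j‖ ^ 2 * (s i - s j) ^ 2 ≤ n * ε ^ 2 +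
      (b - a) ^ 2 / δ * ∑ i, ∑ j, ‖W i j‖ ^ 2 * g (s i, s j) := by
    have h6 : ∑ i, ∑ j, ‖W i j‖ ^ 2 * ε ^ 2 = n * ε ^ 2 := by
      simp only [← Finset.sum_mul, sum_row_unitary hW]; simp
    rw [← h6, Finset.mul_sum, ← Finset.sum_add_distrib]
    refine Finset.sum_le_sum fun i _ => ?_
    rw [Finset.mul_sum, ← Finset.sum_add_distrib]
    exact Finset.sum_le_sum fun j _ => hterm i j
  refine hsum.trans ?_
  have hsplit : ∑ i, ∑ j, ‖W i j‖ ^ 2 * g (s i, s j) =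
      ∑ i, ∑ j, ‖W i j‖ ^ 2 * ((φ₁ (s i) - φ₁ a) ^ 2 - (φ₁ (s j) - φ₁ a) ^ 2) ^ 2 +
      ∑ i, ∑ j, ‖W i j‖ ^ 2 * ((φ₂ (s j) - φ₂ a) ^ 2 - (φ₂ (s i) - φ₂ a) ^ 2) ^ 2 := by
    simp only [← Finset.sum_add_distrib, g]
    exact Finset.sum_congr rfl fun i _ => Finset.sum_congr rfl fun j _ => by ring
  have q₁ : 0 ≤ ∑ i, ∑ j, ‖W i j‖ ^ 2 *
      ((φ₁ (s i) - φ₁ a) ^ 2 - (φ₁ (s j) - φ₁ a) ^ 2) ^ 2 := by positivity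
  have q₂ : 0 ≤ ∑ i, ∑ j, ‖W i j‖ ^ 2 *
      ((φ₂ (s j) - φ₂ a) ^ 2 - (φ₂ (s i) - φ₂ a) ^ 2) ^ 2 := by positivity
  rw [hsplit, mul_assoc]
  refine add_le_add le_rfl (mul_le_mul_of_nonneg_left ?_ (by positivity))
  set S₁ := ∑ i, ∑ j, ‖W i j‖ ^ 2 * ((φ₁ (s i) - φ₁ a) ^ 2 - (φ₁ (s j) - φ₁ a) ^ 2) ^ 2
  set S₂ := ∑ i, ∑ j, ‖W i j‖ ^ 2 * ((φ₂ (s j) - φ₂ a) ^ 2 - (φ₂ (s i) - φ₂ a) ^ 2) ^ 2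
  have r₁ : S₁ ≤ 1 / c₁ * D₁ := by rw [one_div, inv_mul_eq_div, le_div_iff₀ hc₁]; linarith
  have r₂ : S₂ ≤ 1 / c₂ * D₂ := by rw [one_div, inv_mul_eq_div, le_div_iff₀ hc₂]; linarith
  have w₁ : 0 ≤ D₁ := (mul_nonneg hc₁.le q₁).trans B₁
  have w₂ : 0 ≤ D₂ := (mul_nonneg hc₂.le q₂).trans B₂
  have x₁ : 0 ≤ 1 / c₁ * D₂ := by positivity
  have x₂ : 0 ≤ 1 / c₂ * D₁ := by positivity
  linarith [add_mul (1 / c₁) (1 / c₂) (D₁ + D₂), mul_add (1 / c₁) D₁ D₂, mul_add (1 / c₂) D₁ D₂]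

lemma dissipation_nonneg {a b : ℝ} (ha : 0 ≤ a) {φ₁ φ₂ : ℝ → ℝ}
    (m₁ : Monotone φ₁) (m₂ : Monotone φ₂) {X : Matrix (Fin n) (Fin n) ℂ}
    (hX : X ∈ matricesIn n a b) : 0 ≤ dissipation φ₁ φ₂ X := by
  obtain ⟨U, V, s, h⟩ := exists_isSVD X
  have hsm := h.mem_matricesIn.1 hX
  have hsq : MonotoneOn (fun x : ℝ => x ^ 2) (Icc a b) := fun x hx y _ hxy =>
    pow_le_pow_left₀ (ha.trans hx.1) hxy 2
  rw [h.dissipation_eq]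
  exact add_nonneg
    (re_trace_rearrangement h.left h.right
      (monovary_of_monotoneOn (m₁.monotoneOn _) hsq hsm))
    (re_trace_rearrangement h.right h.left
      (monovary_of_monotoneOn (m₂.monotoneOn _) hsq hsm))

lemma IsGlobalSolution.exists_bounds {a b : ℝ} (ha : 0 ≤ a) (hab : a < b) {φ₁ φ₂ : ℝ → ℝ}
    {K : ℝ≥0} (h₁ : LipschitzWith K φ₁) (h₂ : LipschitzWith K φ₂)
    {T : Matrix (Fin n) (Fin n) ℂ} {X : ℝ → Matrix (Fin n) (Fin n) ℂ}
    (hX : IsGlobalSolution a b φ₁ φ₂ T X) :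
    ∃ R P : ℝ, 0 ≤ R ∧ 0 ≤ P ∧ (∀ t ∈ Ici (0 : ℝ), ‖X t‖ ≤ R) ∧
      (∀ t ∈ Ici (0 : ℝ), ‖phi φ₁ φ₂ (X t)‖ ≤ P) := by
  have hb : 0 ≤ b := ha.trans hab.le
  have hR : ∀ t ∈ Ici (0 : ℝ), ‖X t‖ ≤ n * b := fun t ht =>
    norm_le_of_mem_matricesIn ha hab (hX.mem t ht)
  refine ⟨n * b, ‖phi φ₁ φ₂ (0 : Matrix (Fin n) (Fin n) ℂ)‖ + 4 * K * (n * b), by positivity,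
    by positivity, hR, fun t ht => (norm_phi_le h₁ h₂ (X t)).trans ?_⟩
  have := hR t ht
  gcongr

/-- The orbit is bounded and φ is Lipschitz, so the dissipation is Lipschitz in time and Barbalat's
lemma applies. -/
lemma IsGlobalSolution.tendsto_abs_sub {a b : ℝ} (ha : 0 ≤ a) (hab : a < b) {φ₁ φ₂ : ℝ → ℝ}
    (m₁ : Monotone φ₁) (m₂ : Monotone φ₂) {K : ℝ≥0} (h₁ : LipschitzWith K φ₁)
    (h₂ : LipschitzWith K φ₂) (hs : StrictMonoOn (fun x => φ₁ x + φ₂ x) (Icc a b))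
    {T : Matrix (Fin n) (Fin n) ℂ} {X : ℝ → Matrix (Fin n) (Fin n) ℂ}
    (hX : IsGlobalSolution a b φ₁ φ₂ T X) :
    Tendsto (fun t => ‖CFC.abs (X t) - CFC.abs (X t)ᴴ‖) atTop (𝓝 0) := by
  obtain ⟨R, P, hR0, hP0, hR, hP⟩ := hX.exists_bounds ha hab h₁ h₂
  have hXL : ∀ t ∈ Ici (0 : ℝ), ∀ u ∈ Ici (0 : ℝ), ‖X t - X u‖ ≤ 2 * P * R * |t - u| := by
    intro t ht u hu
    refine Convex.norm_image_sub_le_of_norm_hasDerivWithin_le (fun v hv => hX.hasDeriv v hv)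
      (fun v hv => ?_) (convex_Ici 0) hu ht
    refine (norm_lie_le _ _).trans ?_
    have := hP v hv
    have := hR v hv
    gcongr
  have hN : ∀ Y Z : Matrix (Fin n) (Fin n) ℂ, ‖Y‖ ≤ R → ‖Z‖ ≤ R →
      ‖(Yᴴ * Y - Y * Yᴴ) - (Zᴴ * Z - Z * Zᴴ)‖ ≤ 4 * R * ‖Y - Z‖ := by
    intro Y Z hY hZ
    have e : (Yᴴ * Y - Y * Yᴴ) - (Zᴴ * Z - Z * Zᴴ) =
        ((Y - Z)ᴴ * Y + Zᴴ * (Y - Z)) - ((Y - Z) * Yᴴ + Z * (Y - Z)ᴴ) := by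
      rw [Matrix.conjTranspose_sub]; noncomm_ring
    have i1 : ‖(Y - Z)ᴴ * Y‖ ≤ ‖Y - Z‖ * R := (norm_mul_le _ _).trans (by
      rw [Matrix.frobenius_norm_conjTranspose]; gcongr)
    have i2 : ‖Zᴴ * (Y - Z)‖ ≤ R * ‖Y - Z‖ := (norm_mul_le _ _).trans (by
      rw [Matrix.frobenius_norm_conjTranspose]; gcongr)
    have i3 : ‖(Y - Z) * Yᴴ‖ ≤ ‖Y - Z‖ * R := (norm_mul_le _ _).trans (by
      rw [Matrix.frobenius_norm_conjTranspose]; gcongr)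
    have i4 : ‖Z * (Y - Z)ᴴ‖ ≤ R * ‖Y - Z‖ := (norm_mul_le _ _).trans (by
      rw [Matrix.frobenius_norm_conjTranspose]; gcongr)
    rw [e]
    refine (norm_sub_le _ _).trans ((add_le_add (norm_add_le _ _) (norm_add_le _ _)).trans ?_)
    linarith
  have hN0 : ∀ Y : Matrix (Fin n) (Fin n) ℂ, ‖Y‖ ≤ R → ‖Yᴴ * Y - Y * Yᴴ‖ ≤ 4 * R * R := by
    intro Y hY
    have := hN Y 0 hY (by simpa using hR0)
    simp only [Matrix.conjTranspose_zero, mul_zero, sub_zero] at this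
    exact this.trans (by gcongr)
  have hD : Tendsto (fun t => dissipation φ₁ φ₂ (X t)) atTop (𝓝 0) := by
    refine tendsto_zero_of_dissipation (E := fun t => (((X t)ᴴ * X t) ^ (0 + 1)).trace.re)
      (L := 4 * K * (2 * P * R) * (4 * R * R) + P * (4 * R * (2 * P * R))) ?_ ?_
      (fun t ht => dissipation_nonneg ha m₁ m₂ (hX.mem t ht)) ?_
    · intro t ht
      have := lie_trace_pow_deriv (conjTranspose_phi φ₁ φ₂ (X t)) (hX.hasDeriv t ht) 0
      convert this using 1
      rw [dissipation, ← neg_sub, mul_neg, Matrix.trace_neg, Complex.neg_re]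
      norm_num
    · intro t
      simp only [zero_add, pow_one]
      rw [← frob_sq_eq_trace]
      positivity
    · intro t ht u hu
      have e : dissipation φ₁ φ₂ (X t) - dissipation φ₁ φ₂ (X u) =
          ((phi φ₁ φ₂ (X t) - phi φ₁ φ₂ (X u)) * ((X t)ᴴ * X t - X t * (X t)ᴴ)).trace.re +
          (phi φ₁ φ₂ (X u) * (((X t)ᴴ * X t - X t * (X t)ᴴ) -
            ((X u)ᴴ * X u - X u * (X u)ᴴ))).trace.re := by
        rw [dissipation, dissipation, ← Complex.sub_re, ← Matrix.trace_sub, ← Complex.add_re,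
          ← Matrix.trace_add]
        congr 2
        noncomm_ring
      have l1 := (lipschitzWith_phi (n := n) h₁ h₂).dist_le_mul (X t) (X u)
      rw [dist_eq_norm, dist_eq_norm] at l1
      push_cast at l1
      have l2 := hXL t ht u hu
      have l3 := hN (X t) (X u) (hR t ht) (hR u hu)
      have l4 := hN0 (X t) (hR t ht)
      rw [e]
      refine (abs_add_le _ _).trans ((add_le_add (abs_re_trace_mul_le _ _)
        (abs_re_trace_mul_le _ _)).trans ?_)
      calc _ ≤ (4 * K * (2 * P * R * |t - u|)) * (4 * R * R) +
            P * (4 * R * (2 * P * R * |t - u|)) := by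
            refine add_le_add (mul_le_mul (l1.trans (by gcongr)) l4 (norm_nonneg _)
              (by positivity)) (mul_le_mul (hP u hu) (l3.trans (by gcongr)) (norm_nonneg _) hP0)
        _ = _ := by ring
  have hsq : Tendsto (fun t => ‖CFC.abs (X t) - CFC.abs (X t)ᴴ‖ ^ 2) atTop (𝓝 0) := by
    rw [Metric.tendsto_atTop]
    intro η hη
    set ε := √(η / (2 * (n + 1)))
    have hε : 0 < ε := Real.sqrt_pos.2 (by positivity)
    have hε2 : n * ε ^ 2 < η / 2 := by
      rw [Real.sq_sqrt (by positivity), mul_div_assoc', div_lt_div_iff₀ (by positivity)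
        (by positivity)]
      nlinarith
    obtain ⟨C, hC⟩ := norm_abs_sub_le_of_dissipation (n := n) ha hab m₁ m₂ h₁ h₂ hs hε
    have h3 : Tendsto (fun t => C * dissipation φ₁ φ₂ (X t)) atTop (𝓝 0) := by
      simpa using hD.const_mul C
    obtain ⟨N, hN⟩ := (Metric.tendsto_atTop.1 h3) (η / 2) (by positivity)
    refine ⟨max N 0, fun t ht => ?_⟩
    have h4 := hN t ((le_max_left _ _).trans ht)
    have h5 := hC (X t) (hX.mem t ((le_max_right _ _).trans ht))
    rw [Real.dist_eq, sub_zero] at h4 ⊢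
    rw [abs_of_nonneg (by positivity)]
    linarith [le_abs_self (C * dissipation φ₁ φ₂ (X t))]
  have := hsq.sqrt
  simpa using this

end

/-! ### Divided differences and matrices commuting with X. -/

section

/-- `c` is a continuous extension to the plane of the divided difference of `φ` on `[a, b]`. -/
structure IsDividedDifference (a b : ℝ) (φ : ℝ → ℝ) (c : ℝ → ℝ → ℝ) : Prop where
  continuous : Continuous (Function.uncurry c)
  sub_eq : ∀ x ∈ Icc a b, ∀ y ∈ Icc a b, φ y - φ x = c x y * (y - x)
  diag : ∀ x ∈ Icc a b, c x x = derivWithin φ (Icc a b) x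

lemma IsDividedDifference.symm {a b : ℝ} {φ : ℝ → ℝ} {c : ℝ → ℝ → ℝ}
    (h : IsDividedDifference a b φ c) {x y : ℝ} (hx : x ∈ Icc a b) (hy : y ∈ Icc a b) :
    c x y = c y x := by
  rcases eq_or_ne x y with rfl | hxy
  · rfl
  · have h1 := h.sub_eq x hx y hy
    have h2 := h.sub_eq y hy x hx
    have h3 : (c x y - c y x) * (y - x) = 0 := by linarith
    rcases mul_eq_zero.1 h3 with h4 | h4
    · linarith
    · exact absurd (by linarith) hxy

/-- Take c x y to be the mean of φ' over the segment from x to y, with φ' extended continuously to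
the line by its endpoint values. -/
lemma exists_isDividedDifference {a b : ℝ} (hab : a < b) {φ : ℝ → ℝ}
    (hφ : ContDiffOn ℝ 1 φ (Icc a b)) : ∃ c, IsDividedDifference a b φ c := by
  have hu : UniqueDiffOn ℝ (Icc a b) := uniqueDiffOn_Icc hab
  have hdc : ContinuousOn (derivWithin φ (Icc a b)) (Icc a b) :=
    hφ.continuousOn_derivWithin hu le_rfl
  let d : ℝ → ℝ := IccExtend hab.le ((Icc a b).domRestrict (derivWithin φ (Icc a b)))
  have hd : Continuous d := (continuousOn_iff_continuous_domRestrict.1 hdc).Icc_extend'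
  have hdeq : ∀ x ∈ Icc a b, d x = derivWithin φ (Icc a b) x := fun x hx =>
    IccExtend_of_mem _ _ hx
  refine ⟨fun x y => ∫ τ in (0 : ℝ)..1, d (x + (y - x) * τ), ?_, ?_, ?_⟩
  · refine intervalIntegral.continuous_parametric_intervalIntegral_of_continuous' ?_ 0 1
    exact hd.comp (by fun_prop : Continuous fun x : (ℝ × ℝ) × ℝ =>
      x.1.1 + (x.1.2 - x.1.1) * x.2)
  · intro x hx y hy
    have h1 := intervalIntegral.mul_integral_comp_add_mul (a := 0) (b := 1) (f := d) (y - x) x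
    rw [mul_comm, h1, mul_zero, mul_one, add_zero, add_sub_cancel]
    refine (intervalIntegral.integral_eq_sub_of_hasDeriv_right ?_ ?_
      (hd.intervalIntegrable _ _)).symm
    · exact hφ.continuousOn.mono (uIcc_subset_Icc hx hy)
    · intro z hz
      have hz' : z ∈ Ioo a b := ⟨(le_min hx.1 hy.1).trans_lt hz.1, hz.2.trans_le (max_le hx.2 hy.2)⟩
      have h2 := (hφ.differentiableOn one_ne_zero z (Ioo_subset_Icc_self hz')).hasDerivWithinAt
      rw [← hdeq z (Ioo_subset_Icc_self hz')] at h2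
      exact (h2.hasDerivAt (Icc_mem_nhds hz'.1 hz'.2)).hasDerivWithinAt
  · intro x hx
    simp [hdeq x hx]

/-- The only delicate point is the origin, reached when a = 0: the quotient is at most x + y, which
tends to the value 0/0 = 0. -/
lemma continuousOn_sq_add_sq_div {a b : ℝ} (ha : 0 ≤ a) :
    ContinuousOn (fun x : ℝ × ℝ => (x.1 ^ 2 + x.2 ^ 2) / (x.1 + x.2)) (Icc a b ×ˢ Icc a b) := by
  intro p hp
  have hp1 : 0 ≤ p.1 := ha.trans hp.1.1
  have hp2 : 0 ≤ p.2 := ha.trans hp.2.1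
  rcases eq_or_ne (p.1 + p.2) 0 with h0 | h0
  · have e1 : p.1 = 0 := by linarith
    have e2 : p.2 = 0 := by linarith
    have hval : (p.1 ^ 2 + p.2 ^ 2) / (p.1 + p.2) = 0 := by rw [h0, div_zero]
    rw [ContinuousWithinAt, hval]
    have hlim : Tendsto (fun x : ℝ × ℝ => x.1 + x.2) (𝓝[Icc a b ×ˢ Icc a b] p) (𝓝 0) := by
      have : Continuous fun x : ℝ × ℝ => x.1 + x.2 := by fun_prop
      have h := (this.tendsto p).mono_left (nhdsWithin_le_nhds (s := Icc a b ×ˢ Icc a b))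
      rwa [h0] at h
    refine squeeze_zero' ?_ ?_ hlim
    · filter_upwards [self_mem_nhdsWithin] with x hx
      have := ha.trans hx.1.1
      have := ha.trans hx.2.1
      positivity
    · filter_upwards [self_mem_nhdsWithin] with x hx
      have h1 := ha.trans hx.1.1
      have h2 := ha.trans hx.2.1
      refine div_le_of_le_mul₀ (by positivity) (by positivity) ?_
      nlinarith [mul_nonneg h1 h2]
  · exact ((by fun_prop : Continuous fun x : ℝ × ℝ => x.1 ^ 2 + x.2 ^ 2).continuousAt.div
      (by fun_prop : Continuous fun x : ℝ × ℝ => x.1 + x.2).continuousAt h0).continuousWithinAt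

section Commutator

variable {U V X P : Matrix (Fin n) (Fin n) ℂ} {s : Fin n → ℝ}

lemma IsSVD.mul_right (h : IsSVD U V s X) : X * V = U * dg s := by
  rw [h.eq, mul_assoc, unitary_conj_mul h.right, mul_one]

lemma IsSVD.left_mul (h : IsSVD U V s X) : Uᴴ * X = dg s * Vᴴ := by
  rw [h.eq, mul_assoc, unitary_cancel h.left]

lemma trace_conj_mul_conj {V : Matrix (Fin n) (Fin n) ℂ}
    (hV : V ∈ Matrix.unitaryGroup (Fin n) ℂ) (C D : Matrix (Fin n) (Fin n) ℂ) :
    (Vᴴ * C * V * (Vᴴ * D * V)).trace = (C * D).trace := by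
  have : Vᴴ * C * V * (Vᴴ * D * V) = Vᴴ * (C * D * V) := by
    simp only [mul_assoc, unitary_cancel' hV]
  rw [this, Matrix.trace_mul_comm, mul_assoc, unitary_mul_conj hV, mul_one]

/-- Entries of the commutator of `P` with `X^* X` in the basis of right singular vectors. -/
lemma IsSVD.right_entry (h : IsSVD U V s X) (hP : P * X = X * P) (i j : Fin n) :
    ((s j : ℂ) ^ 2 - (s i : ℂ) ^ 2) * (Vᴴ * P * V) i j =
      (s j : ℂ) ^ 2 * (Vᴴ * (P - Pᴴ) * V) i j - s i * s j * (Uᴴ * (P - Pᴴ) * U) i j := by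
  have hP' : Xᴴ * Pᴴ = Pᴴ * Xᴴ := by
    rw [← Matrix.conjTranspose_mul, hP, Matrix.conjTranspose_mul]
  -- Since P commutes with X and P* with X*, the commutator of P with X*X involves only the skew
  -- part P − P*. Its matrix entries give the identity.
  have e0 : P * (Xᴴ * X) - (Xᴴ * X) * P = (P - Pᴴ) * (Xᴴ * X) - Xᴴ * (P - Pᴴ) * X := by
    have e1 : Xᴴ * Pᴴ * X = Pᴴ * Xᴴ * X := by rw [hP']
    have e2 : Xᴴ * (P * X) = Xᴴ * (X * P) := by rw [hP]
    calc _ = P * (Xᴴ * X) - Xᴴ * (X * P) := by rw [mul_assoc Xᴴ]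
      _ = P * (Xᴴ * X) - Pᴴ * Xᴴ * X - (Xᴴ * (P * X) - Xᴴ * Pᴴ * X) := by rw [e1, e2]; abel
      _ = _ := by noncomm_ring
  have m1 : Vᴴ * (P * (Xᴴ * X) - (Xᴴ * X) * P) * V =
      (Vᴴ * P * V) * dg (fun i => s i ^ 2) - dg (fun i => s i ^ 2) * (Vᴴ * P * V) := by
    rw [h.conj_mul_self]
    simp only [mul_sub, sub_mul, mul_assoc, unitary_cancel h.right, unitary_conj_mul h.right,
      mul_one]
  have m2 : Vᴴ * ((P - Pᴴ) * (Xᴴ * X) - Xᴴ * (P - Pᴴ) * X) * V =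
      (Vᴴ * (P - Pᴴ) * V) * dg (fun i => s i ^ 2) - dg s * (Uᴴ * (P - Pᴴ) * U) * dg s := by
    have e1 : Vᴴ * ((P - Pᴴ) * (Xᴴ * X) - Xᴴ * (P - Pᴴ) * X) * V =
        Vᴴ * (P - Pᴴ) * ((Xᴴ * X) * V) - (Vᴴ * Xᴴ) * (P - Pᴴ) * (X * V) := by noncomm_ring
    rw [e1, h.conjTranspose.left_mul, h.mul_right, h.conj_mul_self]
    simp only [mul_assoc, unitary_conj_mul h.right, mul_one]
  have e := congrArg (fun Z => Z i j) (m1.symm.trans ((congrArg (fun Z => Vᴴ * Z * V) e0).trans m2))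
  simp only [Matrix.sub_apply, dg, Matrix.mul_diagonal, Matrix.diagonal_mul,
    Complex.ofReal_pow] at e
  linear_combination e

lemma IsSVD.left_entry (h : IsSVD U V s X) (hP : P * X = X * P) (i j : Fin n) :
    ((s j : ℂ) ^ 2 - (s i : ℂ) ^ 2) * (Uᴴ * P * U) i j =
      s i * s j * (Vᴴ * (P - Pᴴ) * V) i j - (s i : ℂ) ^ 2 * (Uᴴ * (P - Pᴴ) * U) i j := by
  have hP' : Xᴴ * Pᴴ = Pᴴ * Xᴴ := by
    rw [← Matrix.conjTranspose_mul, hP, Matrix.conjTranspose_mul]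
  have e0 : P * (X * Xᴴ) - (X * Xᴴ) * P = X * (P - Pᴴ) * Xᴴ - (X * Xᴴ) * (P - Pᴴ) := by
    have e1 : X * (Xᴴ * Pᴴ) = X * (Pᴴ * Xᴴ) := by rw [hP']
    have e2 : P * X * Xᴴ = X * P * Xᴴ := by rw [hP]
    calc _ = P * X * Xᴴ - (X * Xᴴ) * P := by rw [mul_assoc P]
      _ = X * P * Xᴴ - X * (Pᴴ * Xᴴ) - ((X * Xᴴ) * P - X * (Xᴴ * Pᴴ)) := by rw [e1, e2]; abel
      _ = _ := by noncomm_ring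
  have hN := h.conjTranspose.conj_mul_self
  rw [Matrix.conjTranspose_conjTranspose] at hN
  have m1 : Uᴴ * (P * (X * Xᴴ) - (X * Xᴴ) * P) * U =
      (Uᴴ * P * U) * dg (fun i => s i ^ 2) - dg (fun i => s i ^ 2) * (Uᴴ * P * U) := by
    rw [hN]
    simp only [mul_sub, sub_mul, mul_assoc, unitary_cancel h.left, unitary_conj_mul h.left,
      mul_one]
  have m2 : Uᴴ * (X * (P - Pᴴ) * Xᴴ - (X * Xᴴ) * (P - Pᴴ)) * U =
      dg s * (Vᴴ * (P - Pᴴ) * V) * dg s - dg (fun i => s i ^ 2) * (Uᴴ * (P - Pᴴ) * U) := by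
    have e1 : Uᴴ * (X * (P - Pᴴ) * Xᴴ - (X * Xᴴ) * (P - Pᴴ)) * U =
        (Uᴴ * X) * (P - Pᴴ) * (Xᴴ * U) - Uᴴ * (X * Xᴴ) * (P - Pᴴ) * U := by noncomm_ring
    rw [e1, h.conjTranspose.mul_right, h.left_mul, hN]
    simp only [mul_assoc, unitary_cancel h.left]
  have e := congrArg (fun Z => Z i j) (m1.symm.trans ((congrArg (fun Z => Uᴴ * Z * U) e0).trans m2))
  simp only [Matrix.sub_apply, dg, Matrix.mul_diagonal, Matrix.diagonal_mul,
    Complex.ofReal_pow] at e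
  linear_combination e

lemma conj_commutator_entry {V : Matrix (Fin n) (Fin n) ℂ}
    (hV : V ∈ Matrix.unitaryGroup (Fin n) ℂ) (k : Fin n → ℝ) (P : Matrix (Fin n) (Fin n) ℂ)
    (i j : Fin n) :
    (Vᴴ * (P * (V * dg k * Vᴴ) - (V * dg k * Vᴴ) * P) * V) i j =
      ((k j : ℂ) - k i) * (Vᴴ * P * V) i j := by
  have : Vᴴ * (P * (V * dg k * Vᴴ) - (V * dg k * Vᴴ) * P) * V =
      (Vᴴ * P * V) * dg k - dg k * (Vᴴ * P * V) := by
    simp only [mul_sub, sub_mul, mul_assoc, unitary_cancel hV, unitary_conj_mul hV, mul_one]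
  rw [this, Matrix.sub_apply, dg, Matrix.mul_diagonal, Matrix.diagonal_mul]
  ring

lemma skew_entry (V P : Matrix (Fin n) (Fin n) ℂ) (i j : Fin n) :
    (Vᴴ * (P - Pᴴ) * V) j i = -(starRingEnd ℂ) ((Vᴴ * (P - Pᴴ) * V) i j) := by
  have : (Vᴴ * (P - Pᴴ) * V)ᴴ = -(Vᴴ * (P - Pᴴ) * V) := by
    simp only [Matrix.conjTranspose_mul, Matrix.conjTranspose_sub,
      Matrix.conjTranspose_conjTranspose]
    noncomm_ring
  have h := congrArg (fun Z => Z j i) this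
  simp only [Matrix.conjTranspose_apply, Matrix.neg_apply] at h
  rw [← Complex.star_def, h, neg_neg]

variable {a b : ℝ} {φ : ℝ → ℝ} {c : ℝ → ℝ → ℝ}

/-- Passes from commutators with X*X to commutators with φ(|X|): in a singular basis their entries
differ by the factor c/(x + y). For x = y = 0 both sides vanish. -/
lemma IsDividedDifference.scale (hc : IsDividedDifference a b φ c) (ha : 0 ≤ a) {x y : ℝ}
    (hx : x ∈ Icc a b) (hy : y ∈ Icc a b) :
    φ y - φ x = c x y / (x + y) * (y ^ 2 - x ^ 2) := by
  have hx0 := ha.trans hx.1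
  have hy0 := ha.trans hy.1
  rw [hc.sub_eq x hx y hy]
  rcases eq_or_ne (x + y) 0 with h0 | h0
  · have e1 : x = 0 := by linarith
    have e2 : y = 0 := by linarith
    simp [e1, e2]
  · field_simp
    ring

lemma IsSVD.right_commutator_entry (h : IsSVD U V s X) (hP : P * X = X * P) (ha : 0 ≤ a)
    (hs : ∀ i, s i ∈ Icc a b) (hc : IsDividedDifference a b φ c) (i j : Fin n) :
    (Vᴴ * (P * (V * dg (fun i => φ (s i)) * Vᴴ) - (V * dg (fun i => φ (s i)) * Vᴴ) * P) * V) i j =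
      ((c (s i) (s j) / (s i + s j) : ℝ) : ℂ) *
        ((s j : ℂ) ^ 2 * (Vᴴ * (P - Pᴴ) * V) i j - s i * s j * (Uᴴ * (P - Pᴴ) * U) i j) := by
  rw [conj_commutator_entry h.right, ← h.right_entry hP, ← mul_assoc]
  congr 1
  exact_mod_cast hc.scale ha (hs i) (hs j)

lemma IsSVD.left_commutator_entry (h : IsSVD U V s X) (hP : P * X = X * P) (ha : 0 ≤ a)
    (hs : ∀ i, s i ∈ Icc a b) (hc : IsDividedDifference a b φ c) (i j : Fin n) :
    (Uᴴ * (P * (U * dg (fun i => φ (s i)) * Uᴴ) - (U * dg (fun i => φ (s i)) * Uᴴ) * P) * U) i j =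
      ((c (s i) (s j) / (s i + s j) : ℝ) : ℂ) *
        (s i * s j * (Vᴴ * (P - Pᴴ) * V) i j - (s i : ℂ) ^ 2 * (Uᴴ * (P - Pᴴ) * U) i j) := by
  rw [conj_commutator_entry h.left, ← h.left_entry hP, ← mul_assoc]
  congr 1
  exact_mod_cast hc.scale ha (hs i) (hs j)

lemma re_trace_mul_skew {V : Matrix (Fin n) (Fin n) ℂ}
    (hV : V ∈ Matrix.unitaryGroup (Fin n) ℂ) (C P : Matrix (Fin n) (Fin n) ℂ) :
    (C * (P - Pᴴ)).trace.re =
      -∑ i, ∑ j, ((Vᴴ * C * V) i j * (starRingEnd ℂ) ((Vᴴ * (P - Pᴴ) * V) i j)).re := by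
  rw [← trace_conj_mul_conj hV, Matrix.trace, Complex.re_sum, ← Finset.sum_neg_distrib]
  refine Finset.sum_congr rfl fun i _ => ?_
  rw [Matrix.diag_apply, Matrix.mul_apply, Complex.re_sum, ← Finset.sum_neg_distrib]
  refine Finset.sum_congr rfl fun j _ => ?_
  rw [skew_entry V P i j, mul_neg, Complex.neg_re]

lemma sum_symm_weight {K t : Fin n → Fin n → ℝ} (hK : ∀ i j, K i j = K j i)
    (ht : ∀ i j, t i j = t j i) (s : Fin n → ℝ) :
    ∑ i, ∑ j, K i j * s j ^ 2 * t i j = ∑ i, ∑ j, K i j * s i ^ 2 * t i j := by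
  rw [Finset.sum_comm]
  exact Finset.sum_congr rfl fun i _ => Finset.sum_congr rfl fun j _ => by rw [hK i j, ht i j]

/-- The rate of change of `‖P‖²` for a solution `P` of the commutator equation which commutes
with `X`, split into a dissipative part and an error. -/
lemma IsSVD.re_trace_phi_commutator (h : IsSVD U V s X) (hP : P * X = X * P) (ha : 0 ≤ a)
    (hs : ∀ i, s i ∈ Icc a b) {φ₁ φ₂ : ℝ → ℝ} {c₁ c₂ : ℝ → ℝ → ℝ}
    (hc₁ : IsDividedDifference a b φ₁ c₁) (hc₂ : IsDividedDifference a b φ₂ c₂) :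
    2 * (phi φ₁ φ₂ X * (P * Pᴴ - Pᴴ * P)).trace.re =
      -∑ i, ∑ j, (c₁ (s i) (s j) + c₂ (s i) (s j)) / (s i + s j) *
        ‖(Uᴴ * (X * (P - Pᴴ) - (P - Pᴴ) * X) * V) i j‖ ^ 2 -
      ∑ i, ∑ j, ((c₁ (s i) (s j) - c₂ (s i) (s j)) / 2 *
          ((s i ^ 2 + s j ^ 2) / (s i + s j))) *
        (‖(Vᴴ * (P - Pᴴ) * V) i j‖ ^ 2 - ‖(Uᴴ * (P - Pᴴ) * U) i j‖ ^ 2) := by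
  have hQ : ∀ i j, (Uᴴ * (X * (P - Pᴴ) - (P - Pᴴ) * X) * V) i j =
      s i * (Vᴴ * (P - Pᴴ) * V) i j - s j * (Uᴴ * (P - Pᴴ) * U) i j := by
    intro i j
    have e : Uᴴ * (X * (P - Pᴴ) - (P - Pᴴ) * X) * V =
        dg s * (Vᴴ * (P - Pᴴ) * V) - (Uᴴ * (P - Pᴴ) * U) * dg s := by
      have e1 : Uᴴ * (X * (P - Pᴴ) - (P - Pᴴ) * X) * V =
          (Uᴴ * X) * (P - Pᴴ) * V - Uᴴ * (P - Pᴴ) * (X * V) := by noncomm_ring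
      rw [e1, h.left_mul, h.mul_right]
      simp only [mul_assoc]
    rw [e, Matrix.sub_apply, dg, Matrix.mul_diagonal, Matrix.diagonal_mul]
    ring
  have e1 : (phi φ₁ φ₂ X * (P * Pᴴ - Pᴴ * P)).trace.re =
      ((P * (V * dg (fun i => φ₁ (s i)) * Vᴴ) - (V * dg (fun i => φ₁ (s i)) * Vᴴ) * P) *
        (P - Pᴴ)).trace.re -
      ((P * (U * dg (fun i => φ₂ (s i)) * Uᴴ) - (U * dg (fun i => φ₂ (s i)) * Uᴴ) * P) *
        (P - Pᴴ)).trace.re := by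
    rw [h.phi_eq]
    generalize V * dg (fun i => φ₁ (s i)) * Vᴴ = A
    generalize U * dg (fun i => φ₂ (s i)) * Uᴴ = B
    -- By cyclicity, the normality defect of P becomes a commutator [P, A] paired with P − P*.
    have key : ∀ A : Matrix (Fin n) (Fin n) ℂ,
        ((P * A - A * P) * (P - Pᴴ)).trace = (A * (P * Pᴴ - Pᴴ * P)).trace := by
      intro A
      have e2 : (P * A - A * P) * (P - Pᴴ) =
          P * (A * (P - Pᴴ)) - A * P * (P - Pᴴ) := by noncomm_ring
      rw [e2, Matrix.trace_sub, Matrix.trace_mul_comm, ← Matrix.trace_sub]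
      congr 1
      noncomm_ring
    rw [key, key, ← Complex.sub_re, ← Matrix.trace_sub, sub_mul]
  rw [e1, re_trace_mul_skew h.right, re_trace_mul_skew h.left]
  simp only [h.right_commutator_entry hP ha hs hc₁, h.left_commutator_entry hP ha hs hc₂, hQ]
  have sV : ∀ i j, ‖(Vᴴ * (P - Pᴴ) * V) i j‖ ^ 2 = ‖(Vᴴ * (P - Pᴴ) * V) j i‖ ^ 2 := by
    intro i j; rw [skew_entry V P i j, norm_neg, RCLike.norm_conj]
  have sU : ∀ i j, ‖(Uᴴ * (P - Pᴴ) * U) i j‖ ^ 2 = ‖(Uᴴ * (P - Pᴴ) * U) j i‖ ^ 2 := by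
    intro i j; rw [skew_entry U P i j, norm_neg, RCLike.norm_conj]
  generalize Vᴴ * (P - Pᴴ) * V = Y at *
  generalize Uᴴ * (P - Pᴴ) * U = Z at *
  have k₁ : ∀ i j, c₁ (s i) (s j) / (s i + s j) = c₁ (s j) (s i) / (s j + s i) := by
    intro i j; rw [hc₁.symm (hs i) (hs j), add_comm]
  have k₂ : ∀ i j, c₂ (s i) (s j) / (s i + s j) = c₂ (s j) (s i) / (s j + s i) := by
    intro i j; rw [hc₂.symm (hs i) (hs j), add_comm]
  -- Kernels and squared moduli are symmetric in i, j, so s j² may be traded for s i². Symmetrising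
  -- completes the squares |s i Y − s j Z|², the entries of [X, P − P*]; the remainder is the
  -- difference of the two Schur sums.
  have w1 := sum_symm_weight k₁ sV s
  have w2 := sum_symm_weight k₁ sU s
  have w3 := sum_symm_weight k₂ sV s
  have w4 := sum_symm_weight k₂ sU s
  have x1 : ∀ i j, (((c₁ (s i) (s j) / (s i + s j) : ℝ) : ℂ) *
      ((s j : ℂ) ^ 2 * Y i j - s i * s j * Z i j) * (starRingEnd ℂ) (Y i j)).re =
      c₁ (s i) (s j) / (s i + s j) * s j ^ 2 * ‖Y i j‖ ^ 2 -
      c₁ (s i) (s j) / (s i + s j) * (s i * s j * (Z i j * (starRingEnd ℂ) (Y i j)).re) := by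
    intro i j
    rw [mul_assoc, Complex.re_ofReal_mul, sub_mul, mul_assoc ((s j : ℂ) ^ 2), Complex.mul_conj',
      Complex.sub_re, mul_assoc ((s i : ℂ) * s j), ← Complex.ofReal_mul, Complex.re_ofReal_mul]
    have : (s j : ℂ) ^ 2 * (‖Y i j‖ : ℂ) ^ 2 = ((s j ^ 2 * ‖Y i j‖ ^ 2 : ℝ) : ℂ) := by push_cast; rfl
    rw [this, Complex.ofReal_re]
    ring
  have x2 : ∀ i j, (((c₂ (s i) (s j) / (s i + s j) : ℝ) : ℂ) *
      (s i * s j * Y i j - (s i : ℂ) ^ 2 * Z i j) * (starRingEnd ℂ) (Z i j)).re =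
      c₂ (s i) (s j) / (s i + s j) * (s i * s j * (Z i j * (starRingEnd ℂ) (Y i j)).re) -
      c₂ (s i) (s j) / (s i + s j) * s i ^ 2 * ‖Z i j‖ ^ 2 := by
    intro i j
    rw [mul_assoc, Complex.re_ofReal_mul, sub_mul, mul_assoc ((s i : ℂ) ^ 2), Complex.mul_conj',
      Complex.sub_re, mul_assoc ((s i : ℂ) * s j), ← Complex.ofReal_mul, Complex.re_ofReal_mul]
    have : (s i : ℂ) ^ 2 * (‖Z i j‖ : ℂ) ^ 2 = ((s i ^ 2 * ‖Z i j‖ ^ 2 : ℝ) : ℂ) := by push_cast; rfl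
    rw [this, Complex.ofReal_re]
    have : (Y i j * (starRingEnd ℂ) (Z i j)).re = (Z i j * (starRingEnd ℂ) (Y i j)).re := by
      simp only [Complex.mul_re, Complex.conj_re, Complex.conj_im]; ring
    rw [this]
    ring
  have x3 : ∀ i j, ‖(s i : ℂ) * Y i j - s j * Z i j‖ ^ 2 = s i ^ 2 * ‖Y i j‖ ^ 2 +
      s j ^ 2 * ‖Z i j‖ ^ 2 - 2 * (s i * s j * (Z i j * (starRingEnd ℂ) (Y i j)).re) := by
    intro i j
    simp only [← Complex.normSq_eq_norm_sq, Complex.normSq_apply, Complex.sub_re, Complex.sub_im,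
      Complex.mul_re, Complex.mul_im, Complex.conj_re, Complex.conj_im, Complex.ofReal_re,
      Complex.ofReal_im]
    ring
  simp only [x1, x2, x3]
  have y1 : ∀ i j, (c₁ (s i) (s j) + c₂ (s i) (s j)) / (s i + s j) *
      (s i ^ 2 * ‖Y i j‖ ^ 2 + s j ^ 2 * ‖Z i j‖ ^ 2 -
        2 * (s i * s j * (Z i j * (starRingEnd ℂ) (Y i j)).re)) =
      c₁ (s i) (s j) / (s i + s j) * s i ^ 2 * ‖Y i j‖ ^ 2 +
      c₁ (s i) (s j) / (s i + s j) * s j ^ 2 * ‖Z i j‖ ^ 2 -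
      2 * (c₁ (s i) (s j) / (s i + s j) * (s i * s j * (Z i j * (starRingEnd ℂ) (Y i j)).re)) +
      (c₂ (s i) (s j) / (s i + s j) * s i ^ 2 * ‖Y i j‖ ^ 2 +
      c₂ (s i) (s j) / (s i + s j) * s j ^ 2 * ‖Z i j‖ ^ 2 -
      2 * (c₂ (s i) (s j) / (s i + s j) * (s i * s j * (Z i j * (starRingEnd ℂ) (Y i j)).re))) := by
    intro i j; ring
  have y2 : ∀ i j, (c₁ (s i) (s j) - c₂ (s i) (s j)) / 2 * ((s i ^ 2 + s j ^ 2) / (s i + s j)) *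
      (‖Y i j‖ ^ 2 - ‖Z i j‖ ^ 2) =
      (c₁ (s i) (s j) / (s i + s j) * s i ^ 2 * ‖Y i j‖ ^ 2 +
      c₁ (s i) (s j) / (s i + s j) * s j ^ 2 * ‖Y i j‖ ^ 2 -
      (c₁ (s i) (s j) / (s i + s j) * s i ^ 2 * ‖Z i j‖ ^ 2 +
      c₁ (s i) (s j) / (s i + s j) * s j ^ 2 * ‖Z i j‖ ^ 2) -
      (c₂ (s i) (s j) / (s i + s j) * s i ^ 2 * ‖Y i j‖ ^ 2 +
      c₂ (s i) (s j) / (s i + s j) * s j ^ 2 * ‖Y i j‖ ^ 2 -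
      (c₂ (s i) (s j) / (s i + s j) * s i ^ 2 * ‖Z i j‖ ^ 2 +
      c₂ (s i) (s j) / (s i + s j) * s j ^ 2 * ‖Z i j‖ ^ 2))) / 2 := by
    intro i j; ring
  simp only [y1, y2, Finset.sum_add_distrib, Finset.sum_sub_distrib, ← Finset.mul_sum,
    ← Finset.sum_div]
  linarith

end Commutator

end

/-! ### Decay of the skew part of idempotents commuting with X. -/

section

lemma norm_le_of_entry_le {M : Matrix (Fin n) (Fin n) ℂ} {C : ℝ} (hC : 0 ≤ C)
    (h : ∀ i j, ‖M i j‖ ≤ C) : ‖M‖ ≤ n * C := by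
  refine le_of_sq_le_sq ?_ (by positivity)
  rw [frob_sq_eq_sum]
  calc ∑ i, ∑ j, ‖M i j‖ ^ 2 ≤ ∑ _i : Fin n, ∑ _j : Fin n, C ^ 2 :=
        Finset.sum_le_sum fun i _ => Finset.sum_le_sum fun j _ =>
          pow_le_pow_left₀ (norm_nonneg _) (h i j) 2
    _ = (n * C) ^ 2 := by simp; ring

lemma norm_entry_unitary_le {W : Matrix (Fin n) (Fin n) ℂ}
    (hW : W ∈ Matrix.unitaryGroup (Fin n) ℂ) (i j : Fin n) : ‖W i j‖ ≤ 1 := by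
  refine le_of_sq_le_sq ?_ zero_le_one
  rw [one_pow, ← sum_row_unitary hW i]
  exact Finset.single_le_sum (f := fun j => ‖W i j‖ ^ 2) (fun j _ => sq_nonneg _)
    (Finset.mem_univ j)

/-- Schur multipliers in the bases of right and left singular vectors agree approximately when
`|X|` and `|X^*|` are close. -/
lemma exists_schur_multiplier_bound {a b : ℝ} {θ : ℝ → ℝ → ℝ}
    (hθ : ContinuousOn (Function.uncurry θ) (Icc a b ×ˢ Icc a b))
    (hsymm : ∀ x ∈ Icc a b, ∀ y ∈ Icc a b, θ x y = θ y x) {ε : ℝ} (hε : 0 < ε) :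
    ∃ η > 0, ∀ {U V X : Matrix (Fin n) (Fin n) ℂ} {s : Fin n → ℝ}, IsSVD U V s X →
      (∀ i, s i ∈ Icc a b) → ‖CFC.abs X - CFC.abs Xᴴ‖ ≤ η →
      ∀ D : Matrix (Fin n) (Fin n) ℂ,
        |∑ i, ∑ j, θ (s i) (s j) * (‖(Vᴴ * D * V) i j‖ ^ 2 - ‖(Uᴴ * D * U) i j‖ ^ 2)| ≤
          ε * ‖D‖ ^ 2 := by
  have hS : IsCompact (Icc a b ×ˢ Icc a b) := isCompact_Icc.prod isCompact_Icc
  obtain ⟨B, hB⟩ := hS.exists_bound_of_continuousOn hθ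
  set ε' := ε / (2 * (n ^ 2 + 1))
  have hε' : 0 < ε' := by positivity
  obtain ⟨δ, hδ, hunif⟩ := Metric.uniformContinuousOn_iff.1
    (hS.uniformContinuousOn_of_continuous hθ) ε' hε'
  refine ⟨ε' * δ / (2 * |B| + 1), by positivity, fun {U V X s} h hs hη D => ?_⟩
  rw [h.abs_eq, h.conjTranspose.abs_eq] at hη
  have hW := mul_mem_unitary h.left h.right
  have hsq := norm_sq_conj_dg_sub h.left h.right s s
  have hYW : (Vᴴ * D * V) * (Vᴴ * U) = Vᴴ * D * U := by
    simp only [mul_assoc, unitary_cancel' h.right]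
  have hWZ : (Vᴴ * U) * (Uᴴ * D * U) = Vᴴ * D * U := by
    simp only [mul_assoc, unitary_cancel' h.left]
  have nY : ‖Vᴴ * D * V‖ = ‖D‖ := norm_conj_unitary h.right h.right D
  have nZ : ‖Uᴴ * D * U‖ = ‖D‖ := norm_conj_unitary h.left h.left D
  have nQ : ‖Vᴴ * D * U‖ = ‖D‖ := norm_conj_unitary h.right h.left D
  have hWe : ∀ i k, ‖(Vᴴ * U) i k‖ * |s i - s k| ≤ ε' * δ / (2 * |B| + 1) := by
    intro i k
    refine le_trans (le_of_sq_le_sq ?_ (norm_nonneg _)) hη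
    rw [hsq, mul_pow, sq_abs]
    exact (Finset.single_le_sum (f := fun j => ‖(Vᴴ * U) i j‖ ^ 2 * (s i - s j) ^ 2)
      (fun j _ => by positivity) (Finset.mem_univ k)).trans
      (Finset.single_le_sum (f := fun i => ∑ j, ‖(Vᴴ * U) i j‖ ^ 2 * (s i - s j) ^ 2)
      (fun i _ => by positivity) (Finset.mem_univ i))
  generalize Vᴴ * U = W at *
  generalize Vᴴ * D * V = Y at *
  generalize Uᴴ * D * U = Z at *
  generalize Vᴴ * D * U = Q at *
  -- Either s i and s k are within δ and uniform continuity applies, or they are far apart and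
  -- closeness of |X| and |X*| makes W i k small. Thus W nearly commutes with the Schur multiplier.
  have key : ∀ i k j, ‖W i k‖ * |θ (s i) (s j) - θ (s k) (s j)| ≤ ε' := by
    intro i k j
    rcases lt_or_ge |s i - s k| δ with hlt | hge
    · have h1 := hunif (s i, s j) ⟨hs i, hs j⟩ (s k, s j) ⟨hs k, hs j⟩ (by
        rw [Prod.dist_eq, dist_self, max_eq_left dist_nonneg, Real.dist_eq]; exact hlt)
      rw [Real.dist_eq] at h1
      calc _ ≤ 1 * ε' := mul_le_mul (norm_entry_unitary_le hW i k) h1.le (abs_nonneg _) zero_le_one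
        _ = ε' := one_mul _
    · have h1 := hWe i k
      have h2 : ‖W i k‖ * δ ≤ ε' * δ / (2 * |B| + 1) :=
        (mul_le_mul_of_nonneg_left hge (norm_nonneg _)).trans h1
      have h3 : |θ (s i) (s j) - θ (s k) (s j)| ≤ 2 * |B| + 1 := by
        have b1 := hB (s i, s j) ⟨hs i, hs j⟩
        have b2 := hB (s k, s j) ⟨hs k, hs j⟩
        rw [Real.norm_eq_abs] at b1 b2
        refine (abs_sub _ _).trans ?_
        simp only [Function.uncurry] at b1 b2
        linarith [le_abs_self B]
      have h4 : ‖W i k‖ ≤ ε' / (2 * |B| + 1) := by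
        rw [mul_div_right_comm] at h2
        exact le_of_mul_le_mul_right h2 hδ
      calc _ ≤ ε' / (2 * |B| + 1) * (2 * |B| + 1) :=
            mul_le_mul h4 h3 (abs_nonneg _) (by positivity)
        _ = ε' := by field_simp
  -- Y W = Q = W Z for the unitary W, so after the multiplier is applied both Yθ W and W Zθ are
  -- close to Qθ. The two weighted sums are the pairings of Yθ W and W Zθ with Q.
  let Zθ : Matrix (Fin n) (Fin n) ℂ := Matrix.of fun i j => (θ (s i) (s j) : ℂ) * Z i j
  let Yθ : Matrix (Fin n) (Fin n) ℂ := Matrix.of fun i j => (θ (s i) (s j) : ℂ) * Y i j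
  let Qθ : Matrix (Fin n) (Fin n) ℂ := Matrix.of fun i j => (θ (s i) (s j) : ℂ) * Q i j
  have dZ : ‖W * Zθ - Qθ‖ ≤ n * (n * (ε' * ‖D‖)) := by
    refine norm_le_of_entry_le (by positivity) fun i j => ?_
    have e : (W * Zθ - Qθ) i j =
        ∑ k, W i k * ((θ (s k) (s j) : ℂ) - θ (s i) (s j)) * Z k j := by
      rw [Matrix.sub_apply, Matrix.mul_apply]
      simp only [Zθ, Qθ, Matrix.of_apply]
      rw [← hWZ, Matrix.mul_apply, Finset.mul_sum, ← Finset.sum_sub_distrib]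
      exact Finset.sum_congr rfl fun k _ => by ring
    rw [e]
    calc _ ≤ ∑ _k : Fin n, ε' * ‖D‖ := by
          refine (norm_sum_le _ _).trans (Finset.sum_le_sum fun k _ => ?_)
          rw [norm_mul, norm_mul, ← Complex.ofReal_sub, Complex.norm_real, Real.norm_eq_abs,
            abs_sub_comm]
          exact mul_le_mul (key i k j) ((norm_entry_le Z k j).trans nZ.le) (norm_nonneg _) hε'.le
      _ = _ := by simp
  have dY : ‖Yθ * W - Qθ‖ ≤ n * (n * (ε' * ‖D‖)) := by
    refine norm_le_of_entry_le (by positivity) fun i j => ?_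
    have e : (Yθ * W - Qθ) i j =
        ∑ k, W k j * ((θ (s i) (s k) : ℂ) - θ (s i) (s j)) * Y i k := by
      rw [Matrix.sub_apply, Matrix.mul_apply]
      simp only [Yθ, Qθ, Matrix.of_apply]
      rw [← hYW, Matrix.mul_apply, Finset.mul_sum, ← Finset.sum_sub_distrib]
      exact Finset.sum_congr rfl fun k _ => by ring
    rw [e]
    calc _ ≤ ∑ _k : Fin n, ε' * ‖D‖ := by
          refine (norm_sum_le _ _).trans (Finset.sum_le_sum fun k _ => ?_)
          rw [norm_mul, norm_mul, ← Complex.ofReal_sub, Complex.norm_real, Real.norm_eq_abs,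
            hsymm _ (hs i) _ (hs k), hsymm _ (hs i) _ (hs j)]
          exact mul_le_mul (key k j i) ((norm_entry_le Y i k).trans nY.le) (norm_nonneg _) hε'.le
      _ = _ := by simp
  have sum_eq : ∀ A Aθ : Matrix (Fin n) (Fin n) ℂ,
      (∀ i j, Aθ i j = (θ (s i) (s j) : ℂ) * A i j) →
      ∑ i, ∑ j, θ (s i) (s j) * ‖A i j‖ ^ 2 = (Aᴴ * Aθ).trace.re := by
    intro A Aθ hA
    rw [Matrix.trace, Complex.re_sum, Finset.sum_comm]
    refine Finset.sum_congr rfl fun j _ => ?_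
    rw [Matrix.diag_apply, Matrix.mul_apply, Complex.re_sum]
    refine Finset.sum_congr rfl fun i _ => ?_
    rw [hA, Matrix.conjTranspose_apply, Complex.star_def, mul_left_comm, Complex.conj_mul',
      Complex.re_ofReal_mul, ← Complex.ofReal_pow, Complex.ofReal_re]
  have tY : (Yᴴ * Yθ).trace = (Qᴴ * (Yθ * W)).trace := by
    rw [← hYW, Matrix.conjTranspose_mul, mul_assoc, Matrix.trace_mul_comm Wᴴ]
    simp only [mul_assoc, unitary_mul_conj hW, mul_one]
  have tZ : (Zᴴ * Zθ).trace = (Qᴴ * (W * Zθ)).trace := by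
    rw [← hWZ, Matrix.conjTranspose_mul]
    simp only [mul_assoc, unitary_cancel hW]
  have hfin : ∑ i, ∑ j, θ (s i) (s j) * (‖Y i j‖ ^ 2 - ‖Z i j‖ ^ 2) =
      (Qᴴ * ((Yθ * W - Qθ) - (W * Zθ - Qθ))).trace.re := by
    rw [sub_sub_sub_cancel_right, mul_sub, Matrix.trace_sub, Complex.sub_re, ← tY, ← tZ,
      ← sum_eq Y Yθ fun _ _ => rfl, ← sum_eq Z Zθ fun _ _ => rfl]
    simp only [mul_sub, Finset.sum_sub_distrib]
  rw [hfin]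
  refine (abs_re_trace_mul_le _ _).trans ?_
  rw [Matrix.frobenius_norm_conjTranspose, nQ]
  have h5 : ‖(Yθ * W - Qθ) - (W * Zθ - Qθ)‖ ≤ 2 * (n * (n * (ε' * ‖D‖))) :=
    (norm_sub_le _ _).trans (by linarith)
  have h6 : 2 * (n * (n * ε')) ≤ ε := by
    have : 2 * (n * (n * ε')) = ε * (n ^ 2 / (n ^ 2 + 1)) := by simp only [ε']; field_simp
    rw [this]
    exact mul_le_of_le_one_right hε.le ((div_le_one (by positivity)).2 (by linarith))
  calc ‖D‖ * _ ≤ ‖D‖ * (2 * (n * (n * (ε' * ‖D‖)))) := by gcongr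
    _ = (2 * (n * (n * ε'))) * ‖D‖ ^ 2 := by ring
    _ ≤ ε * ‖D‖ ^ 2 := by gcongr

/-- [·, D] is a derivation, so [p(Y), D] is a sum of terms containing [Y, D]; on a ball the
remaining factors are uniformly bounded. -/
lemma norm_commutator_aeval_le (R : ℝ) (p : ℂ[X]) : ∃ C B : ℝ, 0 ≤ C ∧ 0 ≤ B ∧
    ∀ Y : Matrix (Fin n) (Fin n) ℂ, ‖Y‖ ≤ R → ‖aeval Y p‖ ≤ B ∧
      ∀ D, ‖aeval Y p * D - D * aeval Y p‖ ≤ C * ‖Y * D - D * Y‖ := by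
  induction p using Polynomial.induction_on with
  | C c =>
    refine ⟨0, ‖algebraMap ℂ (Matrix (Fin n) (Fin n) ℂ) c‖, le_rfl, norm_nonneg _,
      fun Y _ => ⟨by rw [aeval_C], fun D => ?_⟩⟩
    rw [aeval_C, Algebra.commutes, sub_self, norm_zero, zero_mul]
  | add p q hp hq =>
    obtain ⟨C₁, B₁, hC₁, hB₁, h₁⟩ := hp
    obtain ⟨C₂, B₂, hC₂, hB₂, h₂⟩ := hq
    refine ⟨C₁ + C₂, B₁ + B₂, by positivity, by positivity, fun Y hY => ?_⟩
    rw [map_add]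
    refine ⟨(norm_add_le _ _).trans (add_le_add (h₁ Y hY).1 (h₂ Y hY).1), fun D => ?_⟩
    rw [add_mul, mul_add, add_sub_add_comm, add_mul]
    exact (norm_add_le _ _).trans (add_le_add ((h₁ Y hY).2 D) ((h₂ Y hY).2 D))
  | monomial k c ih =>
    obtain ⟨C₁, B₁, hC₁, hB₁, h₁⟩ := ih
    refine ⟨C₁ * |R| + B₁, B₁ * |R|, by positivity, by positivity, fun Y hY => ?_⟩
    have e : aeval Y (C c * Polynomial.X ^ (k + 1)) =
        aeval Y (C c * Polynomial.X ^ k) * Y := by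
      simp [pow_succ, mul_assoc]
    have hY' : ‖Y‖ ≤ |R| := hY.trans (le_abs_self R)
    obtain ⟨hB, hC⟩ := h₁ Y hY
    rw [e]
    generalize aeval Y (C c * Polynomial.X ^ k) = Q at *
    refine ⟨(norm_mul_le _ _).trans (mul_le_mul hB hY' (norm_nonneg _) hB₁), fun D => ?_⟩
    have e2 : Q * Y * D - D * (Q * Y) = (Q * D - D * Q) * Y + Q * (Y * D - D * Y) := by
      noncomm_ring
    rw [e2, add_mul]
    refine (norm_add_le _ _).trans (add_le_add ?_ ?_)
    · calc _ ≤ C₁ * ‖Y * D - D * Y‖ * |R| :=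
            (norm_mul_le _ _).trans (mul_le_mul (hC D) hY' (norm_nonneg _) (by positivity))
        _ = _ := by ring
    · exact (norm_mul_le _ _).trans (mul_le_mul_of_nonneg_right hB (norm_nonneg _))

/-- For an idempotent, [P, P − P*] = (P + P* − 1)(P − P*), and the square of the Hermitian factor P
+ P* − 1 is 1 + (P − P*)*(P − P*), so that factor does not shrink norms. -/
lemma norm_sub_conjTranspose_le {P : Matrix (Fin n) (Fin n) ℂ} (hP : P * P = P) :
    ‖P - Pᴴ‖ ≤ ‖P * (P - Pᴴ) - (P - Pᴴ) * P‖ := by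
  have hP' : Pᴴ * Pᴴ = Pᴴ := by rw [← Matrix.conjTranspose_mul, hP]
  have e1 : P * (P - Pᴴ) - (P - Pᴴ) * P = (P + Pᴴ - 1) * (P - Pᴴ) := by
    have : P * (P - Pᴴ) - (P - Pᴴ) * P =
        (P + Pᴴ - 1) * (P - Pᴴ) + (P - P * P) - (Pᴴ - Pᴴ * Pᴴ) := by noncomm_ring
    rw [this, hP, hP']; abel
  have e2 : (P + Pᴴ - 1) * (P + Pᴴ - 1) = 1 + (P - Pᴴ)ᴴ * (P - Pᴴ) := by
    have : (P + Pᴴ - 1) * (P + Pᴴ - 1) = 1 + (P - Pᴴ)ᴴ * (P - Pᴴ) +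
        2 • (P * P - P) + 2 • (Pᴴ * Pᴴ - Pᴴ) := by
      rw [Matrix.conjTranspose_sub, Matrix.conjTranspose_conjTranspose]
      noncomm_ring
    rw [this, hP, hP']; simp
  have hS : (P + Pᴴ - 1)ᴴ = P + Pᴴ - 1 := by
    simp [Matrix.conjTranspose_sub, Matrix.conjTranspose_add, add_comm]
  have e3 : ‖(P + Pᴴ - 1) * (P - Pᴴ)‖ ^ 2 =
      ‖P - Pᴴ‖ ^ 2 + ‖(P - Pᴴ) * (P - Pᴴ)‖ ^ 2 := by
    rw [frob_sq_eq_trace, frob_sq_eq_trace, frob_sq_eq_trace, ← Complex.add_re,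
      ← Matrix.trace_add, Matrix.conjTranspose_mul, hS]
    congr 2
    rw [mul_assoc, ← mul_assoc (P + Pᴴ - 1), e2, add_mul, one_mul, mul_add,
      Matrix.conjTranspose_mul]
    simp only [mul_assoc]
  rw [e1]
  refine le_of_sq_le_sq ?_ (norm_nonneg _)
  rw [e3]
  exact le_add_of_nonneg_right (sq_nonneg _)

/-- The trace of P is constant along a commutator equation, so this ties the decay of the skew part
to that of ‖P‖². -/
lemma norm_sq_sub_conjTranspose {P : Matrix (Fin n) (Fin n) ℂ} (hP : P * P = P) :
    ‖P - Pᴴ‖ ^ 2 = 2 * (Pᴴ * P).trace.re - 2 * P.trace.re := by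
  have hP' : Pᴴ * Pᴴ = Pᴴ := by rw [← Matrix.conjTranspose_mul, hP]
  have e : (P - Pᴴ)ᴴ * (P - Pᴴ) = Pᴴ * P - P * P - Pᴴ * Pᴴ + P * Pᴴ := by
    rw [Matrix.conjTranspose_sub, Matrix.conjTranspose_conjTranspose]
    noncomm_ring
  rw [frob_sq_eq_trace, e, hP, hP', Matrix.trace_add, Matrix.trace_sub, Matrix.trace_sub,
    Matrix.trace_mul_comm P, Matrix.trace_conjTranspose]
  simp only [Complex.add_re, Complex.sub_re, Complex.star_def, Complex.conj_re]
  ring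

variable {a b : ℝ} {φ₁ φ₂ : ℝ → ℝ} {c₁ c₂ : ℝ → ℝ → ℝ}

/-- Disposes of index pairs with s i + s j small, where `c₁ + c₂` may have no positive lower bound.
-/
lemma IsSVD.norm_entry_le {U V X D : Matrix (Fin n) (Fin n) ℂ} {s : Fin n → ℝ}
    (h : IsSVD U V s X) (i j : Fin n) :
    ‖(Uᴴ * (X * D - D * X) * V) i j‖ ≤ (s i + s j) * ‖D‖ := by
  have e : Uᴴ * (X * D - D * X) * V = dg s * (Vᴴ * D * V) - (Uᴴ * D * U) * dg s := by
    have e1 : Uᴴ * (X * D - D * X) * V = (Uᴴ * X) * D * V - Uᴴ * D * (X * V) := by noncomm_ring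
    rw [e1, h.left_mul, h.mul_right]
    simp only [mul_assoc]
  rw [e, Matrix.sub_apply, dg, Matrix.mul_diagonal, Matrix.diagonal_mul]
  have h1 := MatrixFlow.norm_entry_le (Vᴴ * D * V) i j
  have h2 := MatrixFlow.norm_entry_le (Uᴴ * D * U) i j
  rw [norm_conj_unitary h.right h.right] at h1
  rw [norm_conj_unitary h.left h.left] at h2
  refine (norm_sub_le _ _).trans ?_
  rw [norm_mul, norm_mul, Complex.norm_real, Complex.norm_real, Real.norm_of_nonneg (h.nonneg i),
    Real.norm_of_nonneg (h.nonneg j)]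
  nlinarith [h.nonneg i, h.nonneg j]

/-- The decay rate of the skew part of matrices commuting with an almost normal `X`. -/
lemma exists_decay_rate (ha : 0 ≤ a) (hab : a < b) (hc₁ : IsDividedDifference a b φ₁ c₁)
    (hc₂ : IsDividedDifference a b φ₂ c₂)
    (hpos : ∀ x ∈ Icc a b, ∀ y ∈ Icc a b, 0 < x + y → 0 < c₁ x y + c₂ x y) {C₀ : ℝ}
    (hC₀ : 0 < C₀) :
    ∃ c > 0, ∃ η > 0, ∀ X ∈ matricesIn n a b, ‖CFC.abs X - CFC.abs Xᴴ‖ ≤ η →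
      ∀ P : Matrix (Fin n) (Fin n) ℂ, P * X = X * P →
        ‖P - Pᴴ‖ ≤ C₀ * ‖X * (P - Pᴴ) - (P - Pᴴ) * X‖ →
        2 * (phi φ₁ φ₂ X * (P * Pᴴ - Pᴴ * P)).trace.re ≤ -(c * ‖P - Pᴴ‖ ^ 2) := by
  have hb : 0 < b := ha.trans_lt hab
  -- Entries with s i + s j < η₀ carry at most n² η₀² ‖P − P*‖² ≤ ‖P − P*‖²/(4C₀²), a quarter of the
  -- lower bound ‖P − P*‖²/C₀² for ‖[X, P − P*]‖².
  set η₀ := 1 / (2 * (n + 1) * C₀)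
  have hη₀ : 0 < η₀ := by positivity
  have hcpt : IsCompact ((Icc a b ×ˢ Icc a b) ∩ {x : ℝ × ℝ | η₀ ≤ x.1 + x.2}) :=
    (isCompact_Icc.prod isCompact_Icc).inter_right (isClosed_le continuous_const (by fun_prop))
  have hcont : Continuous fun x : ℝ × ℝ => c₁ x.1 x.2 + c₂ x.1 x.2 :=
    hc₁.continuous.add hc₂.continuous
  obtain ⟨m, hm, hmin⟩ := hcpt.exists_forall_le' hcont.continuousOn
    (fun x hx => hpos x.1 hx.1.1 x.2 hx.1.2 (hη₀.trans_le hx.2))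
  -- On the remaining pairs c₁ + c₂ ≥ m and s i + s j ≤ 2b. Three quarters of κ/C₀² survive, and the
  -- Schur error below takes one more.
  set κ := m / (2 * b)
  have hκ : 0 < κ := by positivity
  have hθ : ContinuousOn (Function.uncurry fun x y : ℝ =>
      (c₁ x y - c₂ x y) / 2 * ((x ^ 2 + y ^ 2) / (x + y))) (Icc a b ×ˢ Icc a b) :=
    ((hc₁.continuous.sub hc₂.continuous).div_const 2).continuousOn.mul
      (continuousOn_sq_add_sq_div ha)
  have hε : 0 < κ / (4 * C₀ ^ 2) := by positivity
  obtain ⟨η, hη, hbound⟩ := exists_schur_multiplier_bound (n := n) hθ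
    (fun x hx y hy => by rw [hc₁.symm hx hy, hc₂.symm hx hy, add_comm (x ^ 2), add_comm x]) hε
  refine ⟨κ / (4 * C₀ ^ 2), hε, η, hη, fun X hX hXη P hP hPC => ?_⟩
  obtain ⟨U, V, s, h⟩ := exists_isSVD X
  have hs := h.mem_matricesIn.1 hX
  rw [h.re_trace_phi_commutator hP ha hs hc₁ hc₂]
  have herr := hbound h hs hXη (P - Pᴴ)
  have hQ : ∑ i, ∑ j, ‖(Uᴴ * (X * (P - Pᴴ) - (P - Pᴴ) * X) * V) i j‖ ^ 2 =
      ‖X * (P - Pᴴ) - (P - Pᴴ) * X‖ ^ 2 := by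
    rw [← frob_sq_eq_sum, norm_conj_unitary h.left h.right]
  have hent := fun i j => h.norm_entry_le (D := P - Pᴴ) i j
  generalize Uᴴ * (X * (P - Pᴴ) - (P - Pᴴ) * X) * V = Q at *
  have hterm : ∀ i j, κ * (‖Q i j‖ ^ 2 - η₀ ^ 2 * ‖P - Pᴴ‖ ^ 2) ≤
      (c₁ (s i) (s j) + c₂ (s i) (s j)) / (s i + s j) * ‖Q i j‖ ^ 2 := by
    intro i j
    have s1 := h.nonneg i
    have s2 := h.nonneg j
    rcases le_or_gt η₀ (s i + s j) with hle | hlt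
    · have h1 : m ≤ c₁ (s i) (s j) + c₂ (s i) (s j) := hmin (s i, s j) ⟨⟨hs i, hs j⟩, hle⟩
      have h2 : κ ≤ (c₁ (s i) (s j) + c₂ (s i) (s j)) / (s i + s j) :=
        div_le_div₀ (hm.le.trans h1) h1 (hη₀.trans_le hle) (by linarith [(hs i).2, (hs j).2])
      calc _ ≤ κ * ‖Q i j‖ ^ 2 := by
            gcongr
            have : 0 ≤ η₀ ^ 2 * ‖P - Pᴴ‖ ^ 2 := by positivity
            linarith
        _ ≤ _ := by gcongr
    · have h1 : ‖Q i j‖ ^ 2 ≤ η₀ ^ 2 * ‖P - Pᴴ‖ ^ 2 := by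
        rw [← mul_pow]
        refine pow_le_pow_left₀ (norm_nonneg _) ((hent i j).trans ?_) 2
        gcongr
      have h2 : 0 ≤ (c₁ (s i) (s j) + c₂ (s i) (s j)) / (s i + s j) := by
        rcases (add_nonneg s1 s2).eq_or_lt with h0 | h0
        · rw [← h0, div_zero]
        · exact (div_pos (hpos _ (hs i) _ (hs j) h0) h0).le
      have h3 : κ * (‖Q i j‖ ^ 2 - η₀ ^ 2 * ‖P - Pᴴ‖ ^ 2) ≤ 0 :=
        mul_nonpos_of_nonneg_of_nonpos hκ.le (by linarith)
      have : 0 ≤ (c₁ (s i) (s j) + c₂ (s i) (s j)) / (s i + s j) * ‖Q i j‖ ^ 2 := by positivity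
      linarith
  have hsum : κ * (‖X * (P - Pᴴ) - (P - Pᴴ) * X‖ ^ 2 - n ^ 2 * (η₀ ^ 2 * ‖P - Pᴴ‖ ^ 2)) ≤
      ∑ i, ∑ j, (c₁ (s i) (s j) + c₂ (s i) (s j)) / (s i + s j) * ‖Q i j‖ ^ 2 := by
    refine le_trans (le_of_eq ?_)
      (Finset.sum_le_sum fun i _ => Finset.sum_le_sum fun j _ => hterm i j)
    simp only [← Finset.mul_sum, Finset.sum_sub_distrib, hQ]
    congr 2
    simp
    ring
  have hn : n ^ 2 * η₀ ^ 2 ≤ 1 / (4 * C₀ ^ 2) := by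
    have : n ^ 2 * η₀ ^ 2 = 1 / (4 * C₀ ^ 2) * (n / (n + 1)) ^ 2 := by
      simp only [η₀]; field_simp; norm_num
    rw [this]
    refine mul_le_of_le_one_right (by positivity) (pow_le_one₀ (by positivity) ?_)
    exact (div_le_one (by positivity)).2 (by linarith)
  have hΔ : ‖P - Pᴴ‖ ^ 2 / C₀ ^ 2 ≤ ‖X * (P - Pᴴ) - (P - Pᴴ) * X‖ ^ 2 := by
    rw [div_le_iff₀ (by positivity), mul_comm, ← mul_pow]
    exact pow_le_pow_left₀ (norm_nonneg _) hPC 2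
  have hfin : κ * (3 / (4 * C₀ ^ 2) * ‖P - Pᴴ‖ ^ 2) ≤
      κ * (‖X * (P - Pᴴ) - (P - Pᴴ) * X‖ ^ 2 - n ^ 2 * (η₀ ^ 2 * ‖P - Pᴴ‖ ^ 2)) := by
    refine mul_le_mul_of_nonneg_left ?_ hκ.le
    have h1 := mul_le_mul_of_nonneg_right hn (sq_nonneg ‖P - Pᴴ‖)
    have h2 : ‖P - Pᴴ‖ ^ 2 / C₀ ^ 2 =
        3 / (4 * C₀ ^ 2) * ‖P - Pᴴ‖ ^ 2 + 1 / (4 * C₀ ^ 2) * ‖P - Pᴴ‖ ^ 2 := by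
      field_simp; norm_num
    linarith
  have h3 : κ * (3 / (4 * C₀ ^ 2) * ‖P - Pᴴ‖ ^ 2) = 3 * (κ / (4 * C₀ ^ 2) * ‖P - Pᴴ‖ ^ 2) := by
    ring
  have h4 := (abs_le.1 herr).1
  have h5 : 0 ≤ κ / (4 * C₀ ^ 2) * ‖P - Pᴴ‖ ^ 2 := by positivity
  linarith

/-- The commutator entries carry a factor s i + s j that cancels the denominator of the divided
difference, so the bound is uniform even when singular values vanish. -/
lemma exists_norm_commutator_phi_le (ha : 0 ≤ a) (hab : a < b)
    (hc₁ : IsDividedDifference a b φ₁ c₁) (hc₂ : IsDividedDifference a b φ₂ c₂) :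
    ∃ C : ℝ, ∀ X ∈ matricesIn n a b, ∀ P : Matrix (Fin n) (Fin n) ℂ, P * X = X * P →
      ‖⁅phi φ₁ φ₂ X, P⁆‖ ≤ C * ‖P - Pᴴ‖ := by
  have hb : 0 < b := ha.trans_lt hab
  have hS : IsCompact (Icc a b ×ˢ Icc a b) := isCompact_Icc.prod isCompact_Icc
  obtain ⟨B₁, hB₁⟩ := hS.exists_bound_of_continuousOn hc₁.continuous.continuousOn
  obtain ⟨B₂, hB₂⟩ := hS.exists_bound_of_continuousOn hc₂.continuous.continuousOn
  have scalar : ∀ (c B x y d : ℝ), |c| ≤ B → 0 ≤ x → x ≤ b → 0 ≤ y → y ≤ b → 0 ≤ d →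
      |c / (x + y)| * ((x + y) * (b * d)) ≤ |B| * b * d := by
    intro c B x y d hcB hx hxb hy hyb hd
    rcases (add_nonneg hx hy).eq_or_lt with h0 | h0
    · rw [← h0]; simp; positivity
    · rw [abs_div, abs_of_pos h0]
      have : |c| / (x + y) * ((x + y) * (b * d)) = |c| * b * d := by field_simp
      rw [this]
      have := hcB.trans (le_abs_self B)
      gcongr
  refine ⟨n * (|B₁| * b) + n * (|B₂| * b), fun X hX P hP => ?_⟩
  obtain ⟨U, V, s, h⟩ := exists_isSVD X
  have hs := h.mem_matricesIn.1 hX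
  have hnn : 0 ≤ ‖P - Pᴴ‖ := norm_nonneg _
  have eY := fun i j => MatrixFlow.norm_entry_le (Vᴴ * (P - Pᴴ) * V) i j
  have eZ := fun i j => MatrixFlow.norm_entry_le (Uᴴ * (P - Pᴴ) * U) i j
  simp only [norm_conj_unitary h.right h.right] at eY
  simp only [norm_conj_unitary h.left h.left] at eZ
  have n₁ : ‖P * (V * dg (fun i => φ₁ (s i)) * Vᴴ) - (V * dg (fun i => φ₁ (s i)) * Vᴴ) * P‖ ≤
      n * (|B₁| * b * ‖P - Pᴴ‖) := by
    rw [← norm_conj_unitary h.right h.right]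
    refine norm_le_of_entry_le (by positivity) fun i j => ?_
    rw [h.right_commutator_entry hP ha hs hc₁, norm_mul, Complex.norm_real, Real.norm_eq_abs]
    refine le_trans (mul_le_mul_of_nonneg_left ?_ (abs_nonneg _))
      (scalar _ B₁ _ _ _ (hB₁ (s i, s j) ⟨hs i, hs j⟩) (h.nonneg i) (hs i).2 (h.nonneg j)
        (hs j).2 hnn)
    refine (norm_sub_le _ _).trans ?_
    simp only [norm_mul, norm_pow, Complex.norm_real, Real.norm_of_nonneg (h.nonneg _)]
    have s1 := h.nonneg i
    have s2 := h.nonneg j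
    calc _ ≤ s j ^ 2 * ‖P - Pᴴ‖ + s i * s j * ‖P - Pᴴ‖ := by
          gcongr
          · exact eY i j
          · exact eZ i j
      _ = (s i + s j) * (s j * ‖P - Pᴴ‖) := by ring
      _ ≤ _ := by
        have := (hs j).2
        gcongr
  have n₂ : ‖P * (U * dg (fun i => φ₂ (s i)) * Uᴴ) - (U * dg (fun i => φ₂ (s i)) * Uᴴ) * P‖ ≤
      n * (|B₂| * b * ‖P - Pᴴ‖) := by
    rw [← norm_conj_unitary h.left h.left]
    refine norm_le_of_entry_le (by positivity) fun i j => ?_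
    rw [h.left_commutator_entry hP ha hs hc₂, norm_mul, Complex.norm_real, Real.norm_eq_abs]
    refine le_trans (mul_le_mul_of_nonneg_left ?_ (abs_nonneg _))
      (scalar _ B₂ _ _ _ (hB₂ (s i, s j) ⟨hs i, hs j⟩) (h.nonneg i) (hs i).2 (h.nonneg j)
        (hs j).2 hnn)
    refine (norm_sub_le _ _).trans ?_
    simp only [norm_mul, norm_pow, Complex.norm_real, Real.norm_of_nonneg (h.nonneg _)]
    have s1 := h.nonneg i
    have s2 := h.nonneg j
    calc _ ≤ s i * s j * ‖P - Pᴴ‖ + s i ^ 2 * ‖P - Pᴴ‖ := by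
          gcongr
          · exact eY i j
          · exact eZ i j
      _ = (s i + s j) * (s i * ‖P - Pᴴ‖) := by ring
      _ ≤ _ := by
        have := (hs i).2
        gcongr
  have e : ⁅phi φ₁ φ₂ X, P⁆ =
      (P * (U * dg (fun i => φ₂ (s i)) * Uᴴ) - (U * dg (fun i => φ₂ (s i)) * Uᴴ) * P) -
      (P * (V * dg (fun i => φ₁ (s i)) * Vᴴ) - (V * dg (fun i => φ₁ (s i)) * Vᴴ) * P) := by
    rw [h.phi_eq, Ring.lie_def]
    noncomm_ring
  rw [e]
  refine (norm_sub_le _ _).trans ((add_le_add n₂ n₁).trans (le_of_eq ?_))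
  ring

end

/-! ### Convergence of spectral idempotents and of the flow. -/

section

/-- A curve whose speed decays exponentially converges. -/
lemma exists_tendsto_of_norm_deriv_le_exp {E : Type*} [NormedAddCommGroup E] [NormedSpace ℝ E]
    [CompleteSpace E] {f f' : ℝ → E} {t₀ K c : ℝ} (hc : 0 < c)
    (h : ∀ t ∈ Ici t₀, HasDerivWithinAt f (f' t) (Ici t₀) t)
    (hb : ∀ t ∈ Ici t₀, ‖f' t‖ ≤ K * Real.exp (-(c * t))) : ∃ Q, Tendsto f atTop (𝓝 Q) := by
  have key : ∀ t ∈ Ici t₀, ∀ u, t ≤ u → ‖f u - f t‖ ≤ K / c * Real.exp (-(c * t)) := by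
    intro t ht u hu
    have hsub : Icc t u ⊆ Ici t₀ := fun v hv => mem_Ici.2 ((mem_Ici.1 ht).trans hv.1)
    have hB : ∀ v, HasDerivAt (fun v => K / c * (Real.exp (-(c * t)) - Real.exp (-(c * v))))
        (K * Real.exp (-(c * v))) v := by
      intro v
      have h1 := ((((hasDerivAt_id v).const_mul c).fun_neg.exp).const_sub
        (Real.exp (-(c * t)))).const_mul (K / c)
      have e : K / c * -(Real.exp (-(c * id v)) * -(c * 1)) = K * Real.exp (-(c * v)) := by
        simp only [id]; field_simp
      rw [e] at h1
      exact h1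
    have hmain := image_norm_le_of_norm_deriv_right_le_deriv_boundary (a := t) (b := u)
      (f := fun v => f v - f t) (f' := f')
      (fun v hv => (((h v (hsub hv)).continuousWithinAt).mono hsub).sub continuousWithinAt_const)
      (fun v hv => ((h v (hsub ⟨hv.1, hv.2.le⟩)).mono
        (Ici_subset_Ici.2 (hsub ⟨hv.1, hv.2.le⟩))).sub_const (f t))
      (B := fun v => K / c * (Real.exp (-(c * t)) - Real.exp (-(c * v)))) (by simp) hB
      (fun v hv => hb v (hsub ⟨hv.1, hv.2.le⟩)) (right_mem_Icc.2 hu)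
    have hK : 0 ≤ K := nonneg_of_mul_nonneg_left ((norm_nonneg _).trans (hb t ht))
      (Real.exp_pos _)
    refine hmain.trans (mul_le_mul_of_nonneg_left ?_ (by positivity))
    linarith [Real.exp_pos (-(c * u))]
  refine cauchySeq_tendsto_of_complete (Metric.cauchySeq_iff'.2 fun ε hε => ?_)
  have hlim : Tendsto (fun t => K / c * Real.exp (-(c * t))) atTop (𝓝 0) := by
    rw [← mul_zero (K / c)]
    exact (Real.tendsto_exp_neg_atTop_nhds_zero.comp (tendsto_id.const_mul_atTop hc)).const_mul _
  obtain ⟨N, hN, hNt⟩ := ((hlim.eventually (gt_mem_nhds hε)).and (eventually_ge_atTop t₀)).exists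
  exact ⟨N, fun u hu => by rw [dist_eq_norm]; exact (key N hNt u hu).trans_lt hN⟩

lemma commute_aeval {Z y : Matrix (Fin n) (Fin n) ℂ} (h : Commute Z y) (p : ℂ[X]) :
    Commute Z (aeval y p) := by
  induction p using Polynomial.induction_on' with
  | add p q hp hq => rw [map_add]; exact hp.add_right hq
  | monomial k r =>
    rw [aeval_monomial]
    exact (Algebra.commute_algebraMap_right r Z).mul_right (h.pow_right k)

/-- Idempotents which are polynomials in a global solution converge. -/
lemma IsGlobalSolution.tendsto_aeval_idempotent {a b : ℝ} (ha : 0 ≤ a) (hab : a < b)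
    {φ₁ φ₂ : ℝ → ℝ} {c₁ c₂ : ℝ → ℝ → ℝ} {K : ℝ≥0} (m₁ : Monotone φ₁) (m₂ : Monotone φ₂)
    (h₁ : LipschitzWith K φ₁) (h₂ : LipschitzWith K φ₂)
    (hs : StrictMonoOn (fun x => φ₁ x + φ₂ x) (Icc a b))
    (hc₁ : IsDividedDifference a b φ₁ c₁) (hc₂ : IsDividedDifference a b φ₂ c₂)
    (hpos : ∀ x ∈ Icc a b, ∀ y ∈ Icc a b, 0 < x + y → 0 < c₁ x y + c₂ x y)
    {T : Matrix (Fin n) (Fin n) ℂ} {X : ℝ → Matrix (Fin n) (Fin n) ℂ}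
    (hX : IsGlobalSolution a b φ₁ φ₂ T X) {p : ℂ[X]}
    (hp : ∀ t ∈ Ici (0 : ℝ), aeval (X t) p * aeval (X t) p = aeval (X t) p) :
    ∃ Q, Tendsto (fun t => aeval (X t) p) atTop (𝓝 Q) := by
  obtain ⟨R, -, -, -, hR, -⟩ := hX.exists_bounds ha hab h₁ h₂
  obtain ⟨C, B, hC, -, hCB⟩ := norm_commutator_aeval_le (n := n) R p
  have hC1 : 0 < C + 1 := by linarith
  obtain ⟨c, hc, η, hη, hdecay⟩ := exists_decay_rate (n := n) ha hab hc₁ hc₂ hpos hC1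
  obtain ⟨M, hM⟩ := exists_norm_commutator_phi_le (n := n) ha hab hc₁ hc₂
  obtain ⟨t₀, ht₀⟩ := eventually_atTop.1
    (((hX.tendsto_abs_sub ha hab m₁ m₂ h₁ h₂ hs).eventually (gt_mem_nhds hη)).and
      (eventually_ge_atTop 0))
  have hsub : Ici t₀ ⊆ Ici (0 : ℝ) := fun t ht => mem_Ici.2 (ht₀ t ht).2
  set P : ℝ → Matrix (Fin n) (Fin n) ℂ := fun t => aeval (X t) p with hPdef
  have hPX : ∀ t, P t * X t = X t * P t := fun t =>
    (commute_aeval (Commute.refl (X t)) p).eq.symm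
  have hPd : ∀ t ∈ Ici t₀, HasDerivWithinAt P ⁅phi φ₁ φ₂ (X t), P t⁆ (Ici t₀) t := fun t ht =>
    HasDerivWithinAt.lie_aeval ((hX.hasDeriv t (hsub ht)).mono hsub) p
  set g : ℝ → ℝ := fun t => ‖P t - (P t)ᴴ‖ ^ 2 with hg
  have hgd : ∀ t ∈ Ici t₀, HasDerivWithinAt g
      (2 * (2 * (phi φ₁ φ₂ (X t) * (P t * (P t)ᴴ - (P t)ᴴ * P t)).trace.re)) (Ici t₀) t := by
    intro t ht
    have d1 := lie_trace_pow_deriv (conjTranspose_phi _ _ _) (hPd t ht) 0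
    have d2 := hasDerivWithinAt_re_trace (hPd t ht)
    have e0 : (⁅phi φ₁ φ₂ (X t), P t⁆.trace).re = 0 := by
      rw [Ring.lie_def, Matrix.trace_sub, Matrix.trace_mul_comm, sub_self, Complex.zero_re]
    rw [e0] at d2
    have d3 := (d1.const_mul 2).fun_sub (d2.const_mul 2)
    simp only [zero_add, pow_one, Nat.cast_zero, mul_one, mul_zero, sub_zero] at d3
    refine d3.congr (fun u hu => ?_) ?_
    · exact norm_sq_sub_conjTranspose (hp u (hsub hu))
    · exact norm_sq_sub_conjTranspose (hp t (hsub ht))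
  have hgle : ∀ t ∈ Ici t₀,
      2 * (2 * (phi φ₁ φ₂ (X t) * (P t * (P t)ᴴ - (P t)ᴴ * P t)).trace.re) ≤ -(2 * c * g t) := by
    intro t ht
    have ht' := hsub ht
    have h3 := hdecay (X t) (hX.mem t ht') (ht₀ t ht).1.le (P t) (hPX t) (by
      have h4 := (hCB (X t) (hR t ht')).2 (P t - (P t)ᴴ)
      have h5 := norm_sub_conjTranspose_le (hp t ht')
      refine h5.trans (h4.trans ?_)
      gcongr
      linarith)
    linarith
  -- Grönwall with an integrating factor: g' ≤ −2c g, so ‖P − P*‖ = √g decays like exp(−c t).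
  have hanti : AntitoneOn (fun t => Real.exp (2 * c * t) * g t) (Ici t₀) := by
    have hd : ∀ t ∈ Ici t₀, HasDerivWithinAt (fun t => Real.exp (2 * c * t) * g t)
        (Real.exp (2 * c * t) * (2 * c * 1) * g t + Real.exp (2 * c * t) *
          (2 * (2 * (phi φ₁ φ₂ (X t) * (P t * (P t)ᴴ - (P t)ᴴ * P t)).trace.re))) (Ici t₀) t :=
      fun t ht => (((hasDerivAt_id t).const_mul (2 * c)).exp.hasDerivWithinAt).fun_mul (hgd t ht)
    refine antitoneOn_of_hasDerivWithinAt_nonpos (convex_Ici _)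
      (fun t ht => (hd t ht).continuousWithinAt)
      (fun t ht => (hd t (interior_subset ht)).mono interior_subset) fun t ht => ?_
    have h1 := hgle t (interior_subset ht)
    have h2 := Real.exp_pos (2 * c * t)
    nlinarith
  set G := Real.exp (2 * c * t₀) * g t₀ with hG
  refine exists_tendsto_of_norm_deriv_le_exp (K := |M| * √G) hc hPd fun t ht => ?_
  have hgt : g t ≤ G * Real.exp (-(2 * c * t)) := by
    have h1 : Real.exp (2 * c * t) * g t ≤ G := hanti (mem_Ici.2 le_rfl) ht ht
    rw [Real.exp_neg, ← div_eq_mul_inv, le_div_iff₀ (Real.exp_pos _), mul_comm]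
    exact h1
  have hGn : 0 ≤ G := by positivity
  have hsq : ‖P t - (P t)ᴴ‖ ≤ √G * Real.exp (-(c * t)) := by
    refine (sq_le_sq₀ (norm_nonneg _) (by positivity)).1 ?_
    rw [mul_pow, Real.sq_sqrt hGn, ← Real.exp_nat_mul]
    refine hgt.trans (le_of_eq ?_)
    congr 2
    push_cast
    ring
  calc _ ≤ M * ‖P t - (P t)ᴴ‖ := hM (X t) (hX.mem t (hsub ht)) (P t) (hPX t)
    _ ≤ |M| * (√G * Real.exp (-(c * t))) :=
      mul_le_mul (le_abs_self M) hsq (norm_nonneg _) (abs_nonneg _)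
    _ = _ := by ring

/-- A normal nilpotent matrix vanishes. -/
lemma eq_zero_of_pow_eq_zero_of_normal {w : Matrix (Fin n) (Fin n) ℂ}
    (hw : wᴴ * w = w * wᴴ) {k : ℕ} (hk : w ^ k = 0) : w = 0 := by
  obtain ⟨U, V, s, h⟩ := exists_isSVD w
  have h0 : (wᴴ * w) ^ (k + 1) = 0 := by
    rw [(show Commute wᴴ w from hw).mul_pow, pow_succ w, hk, zero_mul, mul_zero]
  have hs : ∀ i, s i = 0 := by
    intro i
    have h1 := pow_le_trace_pow h k i
    rw [h0, Matrix.trace_zero, Complex.zero_re] at h1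
    have h2 : (s i ^ 2) ^ (k + 1) = 0 := le_antisymm h1 (by positivity)
    simpa using h2
  have h3 := h.norm_sq
  simp only [hs] at h3
  simpa using h3

lemma normal_aeval {y : Matrix (Fin n) (Fin n) ℂ} (h : yᴴ * y = y * yᴴ) (p : ℂ[X]) :
    (aeval y p)ᴴ * aeval y p = aeval y p * (aeval y p)ᴴ := by
  have h1 : Commute yᴴ (aeval y p) := commute_aeval h p
  have h2 : Commute (aeval y p)ᴴ y := by
    have := congrArg Matrix.conjTranspose h1.eq
    simpa [Commute, SemiconjBy] using this
  exact commute_aeval h2 p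

/-- The spectral projections and the nilpotent part of a matrix are polynomials in it. -/
lemma exists_spectral_polynomials (T : Matrix (Fin n) (Fin n) ℂ) :
    ∃ (S : Finset ℂ) (e : ℂ → ℂ[X]) (ν : ℂ[X]) (k : ℕ),
      (∀ μ ∈ S, aeval T (e μ * e μ - e μ) = 0) ∧ aeval T (ν ^ k) = 0 ∧
      aeval T (Polynomial.X - ν - ∑ μ ∈ S, C μ * e μ) = 0 := by
  let Φ : Matrix (Fin n) (Fin n) ℂ ≃ₐ[ℂ] Module.End ℂ (Fin n → ℂ) := Matrix.toLinAlgEquiv'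
  set f := Φ T with hf
  have hΦ : ∀ p : ℂ[X], aeval f p = 0 → aeval T p = 0 := by
    intro p hp
    apply Φ.injective
    rw [map_zero, ← hp, hf, Polynomial.aeval_algEquiv, AlgHom.comp_apply]
    rfl
  -- Jordan–Chevalley: both parts lie in the algebra generated by f, hence are polynomials in it.
  obtain ⟨ν', hν', s, hs, ⟨k, hk⟩, hss, hfs⟩ := f.exists_isNilpotent_isSemisimple
  rw [Algebra.adjoin_singleton_eq_range_aeval] at hν' hs
  obtain ⟨ν, rfl⟩ := hν'
  obtain ⟨σ, rfl⟩ := hs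
  set s := aeval f σ with hsdef
  set m := minpoly ℂ s with hm
  have hmm : m.Monic := minpoly.monic (Algebra.IsIntegral.isIntegral s)
  have hsep : m.Separable := (PerfectField.separable_iff_squarefree).2 hss.minpoly_squarefree
  set S := m.roots.toFinset with hS
  -- The minimal polynomial of the semisimple part is squarefree and split, so q kills s as soon as
  -- it vanishes at its roots. Hence the Lagrange basis at these roots yields the idempotents.
  have hdvd : ∀ q : ℂ[X], (∀ μ ∈ S, q.eval μ = 0) → aeval s q = 0 := by
    intro q hq
    have : m ∣ q := by
      rcases eq_or_ne q 0 with rfl | hq0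
      · exact dvd_zero _
      refine (IsAlgClosed.dvd_iff_roots_le_roots hmm.ne_zero hq0).2 ?_
      refine (Multiset.le_iff_subset (nodup_roots hsep)).2 fun μ hμ => ?_
      exact (mem_roots hq0).2 (hq μ (Multiset.mem_toFinset.2 hμ))
    obtain ⟨r, rfl⟩ := this
    rw [map_mul, hm, minpoly.aeval, zero_mul]
  refine ⟨S, fun μ => (Lagrange.basis S id μ).comp σ, ν, k, fun μ hμ => hΦ _ ?_, hΦ _ ?_,
    hΦ _ ?_⟩
  · rw [← mul_comp, ← sub_comp, aeval_comp]
    refine hdvd _ fun μ' hμ' => ?_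
    rcases eq_or_ne μ' μ with rfl | hne
    · have := Lagrange.eval_basis_self (v := id) (injOn_id (S : Set ℂ)) hμ'
      simp only [id] at this
      simp [this]
    · have := Lagrange.eval_basis_of_ne (v := (id : ℂ → ℂ)) hne.symm hμ'
      simp only [id] at this
      simp [this]
  · rw [map_pow]; exact hk
  · have e : aeval f (∑ μ ∈ S, C μ * (Lagrange.basis S id μ).comp σ) =
        aeval s (∑ μ ∈ S, C μ * Lagrange.basis S id μ) := by
      simp [map_sum, aeval_comp, hsdef]
    have h1 : aeval s (∑ μ ∈ S, C μ * Lagrange.basis S id μ - Polynomial.X) = 0 := by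
      refine hdvd _ fun μ hμ => ?_
      rw [eval_sub, eval_finsetSum, eval_X, Finset.sum_eq_single μ]
      · have := Lagrange.eval_basis_self (v := id) (injOn_id (S : Set ℂ)) hμ
        simp only [id] at this
        simp [this]
      · intro μ' hμ' hne
        have := Lagrange.eval_basis_of_ne (v := (id : ℂ → ℂ)) hne hμ
        simp only [id] at this
        simp [this]
      · exact fun h => absurd hμ h
    rw [map_sub, aeval_X, sub_eq_zero] at h1
    rw [map_sub, map_sub, aeval_X, e, h1]
    have h2 : f = aeval f ν + s := hfs
    rw [sub_sub, ← h2, sub_self]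

lemma eq_of_mapClusterPt {α β γ : Type*} [TopologicalSpace β] [TopologicalSpace γ] [T2Space γ]
    {l : Filter α} {u : α → β} {F : β → γ} {y : β} {L : γ} (hy : MapClusterPt y l u)
    (hF : Continuous F) (h : Tendsto (fun t => F (u t)) l (𝓝 L)) : F y = L :=
  eq_of_nhds_neBot (ClusterPt.mono (hy.continuousAt_comp hF.continuousAt) h)

/-- A global solution converges to a normal matrix. -/
lemma IsGlobalSolution.exists_tendsto_normal {a b : ℝ} (ha : 0 ≤ a) (hab : a < b)
    {φ₁ φ₂ : ℝ → ℝ} {c₁ c₂ : ℝ → ℝ → ℝ} {K : ℝ≥0} (m₁ : Monotone φ₁) (m₂ : Monotone φ₂)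
    (h₁ : LipschitzWith K φ₁) (h₂ : LipschitzWith K φ₂)
    (hs : StrictMonoOn (fun x => φ₁ x + φ₂ x) (Icc a b))
    (hc₁ : IsDividedDifference a b φ₁ c₁) (hc₂ : IsDividedDifference a b φ₂ c₂)
    (hpos : ∀ x ∈ Icc a b, ∀ y ∈ Icc a b, 0 < x + y → 0 < c₁ x y + c₂ x y)
    {T : Matrix (Fin n) (Fin n) ℂ} {X : ℝ → Matrix (Fin n) (Fin n) ℂ}
    (hX : IsGlobalSolution a b φ₁ φ₂ T X) :
    ∃ N : Matrix (Fin n) (Fin n) ℂ, IsStarNormal N ∧ Tendsto X atTop (𝓝 N) := by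
  obtain ⟨R, B, -, -, hR, hB⟩ := hX.exists_bounds ha hab h₁ h₂
  obtain ⟨S, e, ν, k, he, hν, hsum⟩ := exists_spectral_polynomials T
  have hzero : ∀ p : ℂ[X], aeval T p = 0 → ∀ t ∈ Ici (0 : ℝ), aeval (X t) p = 0 :=
    fun p hp t ht => aeval_lie_solution_eq_zero hX.hasDeriv hB (by rwa [hX.init]) ht
  have hQ : ∀ μ ∈ S, ∃ Q, Tendsto (fun t => aeval (X t) (e μ)) atTop (𝓝 Q) := by
    refine fun μ hμ => hX.tendsto_aeval_idempotent ha hab m₁ m₂ h₁ h₂ hs hc₁ hc₂ hpos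
      fun t ht => ?_
    have := hzero _ (he μ hμ) t ht
    rwa [map_sub, map_mul, sub_eq_zero] at this
  choose! Q hQ using hQ
  have hcl0 : ∀ y, MapClusterPt y atTop X → ∀ p : ℂ[X], aeval T p = 0 → aeval y p = 0 :=
    fun y hy p hp => eq_of_mapClusterPt (F := fun Y => aeval Y p) hy
      (Polynomial.continuous_aeval p) (tendsto_const_nhds.congr' (by
        filter_upwards [eventually_ge_atTop 0] with t ht using (hzero p hp t ht).symm))
  have hnormal : ∀ y, MapClusterPt y atTop X → yᴴ * y = y * yᴴ := by
    intro y hy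
    -- Realising |Y| − |Y*| as φ(Y) for φ₁ = φ₂ = id supplies its continuity.
    have hphi : ∀ Y : Matrix (Fin n) (Fin n) ℂ, phi id id Y = CFC.abs Y - CFC.abs Yᴴ :=
      fun Y => by
        rw [phi, cfc_id ℝ _ (CFC.abs_nonneg Y).isSelfAdjoint,
          cfc_id ℝ _ (CFC.abs_nonneg Yᴴ).isSelfAdjoint]
    have h0 : phi id id y = 0 := by
      refine eq_of_mapClusterPt hy
        (lipschitzWith_phi (LipschitzWith.id) (LipschitzWith.id)).continuous ?_
      simp only [hphi]
      exact tendsto_zero_iff_norm_tendsto_zero.2 (hX.tendsto_abs_sub ha hab m₁ m₂ h₁ h₂ hs)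
    rw [hphi, sub_eq_zero] at h0
    have h1 := CFC.abs_mul_abs y
    rw [h0, CFC.abs_mul_abs, Matrix.star_eq_conjTranspose, Matrix.star_eq_conjTranspose,
      Matrix.conjTranspose_conjTranspose] at h1
    exact h1.symm
  have hunique : ∀ y, MapClusterPt y atTop X → y = ∑ μ ∈ S, algebraMap ℂ _ μ * Q μ := by
    intro y hy
    have hν0 : aeval y ν = 0 := by
      have := hcl0 y hy _ hν
      rw [map_pow] at this
      exact eq_zero_of_pow_eq_zero_of_normal (normal_aeval (hnormal y hy) ν) this
    have h1 := hcl0 y hy _ hsum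
    rw [map_sub, map_sub, aeval_X, hν0, sub_zero, sub_eq_zero, map_sum] at h1
    refine h1.trans (Finset.sum_congr rfl fun μ hμ => ?_)
    rw [map_mul, aeval_C, eq_of_mapClusterPt (F := fun Y => aeval Y (e μ)) hy
      (Polynomial.continuous_aeval (e μ)) (hQ μ hμ)]
  have hlim : Tendsto X atTop (𝓝 (∑ μ ∈ S, algebraMap ℂ _ μ * Q μ)) := by
    refine IsCompact.tendsto_nhds_of_unique_mapClusterPt
      (isCompact_closedBall (0 : Matrix (Fin n) (Fin n) ℂ) R) ?_ fun y _ hy => hunique y hy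
    filter_upwards [eventually_ge_atTop 0] with t ht
    rw [mem_closedBall_zero_iff]
    exact hR t ht
  exact ⟨_, ⟨hnormal _ hlim.mapClusterPt⟩, hlim⟩

/-- A function which is monotone and Lipschitz on an interval has an extension with these
properties to the line. -/
lemma exists_monotone_lipschitz_extension {a b : ℝ} (hab : a < b) {φ : ℝ → ℝ} {K : ℝ≥0}
    (hm : MonotoneOn φ (Icc a b)) (hK : LipschitzOnWith K φ (Icc a b)) :
    ∃ ψ : ℝ → ℝ, Monotone ψ ∧ LipschitzWith K ψ ∧ EqOn φ ψ (Icc a b) := by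
  refine ⟨fun x => φ (projIcc a b hab.le x), fun x y hxy =>
    hm (projIcc a b hab.le x).2 (projIcc a b hab.le y).2 (monotone_projIcc hab.le hxy), ?_, ?_⟩
  · intro x y
    refine (hK (projIcc a b hab.le x).2 (projIcc a b hab.le y).2).trans ?_
    gcongr
    have := (LipschitzWith.projIcc hab.le) x y
    rwa [ENNReal.coe_one, one_mul] at this
  · intro x hx
    simp only [projIcc_of_mem hab.le hx]

lemma IsDividedDifference.congr {a b : ℝ} {φ ψ : ℝ → ℝ} {c : ℝ → ℝ → ℝ}
    (h : IsDividedDifference a b φ c) (he : EqOn φ ψ (Icc a b)) :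
    IsDividedDifference a b ψ c where
  continuous := h.continuous
  sub_eq x hx y hy := by rw [← he hx, ← he hy, h.sub_eq x hx y hy]
  diag x hx := by rw [h.diag x hx, derivWithin_congr he (he hx)]

lemma IsGlobalSolution.congr {a b : ℝ} {φ₁ φ₂ ψ₁ ψ₂ : ℝ → ℝ} (h₁ : EqOn φ₁ ψ₁ (Icc a b))
    (h₂ : EqOn φ₂ ψ₂ (Icc a b)) {T : Matrix (Fin n) (Fin n) ℂ}
    {X : ℝ → Matrix (Fin n) (Fin n) ℂ} (hX : IsGlobalSolution a b φ₁ φ₂ T X) :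
    IsGlobalSolution a b ψ₁ ψ₂ T X where
  init := hX.init
  mem := hX.mem
  hasDeriv t ht := by rw [← phi_congr h₁ h₂ (hX.mem t ht)]; exact hX.hasDeriv t ht

/-- Under the condition (C1), the flow exists and converges to a normal matrix, in every
dimension and for every initial value. -/
theorem flowConvergesToNormal {a b : ℝ} (ha : 0 ≤ a) (hab : a < b) {φ₁ φ₂ : ℝ → ℝ}
    (hφ : CondC1 a b φ₁ φ₂) {T : Matrix (Fin n) (Fin n) ℂ} (hT : T ∈ matricesIn n a b) :
    FlowConvergesToNormal a b φ₁ φ₂ T := by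
  obtain ⟨K₁, hK₁⟩ := hφ.lipschitzOn₁
  obtain ⟨K₂, hK₂⟩ := hφ.lipschitzOn₂
  obtain ⟨ψ₁, m₁, h₁, e₁⟩ := exists_monotone_lipschitz_extension hab hφ.monotoneOn₁
    (hK₁.weaken (le_max_left K₁ K₂))
  obtain ⟨ψ₂, m₂, h₂, e₂⟩ := exists_monotone_lipschitz_extension hab hφ.monotoneOn₂
    (hK₂.weaken (le_max_right K₁ K₂))
  obtain ⟨c₁, hc₁⟩ := exists_isDividedDifference hab hφ.contDiffOn₁
  obtain ⟨c₂, hc₂⟩ := exists_isDividedDifference hab hφ.contDiffOn₂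
  have hs : StrictMonoOn (fun x => ψ₁ x + ψ₂ x) (Icc a b) := by
    refine hφ.strictMonoOn_add.congr fun x hx => ?_
    simp only [e₁ hx, e₂ hx]
  -- Off the diagonal this is strict monotonicity of φ₁ + φ₂; on it, positivity of the derivative.
  -- The point (0, 0), where the derivative may vanish, is excluded.
  have hpos : ∀ x ∈ Icc a b, ∀ y ∈ Icc a b, 0 < x + y → 0 < c₁ x y + c₂ x y := by
    intro x hx y hy hxy
    have hstrict : ∀ u ∈ Icc a b, ∀ v ∈ Icc a b, u < v → φ₁ u + φ₂ u < φ₁ v + φ₂ v :=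
      fun u hu v hv huv => hφ.strictMonoOn_add hu hv huv
    have e : (φ₁ y + φ₂ y) - (φ₁ x + φ₂ x) = (c₁ x y + c₂ x y) * (y - x) := by
      linear_combination hc₁.sub_eq x hx y hy + hc₂.sub_eq x hx y hy
    rcases lt_trichotomy x y with h | rfl | h
    · have := hstrict x hx y hy h
      exact pos_of_mul_pos_left (b := y - x) (by linarith) (by linarith)
    · rw [hc₁.diag x hx, hc₂.diag x hx]
      exact hφ.deriv_pos x ⟨hx, fun h0 => by
        rw [mem_singleton_iff] at h0; linarith⟩
    · have := hstrict y hy x hx h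
      by_contra hneg
      nlinarith [mul_nonneg_of_nonpos_of_nonpos (not_lt.1 hneg) (sub_nonpos.2 h.le)]
  obtain ⟨X, hX⟩ := exists_isGlobalSolution ha hab m₁ m₂ h₁ h₂ hT
  exact ⟨X, ⟨hX.congr e₁.symm e₂.symm, fun Z hZ =>
    isGlobalSolution_unique ha hab h₁ h₂ hX (hZ.congr e₁ e₂)⟩,
    hX.exists_tendsto_normal ha hab m₁ m₂ h₁ h₂ hs (hc₁.congr e₁) (hc₂.congr e₂) hpos⟩

end

end MatrixFlow

theorem mainTheorem10 (a b : ℝ) (ha : 0 ≤ a) (hab : a < b) (φ₁ φ₂ : ℝ → ℝ)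
    (hφ : MatrixFlow.CondC1 a b φ₁ φ₂) (T : Matrix (Fin 3) (Fin 3) ℂ)
    (hT : T ∈ MatrixFlow.matricesIn 3 a b) :
    (a = 0 → LinearMap.ker (Matrix.toLin' T) ≠ ⊥ →
      MatrixFlow.FlowConvergesToNormal a b φ₁ φ₂ T) ∧
    (0 < a → ContDiffOn ℝ 2 φ₁ (Set.Icc a b) → ContDiffOn ℝ 2 φ₂ (Set.Icc a b) →
      MatrixFlow.FlowConvergesToNormal a b φ₁ φ₂ T) :=
  ⟨fun _ _ => MatrixFlow.flowConvergesToNormal ha hab hφ hT,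
    fun _ _ _ => MatrixFlow.flowConvergesToNormal ha hab hφ hT⟩
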